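/- Let $\tilde\sigma>0$, $E>0$, $T>0$, $r,q,\gamma\in\mathbb R$, $\delta\ge 0$ with $\delta\neq 1$, and let $A$ be a real function, continuous on $(0,T]$. Put $$\alpha=\tfrac12+\tfrac{q-r}{\tilde\sigma^2},\qquad \beta=-\Big(\tfrac{\tilde\sigma^2}{8}+\tfrac{r+q}{2}+\tfrac{(r-q)^2}{2\tilde\sigma^2}\Big),\qquad P=\gamma-\delta-\alpha(1-\delta),$$ $$Q(\tau,\xi)=\delta\tau+(1-\delta)\xi,\qquad \Lambda(\tau,\xi)=(2\pi\tilde\sigma^2)^{\delta/2}\,\xi^{(\delta-1)/2}\sqrt{Q(\tau,\xi)} .$$ Below, $\int_0^\tau g(\xi)\,d\xi$ means $\lim_{\varepsilon\to0^+}\int_\varepsilon^\tau g(\xi)\,d\xi$; this is the Lebesgue integral whenever $g$ is integrable on $(0,\tau)$, which for the integrals below is the case if $A$ is bounded and $\delta<3$. **(i)** Let $u(x,\tau)$ be a classical solution of $$\frac{\partial u}{\partial\tau}-\frac{\tilde\sigma^2}{2}\frac{\partial^2u}{\partial x^2}=\frac{E^\gamma A(\tau)}{(2\pi\tilde\sigma^2\tau)^{\delta/2}}\,e^{-\frac{\delta}{2\tilde\sigma^2\tau}x^2+Px-\left[\beta+q\delta+\frac\delta2(1-\alpha)^2\tilde\sigma^2\right]\tau},\qquad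 u(x,0)=0,\qquad (x,\tau)\in\mathbb R\times[0,T],$$ that is, $u$ is continuous on $\mathbb R\times(0,T]$, the derivatives exist and the equation holds on $\mathbb R\times(0,T)$, and the initial value is attained in the sense of distributions, $u(\cdot,\tau)\to0$ as $\tau\to0^+$. Suppose that $|u(x,\tau)|\le Me^{b|x|^2}$ for all $x\in\mathbb R$, $\tau\in[0,T]$, with some constants $M,b$. Then for all $x\in\mathbb R$ and $\tau\in(0,T]$ $$u(x,\tau)=E^\gamma\int_0^\tau\frac{A(\xi)}{\Lambda(\tau,\xi)}\,e^{\left[\frac{P^2\tilde\sigma^2}{2(\delta-1)}+\beta(\delta-1)\right]\xi+\frac{Px}{1-\delta}+\frac{P^2\tilde\sigma^2\tau}{2(1-\delta)^2}-\left[\frac{\delta x^2}{2\tilde\sigma^2}+\frac{Px\delta\tau}{1-\delta}+\frac{P^2\tilde\sigma^2\delta\tau^2}{2(1-\delta)^2}\right]\frac1{Q(\tau,\xi)}}\,d\xi .$$ **(ii)** Let $V_0(S,t)$ be the Black–Scholes price of the European call or put with expiration price $E$, maturity $T$, volatility $\tilde\sigma$, interest rate $r$ and dividend yield $q$. Let $V_1(S,t)$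 be the first-order correction for the volatility law $\sigma^2=\tilde\sigma^2+2\varepsilon A(T-t)S^{\gamma-1}\big(S\,\partial_S^2V\big)^{\delta-1}$, i.e. a classical solution of $$\frac{\partial V_1}{\partial t}+\frac{\tilde\sigma^2}{2}S^2\frac{\partial^2V_1}{\partial S^2}+(r-q)S\frac{\partial V_1}{\partial S}-rV_1=-A(T-t)\,S^\gamma\Big(S\frac{\partial^2V_0}{\partial S^2}\Big)^{\delta},\qquad V_1(S,T)=0,$$ on $(0,\infty)\times[0,T)$ (continuous there, the equation holding for $0<t<T$, the terminal value attained in the sense of distributions on $(0,\infty)$ as $t\to T^-$), with $|V_1(S,t)|\le Me^{b|\ln S|^2}$ for all $S>0$, $t\in[0,T]$ and some constants $M,b$. Then for all $S>0$ and $t\in[0,T)$ $$V_1(S,t)=\frac{E^\gamma}{(2\pi\tilde\sigma^2)^{\delta/2}}\Big(\frac SE\Big)^{\frac{\gamma-\delta}{1-\delta}}e^{\left\{\beta+\frac{P^2\tilde\sigma^2}{2(1-\delta)^2}\right\}(T-t)}\int_0^{T-t}\frac{A(\xi)\;e^{K\xi-\frac{M(S,t)}{\delta(T-t)+(1-\delta)\xi}}}{\xi^{\frac{\delta-1}{2}}\sqrt{\delta(T-t)+(1-\delta)\xi}}\,d\xi,$$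 where $$K=\frac{P^2\tilde\sigma^2}{2(\delta-1)}+\beta(\delta-1),\qquad M(S,t)=\frac{\delta}{2\tilde\sigma^2}\Big(\ln\frac SE\Big)^2+\frac{P\delta(T-t)}{1-\delta}\ln\frac SE+\frac{P^2\tilde\sigma^2\delta(T-t)^2}{2(1-\delta)^2}.$$ -/

import Mathlib

open MeasureTheory Set Filter Topology
open scoped ContDiff

namespace NonlinearBS

/-- The model data: historical volatility `σ`, interest rate `r`, dividend yield `q`, expiration
price `E`, maturity `T`, and the powers `γ`, `δ` and the function `A` in the volatility law
`σ² + 2 ε A(T - t) S^(γ - 1) (S ∂²V/∂S²)^(δ - 1)`. -/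
structure Params where
  σ : ℝ
  r : ℝ
  q : ℝ
  E : ℝ
  T : ℝ
  γ : ℝ
  δ : ℝ
  A : ℝ → ℝ

noncomputable section

namespace Params

variable (p : Params)

def α : ℝ := 1 / 2 + (p.q - p.r) / p.σ ^ 2

def β : ℝ :=
  -(p.σ ^ 2 / 8 + (p.r + p.q) / 2 + (p.r - p.q) ^ 2 / (2 * p.σ ^ 2))

def P : ℝ := p.γ - p.δ - p.α * (1 - p.δ)

def Q (τ ξ : ℝ) : ℝ := p.δ * τ + (1 - p.δ) * ξ

def Lam (τ ξ : ℝ) : ℝ :=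
  (2 * Real.pi * p.σ ^ 2) ^ (p.δ / 2) * ξ ^ ((p.δ - 1) / 2) * Real.sqrt (p.Q τ ξ)

/-- The source term of the transformed problem. -/
def source (x τ : ℝ) : ℝ :=
  p.E ^ p.γ * p.A τ / (2 * Real.pi * p.σ ^ 2 * τ) ^ (p.δ / 2) *
    Real.exp (-(p.δ / (2 * p.σ ^ 2 * τ)) * x ^ 2
      + (p.γ - p.δ - p.α * (1 - p.δ)) * x
      - (p.β + p.q * p.δ + p.δ / 2 * (1 - p.α) ^ 2 * p.σ ^ 2) * τ)

/-- `u` is a classical solution of `∂u/∂τ - (σ²/2) ∂²u/∂x² = source`, `u(x, 0) = 0`, on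
`ℝ × [0, T]`. The source is singular at `τ = 0` (and for `δ = 2` the solution has no limit at the
point `(0, 0)`), so the initial value is attained in the sense of distributions:
`u(·, τ) → 0` as `τ → 0+`. -/
structure IsSolution (u : ℝ → ℝ → ℝ) : Prop where
  continuousOn : ContinuousOn (fun z : ℝ × ℝ => u z.1 z.2) (univ ×ˢ Ioc 0 p.T)
  diff_time : ∀ x : ℝ, ∀ τ ∈ Ioo 0 p.T, DifferentiableAt ℝ (fun s => u x s) τ
  diff_space : ∀ τ ∈ Ioo 0 p.T, Differentiable ℝ (fun y => u y τ)
  diff_space_two : ∀ τ ∈ Ioo 0 p.T, Differentiable ℝ (deriv fun y => u y τ)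
  equation : ∀ x : ℝ, ∀ τ ∈ Ioo 0 p.T,
    deriv (fun s => u x s) τ - p.σ ^ 2 / 2 * deriv (deriv fun y => u y τ) x = p.source x τ
  initial_value : ∀ x : ℝ, u x 0 = 0
  initial_limit : ∀ φ : ℝ → ℝ, ContDiff ℝ ∞ φ → HasCompactSupport φ →
    Tendsto (fun τ => ∫ x, u x τ * φ x) (𝓝[>] 0) (𝓝 0)

/-- The integrand of the formula for `u(x, τ)`, without the factor `E ^ γ`. -/
def kernel (x τ ξ : ℝ) : ℝ :=
  p.A ξ / p.Lam τ ξ *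
    Real.exp ((p.P ^ 2 * p.σ ^ 2 / (2 * (p.δ - 1)) + p.β * (p.δ - 1)) * ξ
      + p.P * x / (1 - p.δ) + p.P ^ 2 * p.σ ^ 2 * τ / (2 * (1 - p.δ) ^ 2)
      - (p.δ * x ^ 2 / (2 * p.σ ^ 2) + p.P * x * p.δ * τ / (1 - p.δ)
          + p.P ^ 2 * p.σ ^ 2 * p.δ * τ ^ 2 / (2 * (1 - p.δ) ^ 2)) * (1 / p.Q τ ξ))

/-- The standard normal cumulative distribution function. -/
def Phi (d : ℝ) : ℝ :=
  1 / Real.sqrt (2 * Real.pi) * ∫ x in Iic d, Real.exp (-x ^ 2 / 2)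

def d₁ (S t : ℝ) : ℝ :=
  (Real.log (S / p.E) + (p.r - p.q + p.σ ^ 2 / 2) * (p.T - t)) / (p.σ * Real.sqrt (p.T - t))

def d₂ (S t : ℝ) : ℝ :=
  (Real.log (S / p.E) + (p.r - p.q - p.σ ^ 2 / 2) * (p.T - t)) / (p.σ * Real.sqrt (p.T - t))

/-- The Black–Scholes price of the European call. -/
def call (S t : ℝ) : ℝ :=
  S * Real.exp (-p.q * (p.T - t)) * Phi (p.d₁ S t)
    - p.E * Real.exp (-p.r * (p.T - t)) * Phi (p.d₂ S t)

/-- The Black–Scholes price of the European put. -/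
def put (S t : ℝ) : ℝ :=
  p.E * Real.exp (-p.r * (p.T - t)) * Phi (-p.d₂ S t)
    - S * Real.exp (-p.q * (p.T - t)) * Phi (-p.d₁ S t)

/-- The linear Black–Scholes operator
`∂V/∂t + (σ²/2) S² ∂²V/∂S² + (r - q) S ∂V/∂S - r V`. -/
def L₀ (V : ℝ → ℝ → ℝ) (S t : ℝ) : ℝ :=
  deriv (fun s => V S s) t + 1 / 2 * p.σ ^ 2 * S ^ 2 * deriv (deriv fun y => V y t) S
    + (p.r - p.q) * S * deriv (fun y => V y t) S - p.r * V S t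

/-- The nonlinear operator `A(T - t) S^γ (S ∂²V/∂S²)^δ`. -/
def L₁ (V : ℝ → ℝ → ℝ) (S t : ℝ) : ℝ :=
  p.A (p.T - t) * S ^ p.γ * (S * deriv (deriv fun y => V y t) S) ^ p.δ

/-- `V₁` is a classical solution of the first-order problem `L₀(V₁) = -L₁(V₀)`, `V₁(S, T) = 0`, on
`(0, ∞) × [0, T)`; the terminal value is attained in the sense of distributions on `(0, ∞)`. -/
structure IsFirstOrderCorrection (V₀ V₁ : ℝ → ℝ → ℝ) : Prop where
  continuousOn : ContinuousOn (fun z : ℝ × ℝ => V₁ z.1 z.2) (Ioi 0 ×ˢ Ico 0 p.T)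
  diff_time : ∀ S > 0, ∀ t ∈ Ioo 0 p.T, DifferentiableAt ℝ (fun s => V₁ S s) t
  diff_space : ∀ S > 0, ∀ t ∈ Ioo 0 p.T, DifferentiableAt ℝ (fun y => V₁ y t) S
  diff_space_two : ∀ S > 0, ∀ t ∈ Ioo 0 p.T, DifferentiableAt ℝ (deriv fun y => V₁ y t) S
  equation : ∀ S > 0, ∀ t ∈ Ioo 0 p.T, p.L₀ V₁ S t = -p.L₁ V₀ S t
  terminal_value : ∀ S > 0, V₁ S p.T = 0
  terminal_limit : ∀ φ : ℝ → ℝ, ContDiff ℝ ∞ φ → HasCompactSupport φ → tsupport φ ⊆ Ioi 0 →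
    Tendsto (fun t => ∫ S in Ioi 0, V₁ S t * φ S) (𝓝[<] p.T) (𝓝 0)

def K : ℝ :=
  (p.γ - p.δ - p.α * (1 - p.δ)) ^ 2 * p.σ ^ 2 / (2 * (p.δ - 1)) + p.β * (p.δ - 1)

def M (S t : ℝ) : ℝ :=
  p.δ / (2 * p.σ ^ 2) * Real.log (S / p.E) ^ 2
    + (p.γ - p.δ - p.α * (1 - p.δ)) * p.δ * (p.T - t) / (1 - p.δ) * Real.log (S / p.E)
    + (p.γ - p.δ - p.α * (1 - p.δ)) ^ 2 * p.σ ^ 2 * p.δ * (p.T - t) ^ 2 / (2 * (1 - p.δ) ^ 2)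

/-- The factor in front of the integral in the formula for `V₁(S, t)`. -/
def priceFactor (S t : ℝ) : ℝ :=
  p.E ^ p.γ / (2 * Real.pi * p.σ ^ 2) ^ (p.δ / 2) * (S / p.E) ^ ((p.γ - p.δ) / (1 - p.δ)) *
    Real.exp ((p.β + (p.γ - p.δ - p.α * (1 - p.δ)) ^ 2 * p.σ ^ 2 / (2 * (1 - p.δ) ^ 2))
      * (p.T - t))

/-- The integrand in the formula for `V₁(S, t)`. -/
def priceKernel (S t ξ : ℝ) : ℝ :=
  p.A ξ / (ξ ^ ((p.δ - 1) / 2) * Real.sqrt (p.δ * (p.T - t) + (1 - p.δ) * ξ)) *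
    Real.exp (p.K * ξ - p.M S t * (1 / (p.δ * (p.T - t) + (1 - p.δ) * ξ)))

end Params

/-- `v = c * ∫₀^τ g(ξ) dξ`. The integrand may be singular at `ξ = 0`, so the integral is the limit
of the integrals over `[ε, τ]` as `ε → 0+` (each of them absolutely convergent), and it is the
Lebesgue integral over `[0, τ]` whenever `g` is integrable there. -/
def EqMulIntegral (v c : ℝ) (g : ℝ → ℝ) (τ : ℝ) : Prop :=
  (∀ ε ∈ Ioc 0 τ, IntervalIntegrable g volume ε τ) ∧
  Tendsto (fun ε => c * ∫ ξ in ε..τ, g ξ) (𝓝[>] 0) (𝓝 v) ∧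
  (IntervalIntegrable g volume 0 τ → v = c * ∫ ξ in 0..τ, g ξ)

end

end NonlinearBS

/-! The kernel in the formula is a family of exact solutions of the homogeneous heat equation. With
`a = σ²/2`, completing the square gives `kernel x τ ξ = coeff ξ * heatSol a δ (P/(1-δ)) ((1-δ)ξ) x
τ` (`kernel_eq`). For fixed `ξ` the second factor solves `∂w/∂τ = a ∂²w/∂x²` and is Gaussian of
width `Q = δτ + (1-δ)ξ`. On the diagonal `ξ = τ` the kernel, multiplied by `E^γ`, is the source
(`source_eq_kernel`). Hence the Duhamel integral `D_ε(x, τ) = E^γ ∫_ε^τ kernel x τ ξ dξ` solves the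
inhomogeneous equation for `τ > ε` with zero data at `τ = ε` (`heatAt_duhamel`), and the claim is
that `u - D_ε → 0` as `ε → 0+`.

The difference `u - D_ε` solves the homogeneous equation and has Gaussian growth. A Tychonoff-type
comparison with an explicit barrier represents it, over a time step of length at most `h =
1/(16a(b+2))`, as the heat-kernel integral of its earlier values (`heat_representation`,
`sub_duhamel_representation`). Starting at time `ε`, the earlier values are `u(·, ε)`, because `D_ε`
vanishes there. They tend to `0` as distributions under a uniform Gaussian bound, so their
heat-kernel integrals tend to `0` (`tendsto_heatKernel_integral`). This settles times up to `h`.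

Later times are reached in steps of length `h` by dominated convergence, which needs a Gaussian
bound on `D_ε(·, s)` uniform in `ε`. Since `A` may be wild at `0`, the integrals may converge only
conditionally and absolute values are useless. However, convergence at a single point already bounds
the integrals there, and the integrand at any other point is the same integrand times a smooth
factor with controlled derivative. Integration by parts transfers the bound
(`exists_abs_duhamel_le_of_bounded`). The conclusion is `tendsto_sub_duhamel`.

For the price, `S ∂²V₀/∂S²` is the same Gaussian in `ln S` for call and put, so its power `δ` is
again Gaussian. The substitution `x = ln (S/E)`, `τ = T - t`, with the factor `e^{-αx-βτ}`, turns
the problem for `V₁` into the one for `u` (`heatAt_transform`, `source_eq_L₁`). -/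

namespace NonlinearBS

/-! ### Parametric integrals -/

/-- Differentiation under an interval integral with a jointly continuous derivative. -/
theorem hasDerivAt_integral_of_continuousOn {F F' : ℝ → ℝ → ℝ} {l r x₀ c d : ℝ}
    (hx₀ : x₀ ∈ Ioo l r)
    (hF : ∀ x ∈ Ioo l r, ContinuousOn (F x) (uIcc c d))
    (hd : ∀ x ∈ Ioo l r, ∀ y ∈ uIcc c d, HasDerivAt (fun z => F z y) (F' x y) x)
    (hF' : ContinuousOn (Function.uncurry F') (Ioo l r ×ˢ uIcc c d)) :
    HasDerivAt (fun x => ∫ y in c..d, F x y) (∫ y in c..d, F' x₀ y) x₀ := by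
  obtain ⟨l', hl', hl'x⟩ := exists_between hx₀.1
  obtain ⟨r', hxr', hr'⟩ := exists_between hx₀.2
  have hsub : Icc l' r' ⊆ Ioo l r := fun z hz => ⟨hl'.trans_le hz.1, hz.2.trans_lt hr'⟩
  have hK : IsCompact (Icc l' r' ×ˢ uIcc c d) := isCompact_Icc.prod isCompact_uIcc
  obtain ⟨C, hC⟩ := hK.exists_bound_of_continuousOn (hF'.mono (prod_mono hsub Subset.rfl))
  have hs : Icc l' r' ∈ 𝓝 x₀ := Icc_mem_nhds hl'x hxr'
  have hF'x : ContinuousOn (F' x₀) (uIcc c d) := by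
    have : ContinuousOn (fun y => Function.uncurry F' (x₀, y)) (uIcc c d) :=
      hF'.comp (by fun_prop) fun y hy => ⟨hx₀, hy⟩
    exact this
  refine (intervalIntegral.hasDerivAt_integral_of_dominated_loc_of_deriv_le (bound := fun _ => C)
    hs ?_ ?_ ?_ ?_ ?_ ?_).2
  · filter_upwards [hs] with x hx
    exact ((hF x (hsub hx)).mono uIoc_subset_uIcc).aestronglyMeasurable measurableSet_uIoc
  · exact (hF x₀ hx₀).intervalIntegrable
  · exact (hF'x.mono uIoc_subset_uIcc).aestronglyMeasurable measurableSet_uIoc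
  · exact Eventually.of_forall fun y hy x hx => hC (x, y) ⟨hx, uIoc_subset_uIcc hy⟩
  · exact intervalIntegrable_const
  · exact Eventually.of_forall fun y hy x hx => hd x (hsub hx) y (uIoc_subset_uIcc hy)

/-- The Leibniz rule for `∫ y in c..x, F x y`. -/
theorem hasDerivAt_integral_upper_of_continuousOn {F F' : ℝ → ℝ → ℝ} {l r x₀ c : ℝ}
    (hx₀ : x₀ ∈ Ioo l r) (hright : c < x₀)
    (hF : ContinuousOn (Function.uncurry F) (Ioo l r ×ˢ Ico c r))
    (hd : ∀ x ∈ Ioo l r, ∀ y ∈ Ico c r, HasDerivAt (fun z => F z y) (F' x y) x)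
    (hF' : ContinuousOn (Function.uncurry F') (Ioo l r ×ˢ Ico c r)) :
    HasDerivAt (fun x => ∫ y in c..x, F x y) (F x₀ x₀ + ∫ y in c..x₀, F' x₀ y) x₀ := by
  have hc : c ≤ x₀ := hright.le
  have hFx : ∀ x ∈ Ioo l r, ContinuousOn (F x) (Ico c r) := fun x hx => by
    have : ContinuousOn (fun y => Function.uncurry F (x, y)) (Ico c r) :=
      hF.comp (by fun_prop) fun y hy => ⟨hx, hy⟩
    exact this
  have hsub : ∀ x ∈ Ioo l r, c ≤ x → uIcc c x ⊆ Ico c r := fun x hx hcx y hy => by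
    rw [uIcc_of_le hcx] at hy
    exact ⟨hy.1, hy.2.trans_lt hx.2⟩
  have h1 : HasDerivAt (fun x => ∫ y in c..x₀, F x y) (∫ y in c..x₀, F' x₀ y) x₀ :=
    hasDerivAt_integral_of_continuousOn hx₀ (fun x hx => (hFx x hx).mono (hsub x₀ hx₀ hc))
      (fun x hx y hy => hd x hx y (hsub x₀ hx₀ hc hy))
      (hF'.mono (prod_mono Subset.rfl (hsub x₀ hx₀ hc)))
  have hmem : Ioo (max l c) r ∈ 𝓝 x₀ := Ioo_mem_nhds (max_lt hx₀.1 hright) hx₀.2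
  -- The integral over the short interval from `x₀` to `x` is compared with `(x - x₀) F(x₀, x₀)`.
  -- Joint continuity at the diagonal point makes the error `o(x - x₀)`, although `x` also occurs in
  -- the integrand.
  have h2 : HasDerivAt (fun x => ∫ y in x₀..x, F x y) (F x₀ x₀) x₀ := by
    rw [hasDerivAt_iff_isLittleO, Asymptotics.isLittleO_iff]
    intro ε hε
    have hcont : ContinuousAt (Function.uncurry F) (x₀, x₀) :=
      hF.continuousAt (prod_mem_nhds (Ioo_mem_nhds hx₀.1 hx₀.2) (Ico_mem_nhds hright hx₀.2))
    have hev := Metric.continuousAt_iff.1 hcont ε hε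
    obtain ⟨η, hη, hηb⟩ := hev
    filter_upwards [hmem, Metric.ball_mem_nhds x₀ hη] with x hx hxη
    have hxI : x ∈ Ioo l r := ⟨(le_max_left _ _).trans_lt hx.1, hx.2⟩
    have hxc : c < x := (le_max_right _ _).trans_lt hx.1
    have hint : IntervalIntegrable (F x) volume x₀ x :=
      ((hFx x hxI).mono fun y hy => ⟨(le_min hc hxc.le).trans hy.1,
        hy.2.trans_lt (max_lt hx₀.2 hx.2)⟩).intervalIntegrable
    have heq : ((∫ y in x₀..x, F x y) - (∫ y in x₀..x₀, F x₀ y)) - (x - x₀) • F x₀ x₀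
        = ∫ y in x₀..x, (F x y - F x₀ x₀) := by
      rw [intervalIntegral.integral_sub hint intervalIntegrable_const]
      simp
    rw [heq]
    refine intervalIntegral.norm_integral_le_of_norm_le_const fun y hy => ?_
    have hy' : dist y x₀ < η := by
      have h3 : |y - x₀| ≤ |x - x₀| := abs_sub_left_of_mem_uIcc (uIoc_subset_uIcc hy)
      exact lt_of_le_of_lt h3 hxη
    have := hηb (x := (x, y)) (by rw [Prod.dist_eq]; exact max_lt hxη hy')
    exact this.le
  have h3 := h2.add h1
  refine h3.congr_of_eventuallyEq ?_
  filter_upwards [hmem] with x hx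
  have hxI : x ∈ Ioo l r := ⟨(le_max_left _ _).trans_lt hx.1, hx.2⟩
  have hxc : c < x := (le_max_right _ _).trans_lt hx.1
  have hint : ∀ z w, z ∈ Ico c r → w ∈ Ico c r → IntervalIntegrable (F x) volume z w := by
    intro z w hz hw
    exact ((hFx x hxI).mono fun y hy => ⟨(le_min hz.1 hw.1).trans hy.1,
        hy.2.trans_lt (max_lt hz.2 hw.2)⟩).intervalIntegrable
  change _ = (∫ y in x₀..x, F x y) + ∫ y in c..x₀, F x y
  rw [add_comm, intervalIntegral.integral_add_adjacent_intervals
    (hint _ _ ⟨le_rfl, hc.trans_lt hx₀.2⟩ ⟨hc, hx₀.2⟩) (hint _ _ ⟨hc, hx₀.2⟩ ⟨hxc.le, hx.2⟩)]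

/-! ### The maximum principle -/

/-- A positive second derivative would make the maximum a local minimum as well. The function would
then be locally constant, forcing `f₂ = 0`. -/
theorem second_deriv_nonpos_of_isLocalMax {f f₁ : ℝ → ℝ} {f₂ x₀ : ℝ}
    (h1 : ∀ y, HasDerivAt f (f₁ y) y) (h2 : HasDerivAt f₁ f₂ x₀) (hmax : IsLocalMax f x₀) :
    f₂ ≤ 0 := by
  by_contra! hpos
  have hderiv : deriv f = f₁ := funext fun y => (h1 y).deriv
  have hmin : IsLocalMin f x₀ := isLocalMin_of_deriv_deriv_pos (by rw [hderiv, h2.deriv]; exact hpos)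
    (by rw [hderiv]; exact hmax.hasDerivAt_eq_zero (h1 x₀)) (h1 x₀).continuousAt
  have hconst : f =ᶠ[𝓝 x₀] fun _ => f x₀ := by
    filter_upwards [hmax, hmin] with y hy1 hy2 using le_antisymm hy1 hy2
  have h3 : f₁ =ᶠ[𝓝 x₀] fun _ => 0 := by
    have := hconst.deriv
    rw [hderiv] at this
    simpa using this
  have h4 : f₂ = 0 := h2.unique ((hasDerivAt_const x₀ (0 : ℝ)).congr_of_eventuallyEq h3)
  exact hpos.ne' h4

theorem deriv_nonneg_of_left_max {f : ℝ → ℝ} {f₁ s t₀ : ℝ} (hs : s < t₀)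
    (h : HasDerivAt f f₁ t₀) (hmax : ∀ t ∈ Icc s t₀, f t ≤ f t₀) : 0 ≤ f₁ := by
  have h1 : Tendsto (slope f t₀) (𝓝[<] t₀) (𝓝 f₁) :=
    h.tendsto_slope.mono_left (nhdsWithin_mono _ fun x hx => ne_of_lt hx)
  refine ge_of_tendsto h1 ?_
  filter_upwards [Ioo_mem_nhdsLT hs] with t ht
  rw [slope_def_field]
  exact div_nonneg_of_nonpos (sub_nonpos.2 (hmax t ⟨ht.1.le, ht.2.le⟩)) (sub_nonpos.2 ht.2.le)

/-- `w` is twice differentiable in space and differentiable in time at the time `t`, where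
`∂w/∂t = a ∂²w/∂x² + f`. -/
def HeatAt (a : ℝ) (w : ℝ → ℝ → ℝ) (f : ℝ → ℝ) (t : ℝ) : Prop :=
  ∃ w₁ w₂ : ℝ → ℝ, (∀ y, HasDerivAt (fun z => w z t) (w₁ y) y) ∧ (∀ y, HasDerivAt w₁ (w₂ y) y) ∧
    ∀ y, HasDerivAt (fun s => w y s) (a * w₂ y + f y) t

theorem HeatAt.sub {a t : ℝ} {v w : ℝ → ℝ → ℝ} {f g : ℝ → ℝ} (hv : HeatAt a v f t)
    (hw : HeatAt a w g t) : HeatAt a (fun x s => v x s - w x s) (fun x => f x - g x) t := by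
  obtain ⟨v₁, v₂, h1, h2, h3⟩ := hv
  obtain ⟨w₁, w₂, k1, k2, k3⟩ := hw
  refine ⟨fun y => v₁ y - w₁ y, fun y => v₂ y - w₂ y, fun y => (h1 y).sub (k1 y),
    fun y => (h2 y).sub (k2 y), fun y => ((h3 y).sub (k3 y)).congr_deriv (by ring)⟩

theorem HeatAt.const_mul {a t : ℝ} {v : ℝ → ℝ → ℝ} {f : ℝ → ℝ} (hv : HeatAt a v f t) (c : ℝ) :
    HeatAt a (fun x s => c * v x s) (fun x => c * f x) t := by
  obtain ⟨v₁, v₂, h1, h2, h3⟩ := hv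
  refine ⟨fun y => c * v₁ y, fun y => c * v₂ y, fun y => (h1 y).const_mul c,
    fun y => (h2 y).const_mul c, fun y => ((h3 y).const_mul c).congr_deriv (by ring)⟩

/-- Weak maximum principle. A positive maximum over the compact rectangle lies at `|y| < R` and
after time `s`, so there `∂²W/∂x² ≤ 0` and `∂W/∂t ≥ 0`, which contradicts `∂W/∂t = a ∂²W/∂x² + f`
with `f < 0`. The equation is available only before `t₁`, so the final time is reached by
continuity. -/
theorem nonpos_of_strict_subsolution {a s t₁ R : ℝ} (ha : 0 < a) {W : ℝ → ℝ → ℝ} (hst : s < t₁)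
    (hcont : ContinuousOn (Function.uncurry W) (univ ×ˢ Icc s t₁))
    (hinit : ∀ x, W x s ≤ 0) (hfar : ∀ x, R ≤ |x| → ∀ t ∈ Icc s t₁, W x t ≤ 0)
    (hW : ∀ t ∈ Ioo s t₁, ∃ f : ℝ → ℝ, HeatAt a W f t ∧ ∀ x, f x < 0) :
    ∀ x, W x t₁ ≤ 0 := by
  have key : ∀ x, ∀ t ∈ Ioo s t₁, W x t ≤ 0 := by
    intro x t ht
    by_contra! hpos
    have hxR : |x| < R := by
      by_contra! h
      exact absurd (hfar x h t ⟨ht.1.le, ht.2.le⟩) (not_le.2 hpos)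
    have hK : IsCompact (Icc (-R) R ×ˢ Icc s t) := isCompact_Icc.prod isCompact_Icc
    have hxt : (x, t) ∈ Icc (-R) R ×ˢ Icc s t :=
      ⟨abs_le.1 hxR.le, ht.1.le, le_rfl⟩
    obtain ⟨⟨y, τ⟩, hm, hmax⟩ := hK.exists_isMaxOn ⟨_, hxt⟩
      (hcont.mono (prod_mono (subset_univ _) (Icc_subset_Icc_right ht.2.le)))
    have hge : ∀ z ∈ Icc (-R) R, ∀ t' ∈ Icc s t, W z t' ≤ W y τ := fun z hz t' ht' =>
      hmax (show (z, t') ∈ Icc (-R) R ×ˢ Icc s t from ⟨hz, ht'⟩)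
    have hposm : 0 < W y τ := hpos.trans_le (hge x hxt.1 t hxt.2)
    have hτ : τ ∈ Icc s t := hm.2
    have hyR : |y| < R := by
      by_contra! h
      exact absurd (hfar y h τ ⟨hτ.1, hτ.2.trans ht.2.le⟩) (not_le.2 hposm)
    have hsτ : s < τ := by
      rcases hτ.1.eq_or_lt with h | h
      · rw [← h] at hposm
        exact absurd (hinit y) (not_le.2 hposm)
      · exact h
    obtain ⟨f, ⟨w₁, w₂, h1, h2, h3⟩, hf⟩ := hW τ ⟨hsτ, hτ.2.trans_lt ht.2⟩
    have hlm : IsLocalMax (fun z => W z τ) y := by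
      filter_upwards [Icc_mem_nhds (abs_lt.1 hyR).1 (abs_lt.1 hyR).2] with z hz
      exact hge z hz τ hτ
    have hw2 : w₂ y ≤ 0 := second_deriv_nonpos_of_isLocalMax h1 (h2 y) hlm
    have hwt : 0 ≤ a * w₂ y + f y := deriv_nonneg_of_left_max hsτ (h3 y)
      fun t' ht' => hge y hm.1 t' ⟨ht'.1, ht'.2.trans hτ.2⟩
    nlinarith [hf y, mul_nonneg ha.le (neg_nonneg.2 hw2)]
  intro x
  have hct : ContinuousOn (fun t => W x t) (Icc s t₁) := by
    have : ContinuousOn (fun t => Function.uncurry W (x, t)) (Icc s t₁) :=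
      hcont.comp (by fun_prop) fun t ht => ⟨mem_univ _, ht⟩
    exact this
  have hlim : Tendsto (fun t => W x t) (𝓝[Ioo s t₁] t₁) (𝓝 (W x t₁)) :=
    (hct t₁ (right_mem_Icc.2 hst.le)).mono Ioo_subset_Icc_self
  have : (𝓝[Ioo s t₁] t₁).NeBot := by
    rw [nhdsWithin_Ioo_eq_nhdsLT hst]; infer_instance
  exact le_of_tendsto hlim (eventually_mem_nhdsWithin.mono fun t ht => key x t ht)

/-- A supersolution of the heat equation with Gaussian growth. -/
noncomputable def growthBarrier (a c s x t : ℝ) : ℝ :=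
  Real.exp (c * (1 + 16 * a * c * (t - s)) * x ^ 2 + 5 * a * c * (t - s))

/-- The constants `16` and `5` make this source positive as long as `16ac(t - s) ≤ 1`. Then `k ≤
2c`, so the subtracted part is at most `4ac + 16ac²x²`, and at least `ac` is left. -/
theorem heatAt_growthBarrier (a c s t : ℝ) :
    HeatAt a (growthBarrier a c s)
      (fun x => growthBarrier a c s x t * (16 * a * c ^ 2 * x ^ 2 + 5 * a * c
        - a * (2 * (c * (1 + 16 * a * c * (t - s)))
          + 4 * (c * (1 + 16 * a * c * (t - s))) ^ 2 * x ^ 2))) t := by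
  set k := c * (1 + 16 * a * c * (t - s)) with hk
  refine ⟨fun x => growthBarrier a c s x t * (2 * k * x),
    fun x => growthBarrier a c s x t * (2 * k + 4 * k ^ 2 * x ^ 2), ?_, ?_, ?_⟩
  · intro y
    have h : HasDerivAt (fun x : ℝ => k * x ^ 2 + 5 * a * c * (t - s)) (2 * k * y) y :=
      (((hasDerivAt_pow 2 y).const_mul k).add_const (5 * a * c * (t - s))).congr_deriv
        (by push_cast; ring)
    exact h.exp
  · intro y
    have h : HasDerivAt (fun x : ℝ => k * x ^ 2 + 5 * a * c * (t - s)) (2 * k * y) y :=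
      (((hasDerivAt_pow 2 y).const_mul k).add_const (5 * a * c * (t - s))).congr_deriv
        (by push_cast; ring)
    have h2 := h.exp.mul ((hasDerivAt_id y).const_mul (2 * k))
    refine h2.congr_deriv ?_
    simp only [growthBarrier, ← hk, id]
    ring
  · intro y
    have h0 : HasDerivAt (fun τ : ℝ => τ - s) 1 t := (hasDerivAt_id t).sub_const s
    have h1 : HasDerivAt (fun τ : ℝ => c * (1 + 16 * a * c * (τ - s)) * y ^ 2
        + 5 * a * c * (τ - s)) (c * (16 * a * c * 1) * y ^ 2 + 5 * a * c * 1) t :=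
      ((((h0.const_mul (16 * a * c)).const_add 1).const_mul c).mul_const (y ^ 2)).add
        (h0.const_mul (5 * a * c))
    refine h1.exp.congr_deriv ?_
    simp only [growthBarrier, ← hk]
    ring

theorem growthBarrier_ge {a c s t : ℝ} (ha : 0 < a) (hc : 0 < c) (hst : s ≤ t) (x : ℝ) :
    Real.exp (c * x ^ 2) ≤ growthBarrier a c s x t := by
  have h1 : 0 ≤ t - s := sub_nonneg.2 hst
  apply Real.exp_le_exp.2
  have : 0 ≤ 16 * a * c * (t - s) * (c * x ^ 2) := by positivity
  have : 0 ≤ 5 * a * c * (t - s) := by positivity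
  nlinarith

/-- Comparison with the barrier, for functions of Gaussian growth. -/
theorem le_barrier_of_heat {a b C N s t₁ : ℝ} (ha : 0 < a) (hb : 0 ≤ b) (hN : 0 ≤ N)
    {w : ℝ → ℝ → ℝ} (hst : s < t₁) (hsmall : 16 * a * (b + 1) * (t₁ - s) ≤ 1)
    (hcont : ContinuousOn (Function.uncurry w) (univ ×ˢ Icc s t₁))
    (hheat : ∀ t ∈ Ioo s t₁, HeatAt a w (fun _ => 0) t)
    (hgrow : ∀ x, ∀ t ∈ Icc s t₁, w x t ≤ C * Real.exp (b * x ^ 2))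
    (hinit : ∀ x, w x s ≤ N * Real.exp ((b + 1) * x ^ 2)) :
    ∀ x, w x t₁ ≤ N * growthBarrier a (b + 1) s x t₁ := by
  intro x
  have hc : 0 < b + 1 := by linarith
  -- The extra `η` serves twice: it makes the comparison strict, and it lets the barrier of rate `b
  -- + 1` beat the growth `C e^{bx²}` at infinity. It is sent to `0` at the end.
  have key : ∀ η > 0, w x t₁ ≤ (N + η) * growthBarrier a (b + 1) s x t₁ := by
    intro η hη
    have hNη : 0 < N + η := by linarith
    -- For `|x| ≥ R` one has `e^{x²} ≥ x² ≥ |x| ≥ |C|/η`, hence `C e^{bx²} ≤ η e^{(b+1)x²}`.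
    set R : ℝ := max 1 (|C| / η) with hR
    have := nonpos_of_strict_subsolution (R := R) ha
      (W := fun x t => w x t - (N + η) * growthBarrier a (b + 1) s x t) hst ?_ ?_ ?_ ?_ x
    · linarith
    · refine hcont.sub (Continuous.continuousOn ?_)
      simp only [growthBarrier]
      fun_prop
    · intro x
      have h1 := growthBarrier_ge ha hc (le_refl s) x
      have h2 : N * Real.exp ((b + 1) * x ^ 2) ≤ (N + η) * growthBarrier a (b + 1) s x s := by
        apply mul_le_mul _ h1 (Real.exp_pos _).le hNη.le
        linarith
      linarith [hinit x]
    · intro x hx t ht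
      have h1 := growthBarrier_ge ha hc ht.1 x
      have hx1 : 1 ≤ |x| := (le_max_left _ _).trans hx
      have hx2 : |C| / η ≤ |x| := (le_max_right _ _).trans hx
      have hsq : |x| ≤ x ^ 2 := by rw [← sq_abs]; nlinarith
      have h3 : C ≤ η * Real.exp (x ^ 2) := by
        have h4 : x ^ 2 ≤ Real.exp (x ^ 2) := by linarith [Real.add_one_le_exp (x ^ 2)]
        have h5 : |C| ≤ η * |x| := by rw [div_le_iff₀ hη] at hx2; linarith
        nlinarith [le_abs_self C]
      have h4 : C * Real.exp (b * x ^ 2) ≤ η * Real.exp ((b + 1) * x ^ 2) := by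
        rw [show (b + 1) * x ^ 2 = x ^ 2 + b * x ^ 2 by ring, Real.exp_add, ← mul_assoc]
        exact mul_le_mul_of_nonneg_right h3 (Real.exp_pos _).le
      have h5 : η * Real.exp ((b + 1) * x ^ 2) ≤ (N + η) * growthBarrier a (b + 1) s x t := by
        apply mul_le_mul _ h1 (Real.exp_pos _).le hNη.le
        linarith
      linarith [hgrow x t ht]
    · intro t ht
      refine ⟨_, (hheat t ht).sub ((heatAt_growthBarrier a (b + 1) s t).const_mul (N + η)), ?_⟩
      intro x
      have hθ0 : 0 ≤ 16 * a * (b + 1) * (t - s) := by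
        have : 0 ≤ t - s := by linarith [ht.1]
        positivity
      have hθ1 : 16 * a * (b + 1) * (t - s) ≤ 1 := by
        have : 16 * a * (b + 1) * (t - s) ≤ 16 * a * (b + 1) * (t₁ - s) := by
          apply mul_le_mul_of_nonneg_left _ (by positivity)
          linarith [ht.2]
        linarith
      set θ := 16 * a * (b + 1) * (t - s)
      set c := b + 1
      have hk2 : (c * (1 + θ)) ≤ 2 * c := by nlinarith
      have hk0 : 0 ≤ c * (1 + θ) := by positivity
      have hk4 : (c * (1 + θ)) ^ 2 ≤ 4 * c ^ 2 := by nlinarith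
      have hB : 0 < growthBarrier a c s x t := Real.exp_pos _
      have hpos : 0 < 16 * a * c ^ 2 * x ^ 2 + 5 * a * c
          - a * (2 * (c * (1 + θ)) + 4 * (c * (1 + θ)) ^ 2 * x ^ 2) := by
        have e1 : (c * (1 + θ)) ^ 2 * (a * x ^ 2) ≤ 4 * c ^ 2 * (a * x ^ 2) :=
          mul_le_mul_of_nonneg_right hk4 (by positivity)
        have e2 : a * (c * (1 + θ)) ≤ a * (2 * c) := mul_le_mul_of_nonneg_left hk2 ha.le
        have e3 : 0 < a * c := by positivity
        nlinarith
      have := mul_pos hNη (mul_pos hB hpos)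
      linarith
  have hlim : Tendsto (fun η : ℝ => (N + η) * growthBarrier a (b + 1) s x t₁) (𝓝[>] 0)
      (𝓝 ((N + 0) * growthBarrier a (b + 1) s x t₁)) := by
    apply Tendsto.mono_left _ nhdsWithin_le_nhds
    exact ((continuous_const.add continuous_id).mul continuous_const).tendsto 0
  rw [add_zero] at hlim
  exact ge_of_tendsto hlim (eventually_mem_nhdsWithin.mono fun η hη => key η hη)


/-! ### Gaussian solutions of the heat equation -/

/-- A solution of `∂w/∂τ = a ∂²w/∂x²`, Gaussian in `x` with variance proportional to `d τ + c`. -/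
noncomputable def heatSol (a d p c x τ : ℝ) : ℝ :=
  Real.exp (p * x + a * p ^ 2 * τ - d * (x + 2 * a * p * τ) ^ 2 / (4 * a * (d * τ + c)))
    / Real.sqrt (d * τ + c)

/-- The logarithmic space derivative of `heatSol`. -/
noncomputable def heatSolLog (a d p c x τ : ℝ) : ℝ :=
  p - d * (x + 2 * a * p * τ) / (2 * a * (d * τ + c))

noncomputable def heatSolDeriv (a d p c x τ : ℝ) : ℝ :=
  heatSol a d p c x τ * heatSolLog a d p c x τ

noncomputable def heatSolDeriv2 (a d p c x τ : ℝ) : ℝ :=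
  heatSol a d p c x τ * (heatSolLog a d p c x τ ^ 2 - d / (2 * a * (d * τ + c)))

theorem hasDerivAt_heatSol {a d p c x τ : ℝ} (ha : 0 < a) (hq : 0 < d * τ + c) :
    HasDerivAt (fun z => heatSol a d p c z τ) (heatSolDeriv a d p c x τ) x := by
  have h0 : HasDerivAt (fun z : ℝ => z + 2 * a * p * τ) 1 x := (hasDerivAt_id x).add_const _
  have h1 : HasDerivAt (fun z : ℝ => p * z + a * p ^ 2 * τ
      - d * (z + 2 * a * p * τ) ^ 2 / (4 * a * (d * τ + c))) (heatSolLog a d p c x τ) x := by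
    refine ((((hasDerivAt_id x).const_mul p).add_const (a * p ^ 2 * τ)).sub
      (((h0.pow 2).const_mul d).div_const (4 * a * (d * τ + c)))).congr_deriv ?_
    simp only [heatSolLog]
    field_simp
    push_cast
    ring
  refine (h1.exp.div_const (Real.sqrt (d * τ + c))).congr_deriv ?_
  simp only [heatSolDeriv, heatSol]
  ring

theorem hasDerivAt_heatSolDeriv {a d p c x τ : ℝ} (ha : 0 < a) (hq : 0 < d * τ + c) :
    HasDerivAt (fun z => heatSolDeriv a d p c z τ) (heatSolDeriv2 a d p c x τ) x := by
  have h0 : HasDerivAt (fun z : ℝ => z + 2 * a * p * τ) 1 x := (hasDerivAt_id x).add_const _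
  have h1 : HasDerivAt (fun z : ℝ => heatSolLog a d p c z τ) (-(d / (2 * a * (d * τ + c)))) x := by
    refine (((h0.const_mul d).div_const (2 * a * (d * τ + c))).const_sub p).congr_deriv ?_
    ring
  refine ((hasDerivAt_heatSol ha hq).mul h1).congr_deriv ?_
  simp only [heatSolDeriv, heatSolDeriv2]
  ring

/-- The exponent `φ` satisfies `∂φ/∂τ = a (∂φ/∂x)²`. The remaining term `a ∂²φ/∂x² = -d/(2(dτ + c))`
is the logarithmic derivative of the factor `(dτ + c)^(-1/2)`. -/
theorem hasDerivAt_heatSol_time {a d p c x τ : ℝ} (ha : 0 < a) (hq : 0 < d * τ + c) :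
    HasDerivAt (fun t => heatSol a d p c x t) (a * heatSolDeriv2 a d p c x τ) τ := by
  have hq' : HasDerivAt (fun t : ℝ => d * t + c) d τ :=
    (((hasDerivAt_id τ).const_mul d).add_const c).congr_deriv (by ring)
  have h0 : HasDerivAt (fun t : ℝ => x + 2 * a * p * t) (2 * a * p) τ :=
    (((hasDerivAt_id τ).const_mul (2 * a * p)).const_add x).congr_deriv (by ring)
  have h1 : HasDerivAt (fun t : ℝ => p * x + a * p ^ 2 * t
      - d * (x + 2 * a * p * t) ^ 2 / (4 * a * (d * t + c)))
      (a * heatSolLog a d p c x τ ^ 2) τ := by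
    refine (((((hasDerivAt_id τ).const_mul (a * p ^ 2)).const_add (p * x))).sub
      (((h0.pow 2).const_mul d).div (hq'.const_mul (4 * a)) (by positivity))).congr_deriv ?_
    simp only [heatSolLog, Pi.pow_apply]
    field_simp
    push_cast
    ring
  have hs : 0 < Real.sqrt (d * τ + c) := Real.sqrt_pos.2 hq
  refine (h1.exp.div (hq'.sqrt hq.ne') hs.ne').congr_deriv ?_
  simp only [heatSolDeriv2, heatSol]
  set e := Real.exp (p * x + a * p ^ 2 * τ - d * (x + 2 * a * p * τ) ^ 2 / (4 * a * (d * τ + c)))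
  set l := heatSolLog a d p c x τ
  have hsq : d * τ + c = Real.sqrt (d * τ + c) ^ 2 := (Real.sq_sqrt hq.le).symm
  set r := Real.sqrt (d * τ + c) with hr
  rw [hsq]
  field_simp

theorem continuousOn_heatSol {a d p : ℝ} (ha : 0 < a) :
    ContinuousOn (fun z : ℝ × ℝ × ℝ => heatSol a d p z.1 z.2.1 z.2.2)
      {z | 0 < d * z.2.2 + z.1} := by
  unfold heatSol
  have h4 : ∀ z ∈ {z : ℝ × ℝ × ℝ | 0 < d * z.2.2 + z.1}, 4 * a * (d * z.2.2 + z.1) ≠ 0 := by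
    intro z hz
    have : 0 < d * z.2.2 + z.1 := hz
    positivity
  have h5 : ∀ z ∈ {z : ℝ × ℝ × ℝ | 0 < d * z.2.2 + z.1}, Real.sqrt (d * z.2.2 + z.1) ≠ 0 :=
    fun z hz => (Real.sqrt_pos.2 hz).ne'
  fun_prop (disch := assumption)

theorem continuousOn_heatSolLog {a d p : ℝ} (ha : 0 < a) :
    ContinuousOn (fun z : ℝ × ℝ × ℝ => heatSolLog a d p z.1 z.2.1 z.2.2)
      {z | 0 < d * z.2.2 + z.1} := by
  unfold heatSolLog
  have h4 : ∀ z ∈ {z : ℝ × ℝ × ℝ | 0 < d * z.2.2 + z.1}, 2 * a * (d * z.2.2 + z.1) ≠ 0 := by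
    intro z hz
    have : 0 < d * z.2.2 + z.1 := hz
    positivity
  fun_prop (disch := assumption)

theorem continuousOn_heatSolDeriv {a d p : ℝ} (ha : 0 < a) :
    ContinuousOn (fun z : ℝ × ℝ × ℝ => heatSolDeriv a d p z.1 z.2.1 z.2.2)
      {z | 0 < d * z.2.2 + z.1} :=
  (continuousOn_heatSol ha).mul (continuousOn_heatSolLog ha)

theorem continuousOn_heatSolDeriv2 {a d p : ℝ} (ha : 0 < a) :
    ContinuousOn (fun z : ℝ × ℝ × ℝ => heatSolDeriv2 a d p z.1 z.2.1 z.2.2)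
      {z | 0 < d * z.2.2 + z.1} := by
  unfold heatSolDeriv2
  have h4 : ∀ z ∈ {z : ℝ × ℝ × ℝ | 0 < d * z.2.2 + z.1}, 2 * a * (d * z.2.2 + z.1) ≠ 0 := by
    intro z hz
    have : 0 < d * z.2.2 + z.1 := hz
    positivity
  refine (continuousOn_heatSol ha).mul (((continuousOn_heatSolLog ha).pow 2).sub ?_)
  fun_prop (disch := assumption)

/-- Space derivatives of a superposition of Gaussian solutions. -/
theorem hasDerivAt_superposition {a d p c₀ c₁ τ : ℝ} (ha : 0 < a) {k c m : ℝ → ℝ}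
    (hk : ContinuousOn k (uIcc c₀ c₁)) (hc : Continuous c) (hm : Continuous m)
    (hq : ∀ ξ ∈ uIcc c₀ c₁, 0 < d * τ + c ξ) (x : ℝ) :
    HasDerivAt (fun z => ∫ ξ in c₀..c₁, k ξ * heatSol a d p (c ξ) (z - m ξ) τ)
      (∫ ξ in c₀..c₁, k ξ * heatSolDeriv a d p (c ξ) (x - m ξ) τ) x ∧
    HasDerivAt (fun z => ∫ ξ in c₀..c₁, k ξ * heatSolDeriv a d p (c ξ) (z - m ξ) τ)
      (∫ ξ in c₀..c₁, k ξ * heatSolDeriv2 a d p (c ξ) (x - m ξ) τ) x := by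
  have hx : x ∈ Ioo (x - 1) (x + 1) := ⟨by linarith, by linarith⟩
  have hmap : MapsTo (fun z : ℝ × ℝ => (c z.2, z.1 - m z.2, τ)) (univ ×ˢ uIcc c₀ c₁)
      {z | 0 < d * z.2.2 + z.1} := fun z hz => hq z.2 hz.2
  have hcm : ContinuousOn (fun z : ℝ × ℝ => (c z.2, z.1 - m z.2, τ)) (univ ×ˢ uIcc c₀ c₁) := by
    fun_prop
  have hk2 : ContinuousOn (fun z : ℝ × ℝ => k z.2) (univ ×ˢ uIcc c₀ c₁) :=
    hk.comp continuousOn_snd fun z hz => hz.2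
  have H0 := hk2.mul ((continuousOn_heatSol (d := d) (p := p) ha).comp hcm hmap)
  have H1 := hk2.mul ((continuousOn_heatSolDeriv (d := d) (p := p) ha).comp hcm hmap)
  have H2 := hk2.mul ((continuousOn_heatSolDeriv2 (d := d) (p := p) ha).comp hcm hmap)
  have slice : ∀ z : ℝ, ContinuousOn (fun ξ : ℝ => (z, ξ)) (uIcc c₀ c₁) := fun z => by fun_prop
  have sliceMap : ∀ z : ℝ, MapsTo (fun ξ : ℝ => (z, ξ)) (uIcc c₀ c₁) (univ ×ˢ uIcc c₀ c₁) :=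
    fun z ξ hξ => ⟨mem_univ _, hξ⟩
  have shift : ∀ z ξ : ℝ, HasDerivAt (fun y : ℝ => y - m ξ) 1 z := fun z ξ =>
    (hasDerivAt_id z).sub_const _
  constructor
  · refine hasDerivAt_integral_of_continuousOn (F := fun z ξ => k ξ * heatSol a d p (c ξ) (z - m ξ) τ)
      (F' := fun z ξ => k ξ * heatSolDeriv a d p (c ξ) (z - m ξ) τ) hx
      (fun z _ => H0.comp (slice z) (sliceMap z)) (fun z _ ξ hξ => ?_)
      (H1.mono (prod_mono (subset_univ _) Subset.rfl))
    exact (((hasDerivAt_heatSol ha (hq ξ hξ)).comp z (shift z ξ)).const_mul (k ξ)).congr_deriv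
      (by ring)
  · refine hasDerivAt_integral_of_continuousOn
      (F := fun z ξ => k ξ * heatSolDeriv a d p (c ξ) (z - m ξ) τ)
      (F' := fun z ξ => k ξ * heatSolDeriv2 a d p (c ξ) (z - m ξ) τ) hx
      (fun z _ => H1.comp (slice z) (sliceMap z)) (fun z _ ξ hξ => ?_)
      (H2.mono (prod_mono (subset_univ _) Subset.rfl))
    exact (((hasDerivAt_heatSolDeriv ha (hq ξ hξ)).comp z (shift z ξ)).const_mul (k ξ)).congr_deriv
      (by ring)

/-! ### The heat semigroup -/

noncomputable def heatKernel (a x t : ℝ) : ℝ :=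
  (Real.sqrt (4 * Real.pi * a))⁻¹ * heatSol a 1 0 0 x t

theorem heatKernel_eq (a x t : ℝ) :
    heatKernel a x t =
      (Real.sqrt (4 * Real.pi * a))⁻¹ * (Real.exp (-(x ^ 2 / (4 * a * t))) / Real.sqrt t) := by
  simp [heatKernel, heatSol]

theorem heatKernel_nonneg (a x t : ℝ) : 0 ≤ heatKernel a x t := by
  rw [heatKernel_eq]; positivity

/-- The heat flow of `g`, as an expectation over a standard normal variable. -/
noncomputable def heatFlow (a : ℝ) (g : ℝ → ℝ) (x t : ℝ) : ℝ :=
  ∫ ζ, (Real.sqrt (2 * Real.pi))⁻¹ * Real.exp (-(1 / 2) * ζ ^ 2) * g (x - Real.sqrt (2 * a * t) * ζ)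

theorem integral_normal : ∫ ζ : ℝ, (Real.sqrt (2 * Real.pi))⁻¹ * Real.exp (-(1 / 2) * ζ ^ 2) = 1 := by
  rw [integral_const_mul, integral_gaussian,
    show Real.pi / (1 / 2) = 2 * Real.pi by ring, inv_mul_cancel₀]
  positivity

/-- Substitution `y = x - √(2at) ζ`. The convolution form yields the heat equation for `t > 0`. The
expectation form stays meaningful at `t = 0` and gives continuity up to the initial time and the sup
bound. -/
theorem heatFlow_eq {a t : ℝ} (ha : 0 < a) (ht : 0 < t) (g : ℝ → ℝ) (x : ℝ) :
    heatFlow a g x t = ∫ y, heatKernel a (x - y) t * g y := by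
  have hk : 0 < Real.sqrt (2 * a * t) := Real.sqrt_pos.2 (by positivity)
  rw [← integral_sub_left_eq_self _ _ x]
  have h := Measure.integral_comp_mul_left
    (fun y => heatKernel a (x - (x - y)) t * g (x - y)) (Real.sqrt (2 * a * t))
  rw [abs_of_pos (inv_pos.2 hk), smul_eq_mul] at h
  have h2 : ∫ y, heatKernel a (x - (x - y)) t * g (x - y)
      = Real.sqrt (2 * a * t) * ∫ ζ, heatKernel a (x - (x - Real.sqrt (2 * a * t) * ζ)) t *
        g (x - Real.sqrt (2 * a * t) * ζ) := by
    rw [h]; field_simp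
  rw [h2, ← integral_const_mul, heatFlow]
  congr 1
  ext ζ
  rw [heatKernel_eq, ← mul_assoc]
  congr 1
  rw [sub_sub_cancel, mul_pow, Real.sq_sqrt (by positivity)]
  have e1 : -(2 * a * t * ζ ^ 2 / (4 * a * t)) = -(1 / 2) * ζ ^ 2 := by field_simp; ring
  have e2 : Real.sqrt (4 * Real.pi * a) * Real.sqrt t
      = Real.sqrt (2 * Real.pi) * Real.sqrt (2 * a * t) := by
    rw [← Real.sqrt_mul (by positivity), ← Real.sqrt_mul (by positivity)]
    congr 1; ring
  rw [e1]
  have h3 : 0 < Real.sqrt t := Real.sqrt_pos.2 ht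
  have h4 : 0 < Real.sqrt (4 * Real.pi * a) := Real.sqrt_pos.2 (by positivity)
  have h5 : 0 < Real.sqrt (2 * Real.pi) := Real.sqrt_pos.2 (by positivity)
  generalize Real.sqrt (4 * Real.pi * a) = A at *
  field_simp
  linear_combination e2

theorem heatFlow_zero (a : ℝ) (g : ℝ → ℝ) (x : ℝ) : heatFlow a g x 0 = g x := by
  simp only [heatFlow, mul_zero, Real.sqrt_zero, zero_mul, sub_zero]
  rw [integral_mul_const, integral_normal, one_mul]

theorem norm_normal_mul_le {g : ℝ → ℝ} {C : ℝ} (hC : ∀ y, |g y| ≤ C) (ζ y : ℝ) :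
    ‖(Real.sqrt (2 * Real.pi))⁻¹ * Real.exp (-(1 / 2) * ζ ^ 2) * g y‖
      ≤ (Real.sqrt (2 * Real.pi))⁻¹ * Real.exp (-(1 / 2) * ζ ^ 2) * C := by
  rw [norm_mul, Real.norm_of_nonneg (by positivity)]
  exact mul_le_mul_of_nonneg_left (hC y) (by positivity)

theorem integrable_normal :
    Integrable fun ζ : ℝ => (Real.sqrt (2 * Real.pi))⁻¹ * Real.exp (-(1 / 2) * ζ ^ 2) :=
  (integrable_exp_neg_mul_sq (by norm_num)).const_mul _

theorem continuous_heatFlow {a : ℝ} {g : ℝ → ℝ} {C : ℝ} (hg : Continuous g)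
    (hC : ∀ y, |g y| ≤ C) : Continuous fun z : ℝ × ℝ => heatFlow a g z.1 z.2 := by
  unfold heatFlow
  refine continuous_of_dominated (bound := fun ζ =>
    (Real.sqrt (2 * Real.pi))⁻¹ * Real.exp (-(1 / 2) * ζ ^ 2) * C) ?_ ?_
    (integrable_normal.mul_const C) ?_
  · intro z
    exact Continuous.aestronglyMeasurable (by fun_prop)
  · exact fun z => Eventually.of_forall fun ζ => norm_normal_mul_le hC ζ _
  · exact Eventually.of_forall fun ζ => by fun_prop

theorem abs_heatFlow_le {a : ℝ} {g : ℝ → ℝ} {C : ℝ} (hC : ∀ y, |g y| ≤ C) (x t : ℝ) :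
    |heatFlow a g x t| ≤ C := by
  have h := norm_integral_le_of_norm_le (integrable_normal.mul_const C)
    (Eventually.of_forall fun ζ => norm_normal_mul_le hC ζ (x - Real.sqrt (2 * a * t) * ζ))
  rw [integral_mul_const, integral_normal, one_mul] at h
  exact h

/-- The heat flow of a continuous function with compact support solves the heat equation. -/
theorem heatAt_heatFlow {a s t L : ℝ} (ha : 0 < a) {g : ℝ → ℝ} (hg : Continuous g)
    (hsupp : ∀ y, y ∉ Ioc (-L) L → g y = 0) (hL : 0 ≤ L) (hst : s < t) :
    HeatAt a (fun x τ => heatFlow a g x (τ - s)) (fun _ => 0) t := by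
  have hform : ∀ x τ, s < τ → heatFlow a g x (τ - s) = (Real.sqrt (4 * Real.pi * a))⁻¹ *
      ∫ y in -L..L, g y * heatSol a 1 0 (-s) (x - y) τ := by
    intro x τ hτ
    rw [heatFlow_eq ha (sub_pos.2 hτ), intervalIntegral.integral_of_le (by linarith),
      ← integral_const_mul, ← setIntegral_eq_integral_of_forall_compl_eq_zero (s := Ioc (-L) L)]
    · congr 1
      ext y
      simp only [heatKernel, heatSol]
      rw [show 1 * (τ - s) + 0 = 1 * τ + -s by ring]
      ring_nf
    · intro y hy
      rw [hsupp y hy, mul_zero]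
  have hsp := fun x => hasDerivAt_superposition (d := 1) (p := 0) (c₀ := -L) (c₁ := L) (τ := t)
    (c := fun _ => -s) (m := fun y => y) ha hg.continuousOn continuous_const continuous_id
    (fun ξ _ => by linarith) x
  refine ⟨fun x => (Real.sqrt (4 * Real.pi * a))⁻¹ *
      ∫ y in -L..L, g y * heatSolDeriv a 1 0 (-s) (x - y) t,
    fun x => (Real.sqrt (4 * Real.pi * a))⁻¹ *
      ∫ y in -L..L, g y * heatSolDeriv2 a 1 0 (-s) (x - y) t, fun x => ?_, fun x => ?_, fun x => ?_⟩
  · simp only [hform _ t hst]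
    exact (hsp x).1.const_mul _
  · exact (hsp x).2.const_mul _
  · have h1 : HasDerivAt (fun τ => ∫ y in -L..L, g y * heatSol a 1 0 (-s) (x - y) τ)
        (∫ y in -L..L, g y * (a * heatSolDeriv2 a 1 0 (-s) (x - y) t)) t := by
      have hmap : MapsTo (fun z : ℝ × ℝ => (-s, x - z.2, z.1)) (Ioo s (t + 1) ×ˢ uIcc (-L) L)
          {z | 0 < 1 * z.2.2 + z.1} := fun z hz => by
        have := hz.1.1
        simp only [mem_ofPred_eq]
        linarith
      have hcm : ContinuousOn (fun z : ℝ × ℝ => (-s, x - z.2, z.1))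
        (Ioo s (t + 1) ×ˢ uIcc (-L) L) := by fun_prop
      have hg2 : ContinuousOn (fun z : ℝ × ℝ => g z.2) (Ioo s (t + 1) ×ˢ uIcc (-L) L) := by fun_prop
      have H0 := hg2.mul ((continuousOn_heatSol (d := 1) (p := 0) ha).comp hcm hmap)
      have H2 := hg2.mul (((continuousOn_heatSolDeriv2 (d := 1) (p := 0) ha).comp hcm hmap).const_mul a)
      refine hasDerivAt_integral_of_continuousOn
        (F := fun τ y => g y * heatSol a 1 0 (-s) (x - y) τ)
        (F' := fun τ y => g y * (a * heatSolDeriv2 a 1 0 (-s) (x - y) τ))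
        (l := s) (r := t + 1) ⟨hst, by linarith⟩ (fun τ hτ => ?_) (fun τ hτ y _ => ?_) H2
      · exact H0.comp (f := fun y => (τ, y)) (by fun_prop) fun y hy => ⟨hτ, hy⟩
      · exact (hasDerivAt_heatSol_time ha (by linarith [hτ.1])).const_mul _
    refine ((h1.const_mul (Real.sqrt (4 * Real.pi * a))⁻¹).congr_of_eventuallyEq ?_).congr_deriv ?_
    · filter_upwards [Ioi_mem_nhds hst] with τ hτ using hform x τ hτ
    · have h2 : ∫ y in -L..L, g y * (a * heatSolDeriv2 a 1 0 (-s) (x - y) t)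
          = a * ∫ y in -L..L, g y * heatSolDeriv2 a 1 0 (-s) (x - y) t := by
        rw [← intervalIntegral.integral_const_mul]
        refine intervalIntegral.integral_congr fun y _ => ?_
        ring
      rw [h2]
      ring


/-! ### Representation of solutions of Gaussian growth -/

/-- A smooth cutoff, equal to `1` on `[-(n + 1), n + 1]` and supported in `[-(n + 2), n + 2]`. -/
noncomputable def cutoff (n : ℕ) : ContDiffBump (0 : ℝ) where
  rIn := n + 1
  rOut := n + 2
  rIn_pos := by positivity
  rIn_lt_rOut := by linarith

theorem cutoff_eq_zero {n : ℕ} {y : ℝ} (hy : (n : ℝ) + 2 ≤ |y|) : cutoff n y = 0 :=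
  (cutoff n).zero_of_le_dist (by rw [dist_zero_right]; exact hy)

/-- Where the cutoff differs from `1`, `y² ≥ |y| > n`. Truncation therefore costs an exponentially
small factor once the growth rate is raised by `1`, which is the form that the barrier propagates.
-/
theorem abs_one_sub_cutoff_le (n : ℕ) (y : ℝ) :
    |1 - cutoff n y| ≤ Real.exp (-n) * Real.exp (y ^ 2) := by
  by_cases hy : |y| ≤ n + 1
  · have : cutoff n y = 1 :=
      (cutoff n).one_of_mem_closedBall (by rw [mem_closedBall_zero_iff]; exact hy)
    rw [this, sub_self, abs_zero]
    positivity
  · push Not at hy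
    have h1 : |1 - cutoff n y| ≤ 1 := abs_le.2
      ⟨by linarith [(cutoff n).le_one (x := y)], by linarith [(cutoff n).nonneg (x := y)]⟩
    refine h1.trans ?_
    rw [← Real.exp_add, Real.one_le_exp_iff, ← sq_abs]
    have : (0 : ℝ) ≤ n := Nat.cast_nonneg n
    nlinarith

theorem abs_cutoff_le (n : ℕ) (y : ℝ) : |cutoff n y| ≤ 1 := by
  rw [abs_of_nonneg (cutoff n).nonneg]
  exact (cutoff n).le_one

theorem tendsto_cutoff (y : ℝ) : Tendsto (fun n => cutoff n y) atTop (𝓝 1) := by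
  refine tendsto_const_nhds.congr' ?_
  filter_upwards [eventually_ge_atTop ⌈|y|⌉₊] with n hn
  refine ((cutoff n).one_of_mem_closedBall ?_).symm
  rw [mem_closedBall_zero_iff]
  have h1 : |y| ≤ n := (Nat.le_ceil _).trans (by exact_mod_cast hn)
  change |y| ≤ n + 1
  linarith

/-- For such short times the kernel decays at least like `e^{-4(b+1)(x-y)²}`, and `y² ≤ 2x² +
2(x-y)²` turns this into decay in `y` that outweighs `e^{by²}`. The majorant is the same for all
admissible `t ≥ T₀`, as dominated convergence requires. -/
theorem heatKernel_mul_exp_le {a b t T₀ : ℝ} (ha : 0 < a) (hb : 0 ≤ b) (hT₀ : 0 < T₀) (ht : T₀ ≤ t)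
    (hsmall : 16 * a * (b + 1) * t ≤ 1) (x y : ℝ) :
    heatKernel a (x - y) t * Real.exp (b * y ^ 2) ≤
      (Real.sqrt (4 * Real.pi * a))⁻¹ * (Real.sqrt T₀)⁻¹ * Real.exp (4 * (b + 1) * x ^ 2) *
        Real.exp (-(b + 2) * y ^ 2) := by
  have ht0 : 0 < t := hT₀.trans_le ht
  rw [heatKernel_eq]
  have h1 : (Real.sqrt t)⁻¹ ≤ (Real.sqrt T₀)⁻¹ :=
    inv_anti₀ (Real.sqrt_pos.2 hT₀) (Real.sqrt_le_sqrt ht)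
  have h2 : 4 * (b + 1) * (x - y) ^ 2 ≤ (x - y) ^ 2 / (4 * a * t) := by
    rw [le_div_iff₀ (by positivity)]
    nlinarith [sq_nonneg (x - y)]
  have h3 : Real.exp (-((x - y) ^ 2 / (4 * a * t))) * Real.exp (b * y ^ 2)
      ≤ Real.exp (4 * (b + 1) * x ^ 2) * Real.exp (-(b + 2) * y ^ 2) := by
    rw [← Real.exp_add, ← Real.exp_add, Real.exp_le_exp]
    nlinarith [sq_nonneg (2 * x - y), mul_nonneg hb (sq_nonneg (2 * x - y))]
  calc _ = (Real.sqrt (4 * Real.pi * a))⁻¹ * (Real.sqrt t)⁻¹ *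
        (Real.exp (-((x - y) ^ 2 / (4 * a * t))) * Real.exp (b * y ^ 2)) := by ring
    _ ≤ (Real.sqrt (4 * Real.pi * a))⁻¹ * (Real.sqrt T₀)⁻¹ *
        (Real.exp (4 * (b + 1) * x ^ 2) * Real.exp (-(b + 2) * y ^ 2)) := by gcongr
    _ = _ := by ring

theorem continuous_heatKernel {a t : ℝ} : Continuous fun z => heatKernel a z t := by
  simp only [heatKernel_eq]
  fun_prop

theorem norm_heatKernel_mul_le {a b t C : ℝ} {x y v : ℝ}
    (hv : |v| ≤ C * Real.exp (b * y ^ 2)) :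
    ‖heatKernel a (x - y) t * v‖ ≤ C * (heatKernel a (x - y) t * Real.exp (b * y ^ 2)) := by
  rw [norm_mul, Real.norm_of_nonneg (heatKernel_nonneg _ _ _), Real.norm_eq_abs]
  calc _ ≤ heatKernel a (x - y) t * (C * Real.exp (b * y ^ 2)) :=
        mul_le_mul_of_nonneg_left hv (heatKernel_nonneg _ _ _)
    _ = _ := by ring

theorem integrable_heatKernel_mul_exp {a b t : ℝ} (ha : 0 < a) (hb : 0 ≤ b) (ht : 0 < t)
    (hsmall : 16 * a * (b + 1) * t ≤ 1) (x : ℝ) :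
    Integrable fun y => heatKernel a (x - y) t * Real.exp (b * y ^ 2) := by
  refine ((integrable_exp_neg_mul_sq (b := b + 2) (by linarith)).const_mul
    ((Real.sqrt (4 * Real.pi * a))⁻¹ * (Real.sqrt t)⁻¹ * Real.exp (4 * (b + 1) * x ^ 2))).mono' ?_ ?_
  · have := continuous_heatKernel (a := a) (t := t)
    exact Continuous.aestronglyMeasurable (by fun_prop)
  · refine Eventually.of_forall fun y => ?_
    rw [Real.norm_of_nonneg (mul_nonneg (heatKernel_nonneg _ _ _) (Real.exp_pos _).le)]
    exact heatKernel_mul_exp_le ha hb ht le_rfl hsmall x y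

/-- Uniqueness and representation at once. The heat flow of the truncated data `cutoff n * w(·, s)`
differs from `w` at time `s` by at most `C e^{-n} e^{(b+1)x²}`, and the barrier keeps the difference
of order `e^{-n}` at `t₁`. As `n → ∞` the flows converge both to `w(x, t₁)` and, by domination, to
the kernel integral. -/
theorem heat_representation {a b C s t₁ : ℝ} (ha : 0 < a) (hb : 0 ≤ b) {w : ℝ → ℝ → ℝ}
    (hst : s < t₁) (hsmall : 16 * a * (b + 1) * (t₁ - s) ≤ 1)
    (hcont : ContinuousOn (Function.uncurry w) (univ ×ˢ Icc s t₁))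
    (hheat : ∀ t ∈ Ioo s t₁, HeatAt a w (fun _ => 0) t)
    (hgrow : ∀ x, ∀ t ∈ Icc s t₁, |w x t| ≤ C * Real.exp (b * x ^ 2)) (x : ℝ) :
    w x t₁ = ∫ y, heatKernel a (x - y) (t₁ - s) * w y s := by
  have hs : s ∈ Icc s t₁ := left_mem_Icc.2 hst.le
  have hC : 0 ≤ C := by
    have := (abs_nonneg _).trans (hgrow 0 s hs)
    simpa using this
  have hws : Continuous fun y => w y s := by
    rw [← continuousOn_univ]
    exact hcont.comp (f := fun y => (y, s)) (by fun_prop) fun y _ => ⟨mem_univ _, hs⟩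
  have ht : 0 < t₁ - s := sub_pos.2 hst
  set g : ℕ → ℝ → ℝ := fun n y => cutoff n y * w y s with hg
  have hgc : ∀ n, Continuous (g n) := fun n => (cutoff n).continuous.mul hws
  have hgb : ∀ n, ∃ B, ∀ y, |g n y| ≤ B := by
    intro n
    have hsup : HasCompactSupport (g n) := (cutoff n).hasCompactSupport.mul_right
    obtain ⟨B, hB⟩ := (hgc n).bounded_above_of_compact_support hsup
    exact ⟨B, hB⟩
  have herr : ∀ n x, |w x t₁ - heatFlow a (g n) x (t₁ - s)|
      ≤ C * Real.exp (-n) * growthBarrier a (b + 1) s x t₁ := by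
    intro n
    obtain ⟨B, hB⟩ := hgb n
    have hB0 : 0 ≤ B := (abs_nonneg _).trans (hB 0)
    have hdc : ContinuousOn (Function.uncurry fun x t => w x t - heatFlow a (g n) x (t - s))
        (univ ×ˢ Icc s t₁) := by
      refine hcont.sub (Continuous.continuousOn ?_)
      exact (continuous_heatFlow (hgc n) hB).comp
        (by fun_prop : Continuous fun z : ℝ × ℝ => (z.1, z.2 - s))
    have hdh : ∀ t ∈ Ioo s t₁,
        HeatAt a (fun x t => w x t - heatFlow a (g n) x (t - s)) (fun _ => 0 - 0) t := by
      intro t ht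
      refine (hheat t ht).sub (heatAt_heatFlow (L := n + 2) ha (hgc n) (fun y hy => ?_)
        (by positivity) ht.1)
      rw [hg]
      simp only
      rw [cutoff_eq_zero, zero_mul]
      by_contra! h
      exact hy ⟨(abs_lt.1 h).1, (abs_lt.1 h).2.le⟩
    simp only [sub_zero] at hdh
    have hdg : ∀ x, ∀ t ∈ Icc s t₁, |w x t - heatFlow a (g n) x (t - s)|
        ≤ (C + B) * Real.exp (b * x ^ 2) := by
      intro x t ht
      have h1 : 1 ≤ Real.exp (b * x ^ 2) := Real.one_le_exp (by positivity)
      have h2 := abs_heatFlow_le (a := a) hB x (t - s)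
      have h3 := abs_sub (w x t) (heatFlow a (g n) x (t - s))
      nlinarith [hgrow x t ht]
    have hdi : ∀ x, |w x s - heatFlow a (g n) x (s - s)|
        ≤ C * Real.exp (-n) * Real.exp ((b + 1) * x ^ 2) := by
      intro x
      rw [sub_self, heatFlow_zero, hg]
      simp only
      rw [show w x s - cutoff n x * w x s = (1 - cutoff n x) * w x s by ring, abs_mul]
      calc _ ≤ (Real.exp (-n) * Real.exp (x ^ 2)) * (C * Real.exp (b * x ^ 2)) :=
            mul_le_mul (abs_one_sub_cutoff_le n x) (hgrow x s hs) (abs_nonneg _) (by positivity)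
        _ = _ := by rw [show (b + 1) * x ^ 2 = x ^ 2 + b * x ^ 2 by ring, Real.exp_add]; ring
    intro x
    rw [abs_le']
    constructor
    · exact le_barrier_of_heat ha hb (by positivity) hst hsmall hdc hdh
        (fun x t ht => (le_abs_self _).trans (hdg x t ht))
        (fun x => (le_abs_self _).trans (hdi x)) x
    · have hneg : ∀ t ∈ Ioo s t₁, HeatAt a (fun x t => -1 *
          (w x t - heatFlow a (g n) x (t - s))) (fun _ => 0) t := fun t ht => by
        have := (hdh t ht).const_mul (-1)
        simpa only [mul_zero] using this
      have hnc : ContinuousOn (Function.uncurry fun x t => -1 *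
          (w x t - heatFlow a (g n) x (t - s))) (univ ×ˢ Icc s t₁) := hdc.const_smul (-1 : ℝ)
      have := le_barrier_of_heat (C := C + B) (N := C * Real.exp (-n)) ha hb (by positivity) hst
        hsmall hnc hneg
        (fun x t ht => by rw [neg_one_mul]; exact (neg_le_abs _).trans (hdg x t ht))
        (fun x => by rw [neg_one_mul]; exact (neg_le_abs _).trans (hdi x)) x
      rwa [neg_one_mul] at this
  have hlim1 : Tendsto (fun n => heatFlow a (g n) x (t₁ - s)) atTop (𝓝 (w x t₁)) := by
    rw [tendsto_iff_norm_sub_tendsto_zero]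
    have h1 : Tendsto (fun n : ℕ => Real.exp (-(n : ℝ))) atTop (𝓝 0) :=
      Real.tendsto_exp_neg_atTop_nhds_zero.comp tendsto_natCast_atTop_atTop
    have h2 := (h1.const_mul C).mul_const (growthBarrier a (b + 1) s x t₁)
    rw [mul_zero, zero_mul] at h2
    refine squeeze_zero (fun _ => norm_nonneg _) (fun n => ?_) h2
    rw [norm_sub_rev]
    exact herr n x
  have hlim2 : Tendsto (fun n => heatFlow a (g n) x (t₁ - s)) atTop
      (𝓝 (∫ y, heatKernel a (x - y) (t₁ - s) * w y s)) := by
    simp only [heatFlow_eq ha ht]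
    refine tendsto_integral_of_dominated_convergence
      (fun y => C * (heatKernel a (x - y) (t₁ - s) * Real.exp (b * y ^ 2))) ?_
      ((integrable_heatKernel_mul_exp ha hb ht hsmall x).const_mul C) ?_ ?_
    · intro n
      have := continuous_heatKernel (a := a) (t := t₁ - s)
      have := hgc n
      exact Continuous.aestronglyMeasurable (by fun_prop)
    · intro n
      refine Eventually.of_forall fun y => norm_heatKernel_mul_le ?_
      rw [hg, abs_mul]
      calc _ ≤ 1 * |w y s| := mul_le_mul_of_nonneg_right (abs_cutoff_le n y) (abs_nonneg _)
        _ ≤ _ := by rw [one_mul]; exact hgrow y s hs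
    · refine Eventually.of_forall fun y => ?_
      have := ((tendsto_cutoff y).mul_const (w y s)).const_mul (heatKernel a (x - y) (t₁ - s))
      simpa only [one_mul] using this
  exact tendsto_nhds_unique hlim1 hlim2


/-! ### The Duhamel integral -/

/-- The contribution of the source on the time interval `[ε, τ]`. -/
noncomputable def duhamel (a d p : ℝ) (k : ℝ → ℝ) (ε x τ : ℝ) : ℝ :=
  ∫ ξ in ε..τ, k ξ * heatSol a d p ((1 - d) * ξ) x τ

/-- The width is `ξ + d(τ - ξ)`, so it stays positive for `0 < ξ ≤ τ` even when `d > 1` and `1 - d`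
is negative. -/
theorem le_width {d τ ξ : ℝ} (hd : 0 ≤ d) (h : ξ ≤ τ) : ξ ≤ d * τ + (1 - d) * ξ := by
  nlinarith [mul_nonneg hd (sub_nonneg.2 h)]

theorem continuousOn_duhamel_integrand {a d p : ℝ} {k : ℝ → ℝ} {T τ : ℝ} (ha : 0 < a) (hd : 0 ≤ d)
    (hk : ContinuousOn k (Ioc 0 T)) (hτ : τ ≤ T) (x : ℝ) :
    ContinuousOn (fun ξ => k ξ * heatSol a d p ((1 - d) * ξ) x τ) (Ioc 0 τ) := by
  refine (hk.mono (Ioc_subset_Ioc_right hτ)).mul ?_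
  exact (continuousOn_heatSol ha).comp (f := fun ξ => ((1 - d) * ξ, x, τ)) (by fun_prop)
    fun ξ hξ => hξ.1.trans_le (le_width hd hξ.2)

theorem intervalIntegrable_duhamel_integrand {a d p : ℝ} {k : ℝ → ℝ} {T τ ε₁ ε₂ : ℝ} (ha : 0 < a)
    (hd : 0 ≤ d) (hk : ContinuousOn k (Ioc 0 T)) (hτ : τ ≤ T) (h1 : ε₁ ∈ Ioc 0 τ)
    (h2 : ε₂ ∈ Ioc 0 τ) (x : ℝ) :
    IntervalIntegrable (fun ξ => k ξ * heatSol a d p ((1 - d) * ξ) x τ) volume ε₁ ε₂ := by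
  refine ((continuousOn_duhamel_integrand ha hd hk hτ x).mono fun y hy => ?_).intervalIntegrable
  exact ⟨(lt_min h1.1 h2.1).trans_le hy.1, hy.2.trans (max_le h1.2 h2.2)⟩

/-- Each integrand solves the homogeneous equation in `(x, τ)`, so in the Leibniz rule only the
diagonal value, contributed by the moving upper limit, survives as a source. -/
theorem heatAt_duhamel {a d p : ℝ} {k : ℝ → ℝ} {T τ ε : ℝ} (ha : 0 < a) (hd : 0 ≤ d)
    (hk : ContinuousOn k (Ioc 0 T)) (hε : 0 < ε) (hετ : ε < τ) (hτ : τ < T) :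
    HeatAt a (duhamel a d p k ε) (fun x => k τ * heatSol a d p ((1 - d) * τ) x τ) τ := by
  have hsub : uIcc ε τ ⊆ Ioc 0 T := by
    rw [uIcc_of_le hετ.le]
    exact fun y hy => ⟨hε.trans_le hy.1, hy.2.trans hτ.le⟩
  have hq : ∀ ξ ∈ uIcc ε τ, 0 < d * τ + (1 - d) * ξ := by
    intro ξ hξ
    rw [uIcc_of_le hετ.le] at hξ
    exact (hε.trans_le hξ.1).trans_le (le_width hd hξ.2)
  have hsp := hasDerivAt_superposition (p := p) (m := fun _ => 0) ha (hk.mono hsub)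
    (c := fun ξ => (1 - d) * ξ) (by fun_prop) continuous_const hq
  simp only [sub_zero] at hsp
  refine ⟨_, _, fun y => (hsp y).1, fun y => (hsp y).2, fun x => ?_⟩
  -- The Leibniz rule needs the integrand around the diagonal, also for `ξ` slightly larger than
  -- `t`. There `ξ - t ≤ 2η`, and this `η` keeps the width `ξ - d(ξ - t)` at least `ε/2`.
  set η := ε / (4 * (d + 1)) with hη
  have hη0 : 0 < η := by positivity
  have hdη : d * (2 * η) ≤ ε / 2 := by
    rw [hη, show d * (2 * (ε / (4 * (d + 1)))) = ε / 2 * (d / (d + 1)) by field_simp; ring]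
    have : d / (d + 1) ≤ 1 := (div_le_one (by positivity)).2 (by linarith)
    nlinarith
  set r := min (τ + η) T
  have hr : r ≤ τ + η := min_le_left _ _
  have hrT : r ≤ T := min_le_right _ _
  have hpos : ∀ z ∈ Ioo (τ - η) r ×ˢ Ico ε r, 0 < d * z.1 + (1 - d) * z.2 := by
    rintro ⟨t, ξ⟩ ⟨ht, hξ⟩
    have h1 : -(2 * η) ≤ t - ξ := by
      have := ht.1
      have := hξ.2
      simp only at *
      linarith
    have h2 := mul_le_mul_of_nonneg_left h1 hd
    have h3 : ε ≤ ξ := hξ.1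
    simp only
    nlinarith
  have hcm : ContinuousOn (fun z : ℝ × ℝ => ((1 - d) * z.2, x, z.1)) (Ioo (τ - η) r ×ˢ Ico ε r) := by
    fun_prop
  have hk2 : ContinuousOn (fun z : ℝ × ℝ => k z.2) (Ioo (τ - η) r ×ˢ Ico ε r) :=
    hk.comp continuousOn_snd fun z hz => ⟨hε.trans_le hz.2.1, hz.2.2.le.trans hrT⟩
  have h := hasDerivAt_integral_upper_of_continuousOn
    (F := fun t ξ => k ξ * heatSol a d p ((1 - d) * ξ) x t)
    (F' := fun t ξ => k ξ * (a * heatSolDeriv2 a d p ((1 - d) * ξ) x t))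
    (l := τ - η) (r := r) (c := ε) (x₀ := τ) ⟨by linarith, lt_min (by linarith) hτ⟩ hετ
    (hk2.mul ((continuousOn_heatSol (d := d) (p := p) ha).comp hcm hpos))
    (fun t ht ξ hξ => (hasDerivAt_heatSol_time ha (hpos (t, ξ) ⟨ht, hξ⟩)).const_mul _)
    (hk2.mul (((continuousOn_heatSolDeriv2 (d := d) (p := p) ha).comp hcm hpos).const_mul a))
  refine h.congr_deriv ?_
  rw [add_comm, ← intervalIntegral.integral_const_mul]
  congr 1
  refine intervalIntegral.integral_congr fun y _ => ?_
  ring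

theorem continuousOn_duhamel {a d p : ℝ} {k : ℝ → ℝ} {T ε : ℝ} (ha : 0 < a) (hd : 0 ≤ d)
    (hk : ContinuousOn k (Ioc 0 T)) (hε : 0 < ε) (hεT : ε ≤ T) :
    ContinuousOn (Function.uncurry (duhamel a d p k ε)) (univ ×ˢ Icc ε T) := by
  -- Clamping the source time to `[ε, T]` and the width from below by `ε` gives a globally
  -- continuous integrand. It agrees with the original one for `ε ≤ ξ ≤ τ ≤ T`.
  set F : ℝ × ℝ → ℝ → ℝ := fun z ξ => k (max ε (min ξ T)) *
    heatSol a d p (max ((1 - d) * ξ) (ε - d * z.2)) z.1 z.2 with hF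
  have hFc : Continuous (Function.uncurry F) := by
    refine Continuous.mul ?_ ?_
    · exact hk.comp_continuous (f := fun z : (ℝ × ℝ) × ℝ => max ε (min z.2 T)) (by fun_prop)
        fun z => ⟨hε.trans_le (le_max_left _ _), max_le hεT (min_le_right _ _)⟩
    · refine (continuousOn_heatSol (d := d) (p := p) ha).comp_continuous
        (f := fun z : (ℝ × ℝ) × ℝ => (max ((1 - d) * z.2) (ε - d * z.1.2), z.1.1, z.1.2))
        (by fun_prop) fun z => ?_
      have := le_max_right ((1 - d) * z.2) (ε - d * z.1.2)
      simp only [mem_ofPred_eq]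
      linarith
  have h := intervalIntegral.continuous_parametric_intervalIntegral_of_continuous (μ := volume)
    (a₀ := ε) hFc (continuous_snd (X := ℝ) (Y := ℝ))
  refine h.continuousOn.congr ?_
  rintro ⟨x, τ⟩ ⟨-, hτ⟩
  simp only [Function.uncurry, duhamel, hF]
  refine intervalIntegral.integral_congr fun ξ hξ => ?_
  rw [uIcc_of_le hτ.1] at hξ
  have h1 : max ε (min ξ T) = ξ := by
    rw [min_eq_left (hξ.2.trans hτ.2), max_eq_right hξ.1]
  have h2 : max ((1 - d) * ξ) (ε - d * τ) = (1 - d) * ξ := by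
    apply max_eq_left
    have := le_width hd hξ.2
    linarith [hξ.1]
  simp only [h1, h2]

theorem abs_heatSol_le {a d p c x τ q : ℝ} (ha : 0 < a) (hd : 0 ≤ d) (hq : 0 < q)
    (hqc : q ≤ d * τ + c) :
    |heatSol a d p c x τ| ≤ Real.exp (p * x + a * p ^ 2 * τ) / Real.sqrt q := by
  have hpos : 0 < d * τ + c := hq.trans_le hqc
  rw [heatSol, abs_of_nonneg (by positivity)]
  have h1 : 0 ≤ d * (x + 2 * a * p * τ) ^ 2 / (4 * a * (d * τ + c)) := by positivity
  gcongr
  linarith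

/-- This crude bound takes absolute values and is uniform only for lower limits at least `ε`. It
handles the part of the integral away from the singularity. -/
theorem exists_abs_duhamel_le {a d : ℝ} (p : ℝ) {k : ℝ → ℝ} {T ε : ℝ} (ha : 0 < a) (hd : 0 ≤ d)
    (hk : ContinuousOn k (Ioc 0 T)) (hε : 0 < ε) :
    ∃ C, 0 ≤ C ∧ ∀ ε' ∈ Icc ε T, ∀ τ ∈ Icc ε' T, ∀ x,
      |duhamel a d p k ε' x τ| ≤ C * Real.exp (x ^ 2) := by
  obtain ⟨B, hB⟩ := (isCompact_Icc (a := ε) (b := T)).exists_bound_of_continuousOn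
    (hk.mono fun y hy => ⟨hε.trans_le hy.1, hy.2⟩)
  refine ⟨|B| * (Real.exp (p ^ 2 + a * p ^ 2 * T) / Real.sqrt ε) * |T|, by positivity, ?_⟩
  intro ε' hε' τ hτ x
  have hbound : ∀ ξ ∈ uIoc ε' τ, ‖k ξ * heatSol a d p ((1 - d) * ξ) x τ‖
      ≤ |B| * (Real.exp (p ^ 2 + a * p ^ 2 * T) / Real.sqrt ε * Real.exp (x ^ 2)) := by
    intro ξ hξ
    rw [uIoc_of_le hτ.1] at hξ
    have hξε : ε ≤ ξ := hε'.1.trans hξ.1.le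
    rw [norm_mul]
    refine mul_le_mul ((hB ξ ⟨hξε, hξ.2.trans hτ.2⟩).trans (le_abs_self B)) ?_ (norm_nonneg _)
      (abs_nonneg _)
    refine (abs_heatSol_le ha hd hε (hξε.trans (le_width hd hξ.2))).trans ?_
    rw [div_mul_eq_mul_div, ← Real.exp_add]
    refine div_le_div_of_nonneg_right (Real.exp_le_exp.2 ?_) (Real.sqrt_nonneg _)
    have h1 : a * p ^ 2 * τ ≤ a * p ^ 2 * T := mul_le_mul_of_nonneg_left hτ.2 (by positivity)
    nlinarith [sq_nonneg (p - x), sq_nonneg (p + x)]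
  have h := intervalIntegral.norm_integral_le_of_norm_le_const hbound
  have hlen : |τ - ε'| ≤ |T| := by
    rw [abs_of_nonneg (sub_nonneg.2 hτ.1)]
    have := hε'.1
    exact le_trans (by linarith [hτ.2]) (le_abs_self T)
  calc |duhamel a d p k ε' x τ| ≤ _ := h
    _ ≤ |B| * (Real.exp (p ^ 2 + a * p ^ 2 * T) / Real.sqrt ε * Real.exp (x ^ 2)) * |T| := by gcongr
    _ = _ := by ring

/-! ### A uniform bound through integration by parts -/

/-- Integration by parts moves the derivative onto `ρ`, so only the tail integrals of `f` enter and
never `∫ |f|`. The bound thus survives `ε → 0` even when `f` is not absolutely integrable near `0`.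
-/
theorem abs_integral_mul_le_of_abs_integral_le {f ρ ρ' : ℝ → ℝ} {ε s B R₀ R₁ : ℝ} (hε : ε ≤ s)
    (hf : ContinuousOn f (Icc ε s)) (hρ : ∀ ξ ∈ Icc ε s, HasDerivAt ρ (ρ' ξ) ξ)
    (hρ' : ContinuousOn ρ' (Icc ε s)) (hB : ∀ ξ ∈ Icc ε s, |∫ η in ξ..s, f η| ≤ B)
    (hR₀ : ∀ ξ ∈ Icc ε s, |ρ ξ| ≤ R₀) (hR₁ : ∀ ξ ∈ Icc ε s, |ρ' ξ| ≤ R₁) :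
    |∫ ξ in ε..s, ρ ξ * f ξ| ≤ B * R₀ + B * R₁ * (s - ε) := by
  have hεm : ε ∈ Icc ε s := left_mem_Icc.2 hε
  have hB0 : 0 ≤ B := (abs_nonneg _).trans (hB ε hεm)
  -- The extension of `f` by its endpoint values is continuous on the line, so its primitive is
  -- differentiable also at the endpoints.
  set g : ℝ → ℝ := fun ξ => f (max ε (min ξ s)) with hg
  have hgc : Continuous g := hf.comp_continuous (by fun_prop)
    fun z => ⟨le_max_left _ _, max_le hε (min_le_right _ _)⟩
  have hgf : ∀ ξ ∈ Icc ε s, g ξ = f ξ := fun ξ hξ => by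
    simp only [hg]
    rw [min_eq_left hξ.2, max_eq_right hξ.1]
  have hgB : ∀ ξ ∈ Icc ε s, |∫ η in ξ..s, g η| ≤ B := by
    intro ξ hξ
    have h : ∫ η in ξ..s, g η = ∫ η in ξ..s, f η := by
      refine intervalIntegral.integral_congr fun η hη => ?_
      rw [uIcc_of_le hξ.2] at hη
      exact hgf η ⟨hξ.1.trans hη.1, hη.2⟩
    rw [h]
    exact hB ξ hξ
  have hv : ∀ ξ, HasDerivAt (fun ξ => -∫ η in ξ..s, g η) (g ξ) ξ := fun ξ => by
    have h := (intervalIntegral.integral_hasDerivAt_left (hgc.intervalIntegrable ξ s)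
      (hgc.stronglyMeasurableAtFilter _ _) hgc.continuousAt).neg
    rw [neg_neg] at h
    exact h
  have hI := intervalIntegral.integral_mul_deriv_eq_deriv_mul (a := ε) (b := s) (u := ρ) (u' := ρ')
    (v := fun ξ => -∫ η in ξ..s, g η) (v' := g) (by rwa [uIcc_of_le hε]) (fun ξ _ => hv ξ)
    (ContinuousOn.intervalIntegrable (by rwa [uIcc_of_le hε])) (hgc.intervalIntegrable _ _)
  have h0 : ∫ ξ in ε..s, ρ ξ * f ξ = ∫ ξ in ε..s, ρ ξ * g ξ :=
    intervalIntegral.integral_congr fun ξ hξ => by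
      rw [uIcc_of_le hε] at hξ
      simp only [hgf ξ hξ]
  rw [h0, hI, intervalIntegral.integral_same, neg_zero, mul_zero, zero_sub]
  have h1 : |ρ ε * -∫ η in ε..s, g η| ≤ R₀ * B := by
    rw [abs_mul, abs_neg]
    exact mul_le_mul (hR₀ ε hεm) (hgB ε hεm) (abs_nonneg _) ((abs_nonneg _).trans (hR₀ ε hεm))
  have h2 : ‖∫ ξ in ε..s, ρ' ξ * -∫ η in ξ..s, g η‖ ≤ R₁ * B * |s - ε| := by
    refine intervalIntegral.norm_integral_le_of_norm_le_const fun ξ hξ => ?_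
    rw [uIoc_of_le hε] at hξ
    have hξ' : ξ ∈ Icc ε s := ⟨hξ.1.le, hξ.2⟩
    rw [Real.norm_eq_abs, abs_mul, abs_neg]
    exact mul_le_mul (hR₁ ξ hξ') (hgB ξ hξ') (abs_nonneg _) ((abs_nonneg _).trans (hR₁ ξ hξ'))
  rw [abs_of_nonneg (sub_nonneg.2 hε), Real.norm_eq_abs] at h2
  have h3 := abs_sub (-(ρ ε * -∫ η in ε..s, g η)) (∫ ξ in ε..s, ρ' ξ * -∫ η in ξ..s, g η)
  rw [abs_neg] at h3
  nlinarith

/-- As `ξ` runs from `0` to `τ` the width runs linearly from `dτ` to `τ`. For `d > 0` it is thus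
pinned between `min(d, 1) τ` and `max(d, 1) τ`. For `d = 0` it does vanish at `ξ = 0`, but it does
not depend on the time, so the ratio is `1` and the other two quantities are `0`. -/
theorem exists_width_bounds {d τ₀ τ₁ : ℝ} (hd : 0 ≤ d) (h₀ : 0 < τ₀) (h₁ : 0 < τ₁) :
    ∃ K, 0 ≤ K ∧ ∀ ξ, 0 < ξ → ξ ≤ τ₀ → ξ ≤ τ₁ →
      Real.sqrt (d * τ₀ + (1 - d) * ξ) / Real.sqrt (d * τ₁ + (1 - d) * ξ) ≤ K ∧
      d / (d * τ₁ + (1 - d) * ξ) ^ 2 ≤ K ∧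
      |1 / (d * τ₀ + (1 - d) * ξ) - 1 / (d * τ₁ + (1 - d) * ξ)| ≤ K := by
  rcases hd.eq_or_lt with rfl | hd
  · refine ⟨1, zero_le_one, fun ξ hξ _ _ => ⟨?_, ?_, ?_⟩⟩
    · simp only [zero_mul, zero_add]
      exact div_self_le_one _
    · simp
    · simp
  · have hlow : ∀ τ ξ, 0 < ξ → ξ ≤ τ → min d 1 * τ ≤ d * τ + (1 - d) * ξ := by
      intro τ ξ hξ hle
      have hτ : 0 ≤ τ := hξ.le.trans hle
      rcases le_total d 1 with h | h
      · rw [min_eq_left h]; nlinarith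
      · rw [min_eq_right h]; nlinarith
    have hup : ∀ τ ξ, 0 < ξ → ξ ≤ τ → d * τ + (1 - d) * ξ ≤ max d 1 * τ := by
      intro τ ξ hξ hle
      have hτ : 0 ≤ τ := hξ.le.trans hle
      rcases le_total d 1 with h | h
      · rw [max_eq_right h]; nlinarith
      · rw [max_eq_left h]; nlinarith
    have hm : 0 < min d 1 := lt_min hd one_pos
    set q₀ := min d 1 * τ₀
    set q₁ := min d 1 * τ₁
    have hq₀ : 0 < q₀ := by positivity
    have hq₁ : 0 < q₁ := by positivity
    set K₁ := Real.sqrt (max d 1 * τ₀) / Real.sqrt q₁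
    have e1 : 0 ≤ K₁ := by positivity
    have e2 : 0 ≤ d / q₁ ^ 2 := by positivity
    have e3 : 0 ≤ 1 / q₀ := by positivity
    have e4 : 0 ≤ 1 / q₁ := by positivity
    refine ⟨K₁ + d / q₁ ^ 2 + (1 / q₀ + 1 / q₁), by positivity, fun ξ hξ hξ₀ hξ₁ => ?_⟩
    have l0 := hlow τ₀ ξ hξ hξ₀
    have l1 := hlow τ₁ ξ hξ hξ₁
    have u0 := hup τ₀ ξ hξ hξ₀
    refine ⟨?_, ?_, ?_⟩
    · have : Real.sqrt (d * τ₀ + (1 - d) * ξ) / Real.sqrt (d * τ₁ + (1 - d) * ξ) ≤ K₁ := by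
        have h1 : 0 < Real.sqrt q₁ := Real.sqrt_pos.2 hq₁
        exact div_le_div₀ (Real.sqrt_nonneg _) (Real.sqrt_le_sqrt u0) h1 (Real.sqrt_le_sqrt l1)
      linarith
    · have : d / (d * τ₁ + (1 - d) * ξ) ^ 2 ≤ d / q₁ ^ 2 := by gcongr
      linarith
    · have f0 : 1 / (d * τ₀ + (1 - d) * ξ) ≤ 1 / q₀ := by gcongr
      have f1 : 1 / (d * τ₁ + (1 - d) * ξ) ≤ 1 / q₁ := by gcongr
      have g0 : 0 ≤ 1 / (d * τ₀ + (1 - d) * ξ) := one_div_nonneg.2 (hq₀.le.trans l0)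
      have g1 : 0 ≤ 1 / (d * τ₁ + (1 - d) * ξ) := one_div_nonneg.2 (hq₁.le.trans l1)
      rw [abs_le]
      constructor <;> linarith


/-- The quotient of two Gaussian solutions, as a function of the time of the source. -/
noncomputable def widthRatio (d τ₀ s m e ξ : ℝ) : ℝ :=
  Real.exp (e - m / (d * s + (1 - d) * ξ)) *
    (Real.sqrt (d * τ₀ + (1 - d) * ξ) / Real.sqrt (d * s + (1 - d) * ξ))

/-- The logarithmic derivative of `widthRatio`. -/
noncomputable def widthRatioLog (d τ₀ s m ξ : ℝ) : ℝ :=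
  (1 - d) * (m / (d * s + (1 - d) * ξ) ^ 2
    + (1 / (d * τ₀ + (1 - d) * ξ) - 1 / (d * s + (1 - d) * ξ)) / 2)

theorem hasDerivAt_widthRatio {d τ₀ s m e ξ : ℝ} (q0 : 0 < d * τ₀ + (1 - d) * ξ)
    (q1 : 0 < d * s + (1 - d) * ξ) :
    HasDerivAt (widthRatio d τ₀ s m e) (widthRatio d τ₀ s m e ξ * widthRatioLog d τ₀ s m ξ) ξ := by
  have r0 : 0 < Real.sqrt (d * τ₀ + (1 - d) * ξ) := Real.sqrt_pos.2 q0
  have r1 : 0 < Real.sqrt (d * s + (1 - d) * ξ) := Real.sqrt_pos.2 q1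
  have l0 : HasDerivAt (fun ξ : ℝ => d * τ₀ + (1 - d) * ξ) (1 - d) ξ :=
    (((hasDerivAt_id ξ).const_mul (1 - d)).const_add (d * τ₀)).congr_deriv (by ring)
  have l1 : HasDerivAt (fun ξ : ℝ => d * s + (1 - d) * ξ) (1 - d) ξ :=
    (((hasDerivAt_id ξ).const_mul (1 - d)).const_add (d * s)).congr_deriv (by ring)
  have he : HasDerivAt (fun ξ : ℝ => e - m / (d * s + (1 - d) * ξ))
      (m * (1 - d) / (d * s + (1 - d) * ξ) ^ 2) ξ := by
    refine (((hasDerivAt_const ξ m).div l1 q1.ne').const_sub (e)).congr_deriv ?_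
    ring
  refine (he.exp.mul ((l0.sqrt q0.ne').div (l1.sqrt q1.ne') r1.ne')).congr_deriv ?_
  simp only [widthRatio, widthRatioLog, Pi.div_apply]
  have h0 : d * τ₀ + (1 - d) * ξ = Real.sqrt (d * τ₀ + (1 - d) * ξ) ^ 2 :=
    (Real.sq_sqrt q0.le).symm
  have h1 : d * s + (1 - d) * ξ = Real.sqrt (d * s + (1 - d) * ξ) ^ 2 :=
    (Real.sq_sqrt q1.le).symm
  generalize Real.sqrt (d * τ₀ + (1 - d) * ξ) = R0 at *
  generalize Real.sqrt (d * s + (1 - d) * ξ) = R1 at *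
  rw [h0, h1]
  generalize Real.exp (e - m / R1 ^ 2) = E
  field_simp

set_option maxHeartbeats 1000000 in
/-- If the Duhamel integrals stay bounded at one point of the time `τ₀` as the lower limit tends to
`0`, then they stay bounded at every time, with Gaussian growth in space. -/
theorem exists_abs_duhamel_le_of_bounded {a d p : ℝ} {k : ℝ → ℝ} {T τ₀ s B : ℝ} (ha : 0 < a)
    (hd : 0 ≤ d) (hk : ContinuousOn k (Ioc 0 T)) (hτ₀ : τ₀ ∈ Ioc 0 T) (hs : s ∈ Ioc 0 T)
    (hB : ∀ ε ∈ Ioc 0 τ₀, |duhamel a d p k ε (-(2 * a * p * τ₀)) τ₀| ≤ B) :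
    ∃ C, 0 ≤ C ∧ ∀ ε ∈ Ioc 0 s, ∀ y, |duhamel a d p k ε y s| ≤ C * Real.exp (y ^ 2) := by
  obtain ⟨K, hK0, hK⟩ := exists_width_bounds hd hτ₀.1 hs.1
  -- Below `s₀` both times lie after the source time and the two integrands can be compared. Above
  -- `s₀` the crude bound suffices.
  set s₀ := min τ₀ s with hs₀
  have hs₀pos : 0 < s₀ := lt_min hτ₀.1 hs.1
  have hs₀τ : s₀ ≤ τ₀ := min_le_left _ _
  have hs₀s : s₀ ≤ s := min_le_right _ _
  have hB0 : 0 ≤ B := (abs_nonneg _).trans (hB τ₀ ⟨hτ₀.1, le_rfl⟩)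
  obtain ⟨C₁, hC₁, hC₁b⟩ := exists_abs_duhamel_le p ha hd hk hs₀pos
  -- At this point the quadratic term in the exponent of `heatSol` vanishes, so at time `τ₀` the
  -- Gaussian depends on `ξ` only through the square root of the width. The constant `c₀` below
  -- collects the difference of the remaining exponents.
  set x₀ := -(2 * a * p * τ₀) with hx₀
  set c₀ := a * p ^ 2 * s - p * x₀ - a * p ^ 2 * τ₀ with hc₀
  set A₀ := Real.exp (p ^ 2 / 2 + c₀) * K with hA₀
  have hA₀0 : 0 ≤ A₀ := by positivity
  set A₁ := |1 - d| * (K * (4 + 2 * (2 * a * p * s) ^ 2) / (4 * a) + K / 2) with hA₁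
  have hA₁0 : 0 ≤ A₁ := by positivity
  set f : ℝ → ℝ := fun ξ => k ξ * heatSol a d p ((1 - d) * ξ) x₀ τ₀ with hf
  -- The tail integral is a difference of two Duhamel integrals at `(x₀, τ₀)`, each bounded by `B`.
  have hint : ∀ ξ ∈ Ioc 0 s₀, |∫ η in ξ..s₀, f η| ≤ 2 * B := by
    intro ξ hξ
    have h1 : (∫ η in ξ..s₀, f η) = duhamel a d p k ξ x₀ τ₀ - duhamel a d p k s₀ x₀ τ₀ := by
      have h0 : ∀ z ∈ Ioc 0 τ₀, ∀ w ∈ Ioc 0 τ₀, IntervalIntegrable f volume z w := fun z hz w hw =>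
        intervalIntegrable_duhamel_integrand ha hd hk hτ₀.2 hz hw x₀
      rw [duhamel, duhamel, ← intervalIntegral.integral_add_adjacent_intervals (b := s₀)
        (h0 ξ ⟨hξ.1, hξ.2.trans hs₀τ⟩ s₀ ⟨hs₀pos, hs₀τ⟩)
        (h0 s₀ ⟨hs₀pos, hs₀τ⟩ τ₀ ⟨hτ₀.1, le_rfl⟩)]
      ring
    rw [h1]
    have h2 := abs_sub (duhamel a d p k ξ x₀ τ₀) (duhamel a d p k s₀ x₀ τ₀)
    have h3 := hB ξ ⟨hξ.1, hξ.2.trans hs₀τ⟩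
    have h4 := hB s₀ ⟨hs₀pos, hs₀τ⟩
    linarith
  have hpart : ∀ y, ∀ ε ∈ Ioc 0 s₀,
      |∫ ξ in ε..s₀, k ξ * heatSol a d p ((1 - d) * ξ) y s|
        ≤ (2 * B * A₀ + 2 * B * (A₀ * A₁) * s₀) * Real.exp (y ^ 2) := by
    intro y ε hε
    set m := d * (y + 2 * a * p * s) ^ 2 / (4 * a) with hm
    have hm0 : 0 ≤ m := by positivity
    set ρ : ℝ → ℝ := widthRatio d τ₀ s m (p * y + c₀) with hρ
    set lg : ℝ → ℝ := widthRatioLog d τ₀ s m with hlg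
    have hmem : ∀ ξ ∈ Icc ε s₀, 0 < ξ ∧ ξ ≤ τ₀ ∧ ξ ≤ s := fun ξ hξ =>
      ⟨hε.1.trans_le hξ.1, hξ.2.trans hs₀τ, hξ.2.trans hs₀s⟩
    have hQ0 : ∀ ξ ∈ Icc ε s₀, 0 < d * τ₀ + (1 - d) * ξ := fun ξ hξ =>
      (hmem ξ hξ).1.trans_le (le_width hd (hmem ξ hξ).2.1)
    have hQ1 : ∀ ξ ∈ Icc ε s₀, 0 < d * s + (1 - d) * ξ := fun ξ hξ =>
      (hmem ξ hξ).1.trans_le (le_width hd (hmem ξ hξ).2.2)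
    have hfc : ContinuousOn f (Icc ε s₀) :=
      (continuousOn_duhamel_integrand ha hd hk hτ₀.2 x₀).mono fun ξ hξ =>
        ⟨(hmem ξ hξ).1, (hmem ξ hξ).2.1⟩
    have heq : (∫ ξ in ε..s₀, k ξ * heatSol a d p ((1 - d) * ξ) y s) = ∫ ξ in ε..s₀, ρ ξ * f ξ := by
      refine intervalIntegral.integral_congr fun ξ hξ => ?_
      rw [uIcc_of_le hε.2] at hξ
      have q0 := hQ0 ξ hξ
      have q1 := hQ1 ξ hξ
      have r0 : 0 < Real.sqrt (d * τ₀ + (1 - d) * ξ) := Real.sqrt_pos.2 q0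
      have r1 : 0 < Real.sqrt (d * s + (1 - d) * ξ) := Real.sqrt_pos.2 q1
      have e1 : p * y + a * p ^ 2 * s - d * (y + 2 * a * p * s) ^ 2 /
          (4 * a * (d * s + (1 - d) * ξ)) = (p * y + c₀ - m / (d * s + (1 - d) * ξ))
          + (p * x₀ + a * p ^ 2 * τ₀) := by
        rw [hc₀, hm]
        field_simp
        ring
      have e2 : p * x₀ + a * p ^ 2 * τ₀ - d * (x₀ + 2 * a * p * τ₀) ^ 2 /
          (4 * a * (d * τ₀ + (1 - d) * ξ)) = p * x₀ + a * p ^ 2 * τ₀ := by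
        rw [hx₀, neg_add_cancel]
        simp
      simp only [hρ, hf, heatSol, widthRatio]
      rw [e1, e2, Real.exp_add]
      field_simp
    have hρd : ∀ ξ ∈ Icc ε s₀, HasDerivAt ρ (ρ ξ * lg ξ) ξ := by
      intro ξ hξ
      have q0 := hQ0 ξ hξ
      have q1 := hQ1 ξ hξ
      exact hasDerivAt_widthRatio q0 q1
    have hlgc : ContinuousOn lg (Icc ε s₀) := by
      have n0 : ∀ ξ ∈ Icc ε s₀, d * τ₀ + (1 - d) * ξ ≠ 0 := fun ξ hξ => (hQ0 ξ hξ).ne'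
      have n1 : ∀ ξ ∈ Icc ε s₀, d * s + (1 - d) * ξ ≠ 0 := fun ξ hξ => (hQ1 ξ hξ).ne'
      have n2 : ∀ ξ ∈ Icc ε s₀, (d * s + (1 - d) * ξ) ^ 2 ≠ 0 := fun ξ hξ =>
        pow_ne_zero 2 (hQ1 ξ hξ).ne'
      rw [hlg]
      unfold widthRatioLog
      fun_prop (disch := assumption)
    have hρ'c : ContinuousOn (fun ξ => ρ ξ * lg ξ) (Icc ε s₀) := by
      refine ContinuousOn.mul (fun ξ hξ => ?_) hlgc
      exact (hρd ξ hξ).continuousAt.continuousWithinAt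
    -- The allowed growth is shared out: one factor `e^{y²/2}` for the `e^{py}` in the ratio, the
    -- other for the quadratic growth of its logarithmic derivative.
    have hy : Real.exp (y ^ 2) = Real.exp (y ^ 2 / 2) * Real.exp (y ^ 2 / 2) := by
      rw [← Real.exp_add]; congr 1; ring
    have hy1 : 1 ≤ Real.exp (y ^ 2 / 2) := Real.one_le_exp (by positivity)
    have hy2 : y ^ 2 / 2 ≤ Real.exp (y ^ 2 / 2) := by linarith [Real.add_one_le_exp (y ^ 2 / 2)]
    have hρb : ∀ ξ ∈ Icc ε s₀, |ρ ξ| ≤ A₀ * Real.exp (y ^ 2 / 2) := by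
      intro ξ hξ
      obtain ⟨k1, -, -⟩ := hK ξ (hmem ξ hξ).1 (hmem ξ hξ).2.1 (hmem ξ hξ).2.2
      have hpos : 0 ≤ ρ ξ := by simp only [hρ, widthRatio]; positivity
      rw [abs_of_nonneg hpos]
      have h1 : Real.exp (p * y + c₀ - m / (d * s + (1 - d) * ξ))
          ≤ Real.exp (p ^ 2 / 2 + c₀) * Real.exp (y ^ 2 / 2) := by
        rw [← Real.exp_add, Real.exp_le_exp]
        have := div_nonneg hm0 (hQ1 ξ hξ).le
        nlinarith [sq_nonneg (p - y)]
      calc ρ ξ ≤ (Real.exp (p ^ 2 / 2 + c₀) * Real.exp (y ^ 2 / 2)) * K :=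
            mul_le_mul h1 k1 (by positivity) (by positivity)
        _ = _ := by rw [hA₀]; ring
    have hlgb : ∀ ξ ∈ Icc ε s₀, |lg ξ| ≤ A₁ * Real.exp (y ^ 2 / 2) := by
      intro ξ hξ
      obtain ⟨-, k2, k3⟩ := hK ξ (hmem ξ hξ).1 (hmem ξ hξ).2.1 (hmem ξ hξ).2.2
      have h1 : |m / (d * s + (1 - d) * ξ) ^ 2|
          ≤ K * (4 + 2 * (2 * a * p * s) ^ 2) / (4 * a) * Real.exp (y ^ 2 / 2) := by
        rw [abs_of_nonneg (by positivity)]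
        have e : m / (d * s + (1 - d) * ξ) ^ 2
            = d / (d * s + (1 - d) * ξ) ^ 2 * ((y + 2 * a * p * s) ^ 2 / (4 * a)) := by
          rw [hm]; ring
        rw [e]
        have h2 : (y + 2 * a * p * s) ^ 2
            ≤ (4 + 2 * (2 * a * p * s) ^ 2) * Real.exp (y ^ 2 / 2) := by
          have h3 : (y + 2 * a * p * s) ^ 2 ≤ 2 * y ^ 2 + 2 * (2 * a * p * s) ^ 2 := by
            nlinarith [sq_nonneg (y - 2 * a * p * s)]
          have h4 := mul_le_mul_of_nonneg_left hy1 (sq_nonneg (2 * a * p * s))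
          linarith
        calc _ ≤ K * ((4 + 2 * (2 * a * p * s) ^ 2) * Real.exp (y ^ 2 / 2) / (4 * a)) := by
              gcongr
          _ = _ := by ring
      have h2 : |(1 / (d * τ₀ + (1 - d) * ξ) - 1 / (d * s + (1 - d) * ξ)) / 2|
          ≤ K / 2 * Real.exp (y ^ 2 / 2) := by
        rw [abs_div, abs_two]
        nlinarith
      simp only [hlg, widthRatioLog]
      rw [abs_mul, hA₁, mul_assoc]
      refine mul_le_mul_of_nonneg_left ?_ (abs_nonneg _)
      refine (abs_add_le _ _).trans ?_
      linarith
    have hR1 : ∀ ξ ∈ Icc ε s₀, |ρ ξ * lg ξ| ≤ A₀ * A₁ * Real.exp (y ^ 2) := by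
      intro ξ hξ
      rw [abs_mul, hy]
      calc _ ≤ (A₀ * Real.exp (y ^ 2 / 2)) * (A₁ * Real.exp (y ^ 2 / 2)) :=
            mul_le_mul (hρb ξ hξ) (hlgb ξ hξ) (abs_nonneg _) (by positivity)
        _ = _ := by ring
    have hR0 : ∀ ξ ∈ Icc ε s₀, |ρ ξ| ≤ A₀ * Real.exp (y ^ 2) := by
      intro ξ hξ
      refine (hρb ξ hξ).trans (mul_le_mul_of_nonneg_left ?_ hA₀0)
      rw [hy]
      nlinarith
    rw [heq]
    refine (abs_integral_mul_le_of_abs_integral_le hε.2 hfc hρd hρ'c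
      (fun ξ hξ => hint ξ ⟨(hmem ξ hξ).1, hξ.2⟩) hR0 hR1).trans ?_
    have h1 : 2 * B * (A₀ * A₁ * Real.exp (y ^ 2)) * (s₀ - ε)
        ≤ 2 * B * (A₀ * A₁ * Real.exp (y ^ 2)) * s₀ :=
      mul_le_mul_of_nonneg_left (by linarith [hε.1]) (by positivity)
    linarith
  refine ⟨2 * B * A₀ + 2 * B * (A₀ * A₁) * s₀ + C₁, by positivity, fun ε hε y => ?_⟩
  have hE := Real.exp_pos (y ^ 2)
  have hD : 0 ≤ 2 * B * A₀ + 2 * B * (A₀ * A₁) * s₀ := by positivity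
  rcases le_total s₀ ε with h | h
  · have h1 := hC₁b ε ⟨h, hε.2.trans hs.2⟩ s ⟨hε.2, hs.2⟩ y
    nlinarith
  · have h1 := hC₁b s₀ ⟨le_rfl, hs₀s.trans hs.2⟩ s ⟨hs₀s, hs.2⟩ y
    have h2 := hpart y ε ⟨hε.1, h⟩
    have h3 : duhamel a d p k ε y s = (∫ ξ in ε..s₀, k ξ * heatSol a d p ((1 - d) * ξ) y s)
        + duhamel a d p k s₀ y s := by
      rw [duhamel, duhamel, intervalIntegral.integral_add_adjacent_intervals]
      · exact intervalIntegrable_duhamel_integrand ha hd hk hs.2 hε ⟨hs₀pos, hs₀s⟩ y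
      · exact intervalIntegrable_duhamel_integrand ha hd hk hs.2 ⟨hs₀pos, hs₀s⟩ ⟨hs.1, le_rfl⟩ y
    rw [h3]
    refine (abs_add_le _ _).trans ?_
    linarith

/-! ### Convergence of the Duhamel integrals to the solution -/

/-- The kernel times a cutoff is a test function, and against it `u(·, ε)` tends to `0`. The uniform
Gaussian bound on `u` controls the rest by `M ∫ |K(τ₀ - ε) - φ n| e^{by²}`, where `K(t)` is the heat
kernel at time `t`. As `ε → 0` this tends to the truncation error alone, which is small for large
`n`. -/
theorem tendsto_heatKernel_integral {a b M τ₀ : ℝ} (ha : 0 < a) (hb : 0 ≤ b) (hτ₀ : 0 < τ₀)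
    (hsmall : 16 * a * (b + 1) * τ₀ ≤ 1) {u : ℝ → ℝ → ℝ}
    (hu : ∀ ε ∈ Ioc 0 τ₀, Continuous fun y => u y ε)
    (hgrow : ∀ x, ∀ τ ∈ Ioc 0 τ₀, |u x τ| ≤ M * Real.exp (b * x ^ 2))
    (hinit : ∀ φ : ℝ → ℝ, ContDiff ℝ ∞ φ → HasCompactSupport φ →
      Tendsto (fun τ => ∫ x, u x τ * φ x) (𝓝[>] 0) (𝓝 0)) (x : ℝ) :
    Tendsto (fun ε => ∫ y, heatKernel a (x - y) (τ₀ - ε) * u y ε) (𝓝[>] 0) (𝓝 0) := by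
  have hM : 0 ≤ M := by
    have := (abs_nonneg _).trans (hgrow 0 τ₀ ⟨hτ₀, le_rfl⟩)
    simpa using this
  set φ : ℕ → ℝ → ℝ := fun n y => heatKernel a (x - y) τ₀ * cutoff n y with hφ
  have hKc : ∀ t, Continuous fun y => heatKernel a (x - y) t := fun t =>
    continuous_heatKernel.comp (by fun_prop)
  have hφc : ∀ n, Continuous (φ n) := fun n => (hKc τ₀).mul (cutoff n).continuous
  have hφs : ∀ n, HasCompactSupport (φ n) := fun n => (cutoff n).hasCompactSupport.mul_left
  have hφd : ∀ n, ContDiff ℝ ∞ (φ n) := fun n => by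
    refine ContDiff.mul ?_ (cutoff n).contDiff
    simp only [heatKernel_eq]
    fun_prop
  have hφ0 : ∀ n y, 0 ≤ φ n y := fun n y => mul_nonneg (heatKernel_nonneg _ _ _) (cutoff n).nonneg
  have hφle : ∀ n y, φ n y ≤ heatKernel a (x - y) τ₀ := fun n y =>
    mul_le_of_le_one_right (heatKernel_nonneg _ _ _) (cutoff n).le_one
  -- The times `τ₀ - ε` are kept in `[τ₀/2, τ₀]`, so that one integrable majorant serves all of
  -- them.
  set N : ℝ := (Real.sqrt (4 * Real.pi * a))⁻¹ * (Real.sqrt (τ₀ / 2))⁻¹ *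
    Real.exp (4 * (b + 1) * x ^ 2) with hN
  have hNint : Integrable fun y : ℝ => 2 * (N * Real.exp (-(b + 2) * y ^ 2)) :=
    ((integrable_exp_neg_mul_sq (b := b + 2) (by linarith)).const_mul N).const_mul 2
  have hKle : ∀ t, τ₀ / 2 ≤ t → t ≤ τ₀ → ∀ y,
      heatKernel a (x - y) t * Real.exp (b * y ^ 2) ≤ N * Real.exp (-(b + 2) * y ^ 2) := by
    intro t h1 h2 y
    refine heatKernel_mul_exp_le ha hb (by positivity) h1 ?_ x y
    have : 16 * a * (b + 1) * t ≤ 16 * a * (b + 1) * τ₀ :=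
      mul_le_mul_of_nonneg_left h2 (by positivity)
    linarith
  have hdiff : ∀ n t, τ₀ / 2 ≤ t → t ≤ τ₀ → ∀ y,
      ‖|heatKernel a (x - y) t - φ n y| * Real.exp (b * y ^ 2)‖
        ≤ 2 * (N * Real.exp (-(b + 2) * y ^ 2)) := by
    intro n t h1 h2 y
    have hE := Real.exp_pos (b * y ^ 2)
    rw [Real.norm_of_nonneg (by positivity)]
    have h3 : |heatKernel a (x - y) t - φ n y| ≤ heatKernel a (x - y) t + heatKernel a (x - y) τ₀ := by
      rw [abs_le]
      have := heatKernel_nonneg a (x - y) t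
      have := heatKernel_nonneg a (x - y) τ₀
      constructor <;> linarith [hφ0 n y, hφle n y]
    have h4 := mul_le_mul_of_nonneg_right h3 hE.le
    linarith [hKle t h1 h2 y, hKle τ₀ (by linarith) le_rfl y]
  have hmeas : ∀ n t, AEStronglyMeasurable
      (fun y => |heatKernel a (x - y) t - φ n y| * Real.exp (b * y ^ 2)) volume := fun n t =>
    Continuous.aestronglyMeasurable (((hKc t).sub (hφc n)).abs.mul (by fun_prop))
  have hev : ∀ᶠ ε in 𝓝[>] (0 : ℝ), ε ∈ Ioo 0 (τ₀ / 2) := Ioo_mem_nhdsGT (by positivity)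
  have hD1 : ∀ n, Tendsto
      (fun ε => ∫ y, |heatKernel a (x - y) (τ₀ - ε) - φ n y| * Real.exp (b * y ^ 2)) (𝓝[>] 0)
      (𝓝 (∫ y, |heatKernel a (x - y) τ₀ - φ n y| * Real.exp (b * y ^ 2))) := by
    intro n
    refine tendsto_integral_filter_of_dominated_convergence _
      (Eventually.of_forall fun ε => hmeas n _) ?_ hNint ?_
    · filter_upwards [hev] with ε hε
      exact Eventually.of_forall
        (hdiff n (τ₀ - ε) (by linarith [hε.2]) (by linarith [hε.1]))
    · refine Eventually.of_forall fun y => ?_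
      have hc : ContinuousAt (fun ε => |heatKernel a (x - y) (τ₀ - ε) - φ n y| *
          Real.exp (b * y ^ 2)) 0 := by
        simp only [heatKernel_eq]
        have h1 : 4 * a * (τ₀ - 0) ≠ 0 := by rw [sub_zero]; positivity
        have h2 : Real.sqrt (τ₀ - 0) ≠ 0 := by rw [sub_zero]; exact (Real.sqrt_pos.2 hτ₀).ne'
        fun_prop (disch := assumption)
      have h := hc.tendsto.mono_left (nhdsWithin_le_nhds (s := Ioi 0))
      simpa only [sub_zero] using h
  have hD2 : Tendsto (fun n => ∫ y, |heatKernel a (x - y) τ₀ - φ n y| * Real.exp (b * y ^ 2))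
      atTop (𝓝 0) := by
    rw [← integral_zero ℝ ℝ (μ := volume)]
    refine tendsto_integral_of_dominated_convergence _ (fun n => hmeas n _) hNint
      (fun n => Eventually.of_forall (hdiff n τ₀ (by linarith) le_rfl)) ?_
    refine Eventually.of_forall fun y => ?_
    have h := ((((tendsto_cutoff y).const_mul (heatKernel a (x - y) τ₀)).const_sub
      (heatKernel a (x - y) τ₀)).abs).mul_const (Real.exp (b * y ^ 2))
    simpa using h
  rw [Metric.tendsto_nhds]
  intro η hη
  have hη' : 0 < η / 2 / (M + 1) := by positivity
  obtain ⟨n, hn⟩ := (hD2.eventually (gt_mem_nhds hη')).exists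
  have h1 := (hD1 n).eventually (gt_mem_nhds hn)
  have h2 := (Metric.tendsto_nhds.1 (hinit (φ n) (hφd n) (hφs n))) (η / 2) (by positivity)
  filter_upwards [hev, h1, h2] with ε hε h1 h2
  rw [dist_zero_right, Real.norm_eq_abs] at h2 ⊢
  have hεI : ε ∈ Ioc 0 τ₀ := ⟨hε.1, by linarith [hε.2]⟩
  have hut : Continuous fun y => u y ε := hu ε hεI
  have i1 : Integrable fun y => u y ε * φ n y :=
    (hut.mul (hφc n)).integrable_of_hasCompactSupport ((hφs n).mul_left)
  have hb2 : ∀ y, ‖(heatKernel a (x - y) (τ₀ - ε) - φ n y) * u y ε‖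
      ≤ M * (|heatKernel a (x - y) (τ₀ - ε) - φ n y| * Real.exp (b * y ^ 2)) := by
    intro y
    rw [norm_mul, Real.norm_eq_abs, Real.norm_eq_abs]
    have := mul_le_mul_of_nonneg_left (hgrow y ε hεI)
      (abs_nonneg (heatKernel a (x - y) (τ₀ - ε) - φ n y))
    linarith
  have i3 : Integrable fun y =>
      |heatKernel a (x - y) (τ₀ - ε) - φ n y| * Real.exp (b * y ^ 2) :=
    hNint.mono' (hmeas n _) (Eventually.of_forall
      (hdiff n (τ₀ - ε) (by linarith [hε.2]) (by linarith [hε.1])))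
  have i2 : Integrable fun y => (heatKernel a (x - y) (τ₀ - ε) - φ n y) * u y ε :=
    (i3.const_mul M).mono' (Continuous.aestronglyMeasurable (((hKc _).sub (hφc n)).mul hut))
      (Eventually.of_forall hb2)
  have heq : (∫ y, heatKernel a (x - y) (τ₀ - ε) * u y ε)
      = (∫ y, u y ε * φ n y) + ∫ y, (heatKernel a (x - y) (τ₀ - ε) - φ n y) * u y ε := by
    rw [← integral_add i1 i2]
    congr 1
    ext y
    ring
  have h3 := norm_integral_le_of_norm_le (i3.const_mul M) (Eventually.of_forall hb2)
  rw [integral_const_mul, Real.norm_eq_abs] at h3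
  have h4 : M * (∫ y, |heatKernel a (x - y) (τ₀ - ε) - φ n y| * Real.exp (b * y ^ 2)) ≤ η / 2 := by
    have h5 := mul_le_mul_of_nonneg_left h1.le hM
    have h6 : M * (η / 2 / (M + 1)) ≤ η / 2 := by
      rw [mul_div_assoc', div_le_iff₀ (by positivity)]
      nlinarith
    linarith
  rw [heq]
  have h5 := abs_add_le (∫ y, u y ε * φ n y)
    (∫ y, (heatKernel a (x - y) (τ₀ - ε) - φ n y) * u y ε)
  linarith

/-- The sources cancel, so the difference solves the homogeneous equation. The Duhamel term
contributes growth `e^{y²}`, which raises the rate to `b + 1` and the smallness condition to `b +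
2`. -/
theorem sub_duhamel_representation {a b d p M T ε s t₁ : ℝ} {k : ℝ → ℝ} {u : ℝ → ℝ → ℝ}
    (ha : 0 < a) (hd : 0 ≤ d) (hb : 0 ≤ b) (hk : ContinuousOn k (Ioc 0 T))
    (hcont : ContinuousOn (Function.uncurry u) (univ ×ˢ Ioc 0 T))
    (hheat : ∀ τ ∈ Ioo 0 T, HeatAt a u (fun x => k τ * heatSol a d p ((1 - d) * τ) x τ) τ)
    (hgrow : ∀ x, ∀ τ ∈ Ioc 0 T, |u x τ| ≤ M * Real.exp (b * x ^ 2))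
    (hε : 0 < ε) (hεs : ε ≤ s) (hst : s < t₁) (ht₁ : t₁ ≤ T)
    (hsmall : 16 * a * (b + 2) * (t₁ - s) ≤ 1) (x : ℝ) :
    u x t₁ - duhamel a d p k ε x t₁
      = ∫ y, heatKernel a (x - y) (t₁ - s) * (u y s - duhamel a d p k ε y s) := by
  obtain ⟨C, hC, hCb⟩ := exists_abs_duhamel_le p ha hd hk hε
  have hεT : ε ≤ T := hεs.trans (hst.le.trans ht₁)
  have hM : 0 ≤ M := by
    have := (abs_nonneg _).trans (hgrow 0 ε ⟨hε, hεT⟩)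
    simpa using this
  refine heat_representation (w := fun x t => u x t - duhamel a d p k ε x t) (C := M + C)
    (b := b + 1) ha (by linarith) hst (by linarith) ?_ ?_ ?_ x
  · exact (hcont.mono (prod_mono Subset.rfl fun t ht => ⟨hε.trans_le (hεs.trans ht.1),
      ht.2.trans ht₁⟩)).sub ((continuousOn_duhamel (p := p) ha hd hk hε hεT).mono
      (prod_mono Subset.rfl fun t ht => ⟨hεs.trans ht.1, ht.2.trans ht₁⟩))
  · intro t ht
    have ht0 : ε < t := hεs.trans_lt ht.1
    have htT : t < T := ht.2.trans_le ht₁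
    have := (hheat t ⟨hε.trans ht0, htT⟩).sub (heatAt_duhamel (p := p) ha hd hk hε ht0 htT)
    simpa only [sub_self] using this
  · intro y t ht
    have h1 := hgrow y t ⟨hε.trans_le (hεs.trans ht.1), ht.2.trans ht₁⟩
    have h2 := hCb ε ⟨le_rfl, hεT⟩ t ⟨hεs.trans ht.1, ht.2.trans ht₁⟩ y
    have e1 : Real.exp (b * y ^ 2) ≤ Real.exp ((b + 1) * y ^ 2) :=
      Real.exp_le_exp.2 (by nlinarith [sq_nonneg y])
    have e2 : Real.exp (y ^ 2) ≤ Real.exp ((b + 1) * y ^ 2) :=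
      Real.exp_le_exp.2 (by nlinarith [mul_nonneg hb (sq_nonneg y)])
    have h3 := abs_sub (u y t) (duhamel a d p k ε y t)
    have h4 := mul_le_mul_of_nonneg_left e1 hM
    have h5 := mul_le_mul_of_nonneg_left e2 hC
    linarith

/-- Up to time `h` the representation starts at `ε`, where only `u(·, ε)` is left. Beyond `h` it
starts at a fixed earlier time, and pointwise convergence is carried forward by dominated
convergence. -/
theorem tendsto_sub_duhamel {a b d p M T : ℝ} {k : ℝ → ℝ} {u : ℝ → ℝ → ℝ}
    (ha : 0 < a) (hd : 0 ≤ d) (hb : 0 ≤ b) (hk : ContinuousOn k (Ioc 0 T))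
    (hcont : ContinuousOn (Function.uncurry u) (univ ×ˢ Ioc 0 T))
    (hheat : ∀ τ ∈ Ioo 0 T, HeatAt a u (fun x => k τ * heatSol a d p ((1 - d) * τ) x τ) τ)
    (hgrow : ∀ x, ∀ τ ∈ Ioc 0 T, |u x τ| ≤ M * Real.exp (b * x ^ 2))
    (hinit : ∀ φ : ℝ → ℝ, ContDiff ℝ ∞ φ → HasCompactSupport φ →
      Tendsto (fun τ => ∫ x, u x τ * φ x) (𝓝[>] 0) (𝓝 0)) {τ : ℝ} (hτ : τ ∈ Ioc 0 T) (x : ℝ) :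
    Tendsto (fun ε => u x τ - duhamel a d p k ε x τ) (𝓝[>] 0) (𝓝 0) := by
  have huc : ∀ t ∈ Ioc 0 T, Continuous fun y => u y t := fun t ht => by
    rw [← continuousOn_univ]
    exact hcont.comp (f := fun y => (y, t)) (by fun_prop) fun y _ => ⟨mem_univ _, ht⟩
  have hM : 0 ≤ M := by
    have := (abs_nonneg _).trans (hgrow 0 τ hτ)
    simpa using this
  set h : ℝ := 1 / (16 * a * (b + 2)) with hh
  have hh0 : 0 < h := by positivity
  have hh1 : 16 * a * (b + 2) * h = 1 := by rw [hh]; field_simp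
  have hsm : ∀ t ≤ h, 16 * a * (b + 2) * t ≤ 1 := fun t ht => by
    rw [← hh1]
    exact mul_le_mul_of_nonneg_left ht (by positivity)
  have base : ∀ t ∈ Ioc 0 T, t ≤ h → ∀ x,
      Tendsto (fun ε => u x t - duhamel a d p k ε x t) (𝓝[>] 0) (𝓝 0) := by
    intro t ht hth x
    have h1 := tendsto_heatKernel_integral ha hb ht.1
      (by have := hsm t hth; nlinarith [mul_pos ha ht.1])
      (fun ε hε => huc ε ⟨hε.1, hε.2.trans ht.2⟩)
      (fun x τ hτ => hgrow x τ ⟨hτ.1, hτ.2.trans ht.2⟩) hinit x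
    refine h1.congr' ?_
    filter_upwards [Ioo_mem_nhdsGT ht.1] with ε hε
    rw [sub_duhamel_representation ha hd hb hk hcont hheat hgrow hε.1 le_rfl hε.2 ht.2
      (hsm _ (by linarith [hε.1]))]
    simp only [duhamel, intervalIntegral.integral_same, sub_zero]
  have hT : 0 < T := hτ.1.trans_le hτ.2
  set τ₀ := min h T with hτ₀d
  have hτ₀ : τ₀ ∈ Ioc 0 T := ⟨lt_min hh0 hT, min_le_right _ _⟩
  -- Convergence at one point, known from the first time step, bounds the integrals for small `ε`.
  -- The crude bound covers the other lower limits.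
  obtain ⟨B, hB⟩ : ∃ B, ∀ ε ∈ Ioc 0 τ₀, |duhamel a d p k ε (-(2 * a * p * τ₀)) τ₀| ≤ B := by
    set x₀ := -(2 * a * p * τ₀)
    have h1 := (Metric.tendsto_nhds.1 (base τ₀ hτ₀ (min_le_left _ _) x₀)) 1 one_pos
    obtain ⟨ε₁, hε₁, hsub⟩ := mem_nhdsGT_iff_exists_Ioo_subset.1 h1
    obtain ⟨C, hC, hCb⟩ := exists_abs_duhamel_le p ha hd hk hε₁
    refine ⟨|u x₀ τ₀| + 1 + C * Real.exp (x₀ ^ 2), fun ε hε => ?_⟩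
    have hpos : 0 ≤ C * Real.exp (x₀ ^ 2) := by positivity
    rcases lt_or_ge ε ε₁ with hlt | hge
    · have h2 : dist (u x₀ τ₀ - duhamel a d p k ε x₀ τ₀) 0 < 1 := hsub ⟨hε.1, hlt⟩
      rw [dist_zero_right, Real.norm_eq_abs] at h2
      have h3 := abs_sub (u x₀ τ₀) (u x₀ τ₀ - duhamel a d p k ε x₀ τ₀)
      rw [sub_sub_cancel] at h3
      linarith
    · have h2 := hCb ε ⟨hge, hε.2.trans hτ₀.2⟩ τ₀ ⟨hε.2, hτ₀.2⟩ x₀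
      have := abs_nonneg (u x₀ τ₀)
      linarith
  have step : ∀ s ∈ Ioc 0 T, s + h ≤ T →
      (∀ x, Tendsto (fun ε => u x s - duhamel a d p k ε x s) (𝓝[>] 0) (𝓝 0)) →
      ∀ x, Tendsto (fun ε => u x (s + h) - duhamel a d p k ε x (s + h)) (𝓝[>] 0) (𝓝 0) := by
    intro s hs hsT hlim x
    -- This constant does not depend on `ε`, which is what provides the majorant for dominated
    -- convergence.
    obtain ⟨C, hC, hCb⟩ := exists_abs_duhamel_le_of_bounded ha hd hk hτ₀ hs hB
    have hev : ∀ᶠ ε in 𝓝[>] (0 : ℝ), ε ∈ Ioo 0 s := Ioo_mem_nhdsGT hs.1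
    have hint : Tendsto (fun ε => ∫ y, heatKernel a (x - y) (s + h - s) *
        (u y s - duhamel a d p k ε y s)) (𝓝[>] 0) (𝓝 (∫ _ : ℝ, (0 : ℝ))) := by
      refine tendsto_integral_filter_of_dominated_convergence
        (fun y => (M + C) * (heatKernel a (x - y) (s + h - s) * Real.exp ((b + 1) * y ^ 2)))
        ?_ ?_ ?_ ?_
      · filter_upwards [hev] with ε hε
        have hεT : ε ≤ T := hε.2.le.trans hs.2
        have hdc : Continuous fun y => duhamel a d p k ε y s := by
          rw [← continuousOn_univ]
          exact (continuousOn_duhamel (p := p) ha hd hk hε.1 hεT).comp (f := fun y => (y, s))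
            (by fun_prop) fun y _ => ⟨mem_univ _, hε.2.le, hs.2⟩
        have hKc : Continuous fun y => heatKernel a (x - y) (s + h - s) :=
          continuous_heatKernel.comp (by fun_prop)
        exact (hKc.mul ((huc s hs).sub hdc)).aestronglyMeasurable
      · filter_upwards [hev] with ε hε
        refine Eventually.of_forall fun y => norm_heatKernel_mul_le ?_
        have h1 := hgrow y s hs
        have h2 := hCb ε ⟨hε.1, hε.2.le⟩ y
        have e1 : Real.exp (b * y ^ 2) ≤ Real.exp ((b + 1) * y ^ 2) :=
          Real.exp_le_exp.2 (by nlinarith [sq_nonneg y])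
        have e2 : Real.exp (y ^ 2) ≤ Real.exp ((b + 1) * y ^ 2) :=
          Real.exp_le_exp.2 (by nlinarith [mul_nonneg hb (sq_nonneg y)])
        have h3 := abs_sub (u y s) (duhamel a d p k ε y s)
        have h4 := mul_le_mul_of_nonneg_left e1 hM
        have h5 := mul_le_mul_of_nonneg_left e2 hC
        linarith
      · refine (integrable_heatKernel_mul_exp ha (by linarith) (by linarith) ?_ x).const_mul _
        rw [add_sub_cancel_left]
        linarith
      · refine Eventually.of_forall fun y => ?_
        have := (hlim y).const_mul (heatKernel a (x - y) (s + h - s))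
        rwa [mul_zero] at this
    rw [integral_zero] at hint
    refine hint.congr' ?_
    filter_upwards [hev] with ε hε
    exact (sub_duhamel_representation ha hd hb hk hcont hheat hgrow hε.1 hε.2.le (by linarith) hsT
      (by rw [add_sub_cancel_left]; exact hh1.le) x).symm
  have all : ∀ n : ℕ, ∀ t ∈ Ioc 0 T, t ≤ (n + 1) * h → ∀ x,
      Tendsto (fun ε => u x t - duhamel a d p k ε x t) (𝓝[>] 0) (𝓝 0) := by
    intro n
    induction n with
    | zero => exact fun t ht hth => base t ht (by simpa using hth)
    | succ n ih =>
      intro t ht hth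
      rcases le_or_gt t h with hle | hgt
      · exact base t ht hle
      · push_cast at hth
        have hs : t - h ∈ Ioc 0 T := ⟨by linarith, by linarith [ht.2]⟩
        have := step (t - h) hs (by linarith [ht.2]) (ih (t - h) hs (by linarith))
        simpa only [sub_add_cancel] using this
  obtain ⟨n, hn⟩ := exists_nat_gt (τ / h)
  refine all n τ hτ ?_ x
  rw [div_lt_iff₀ hh0] at hn
  linarith


/-- If the integrand is integrable on `[0, τ]`, the primitive is continuous in its lower limit, so
the improper and the Lebesgue integrals agree. -/
theorem eqMulIntegral_of_tendsto {v c τ : ℝ} {g : ℝ → ℝ} (hτ : 0 < τ)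
    (hint : ∀ ε ∈ Ioc 0 τ, IntervalIntegrable g volume ε τ)
    (hlim : Tendsto (fun ε => c * ∫ ξ in ε..τ, g ξ) (𝓝[>] 0) (𝓝 v)) :
    EqMulIntegral v c g τ := by
  refine ⟨hint, hlim, fun h => ?_⟩
  have h1 : ContinuousOn (fun ε => ∫ ξ in ε..τ, g ξ) (uIcc 0 τ) :=
    intervalIntegral.continuousOn_primitive_interval_left
      ((intervalIntegrable_iff' (μ := volume)).1 h)
  have h2 : Tendsto (fun ε => ∫ ξ in ε..τ, g ξ) (𝓝[uIcc 0 τ] 0) (𝓝 (∫ ξ in 0..τ, g ξ)) :=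
    h1 0 left_mem_uIcc
  have hle : 𝓝[>] (0 : ℝ) ≤ 𝓝[uIcc 0 τ] 0 := by
    rw [uIcc_of_le hτ.le, ← nhdsWithin_Ioc_eq_nhdsGT hτ]
    exact nhdsWithin_mono _ Ioc_subset_Icc_self
  exact tendsto_nhds_unique hlim ((h2.mono_left hle).const_mul c)

/-! ### The model kernel as a multiple of a Gaussian solution, and the formula for `u` -/

namespace Params

variable (p : Params)

/-- The factor of the kernel that depends on the time of the source only. -/
noncomputable def coeff (ξ : ℝ) : ℝ :=
  p.A ξ / ((2 * Real.pi * p.σ ^ 2) ^ (p.δ / 2) * ξ ^ ((p.δ - 1) / 2)) *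
    Real.exp ((p.P ^ 2 * p.σ ^ 2 / (2 * (p.δ - 1)) + p.β * (p.δ - 1)) * ξ)

variable {p}

/-- Completing the square in `x + σ² P τ/(1-δ)`: apart from `coeff`, the source time enters only
through the width. -/
theorem kernel_eq (hσ : 0 < p.σ) (hδ0 : 0 ≤ p.δ) (hδ1 : p.δ ≠ 1) {τ ξ : ℝ} (hξ : 0 < ξ)
    (hξτ : ξ ≤ τ) (x : ℝ) :
    p.kernel x τ ξ =
      p.coeff ξ * heatSol (p.σ ^ 2 / 2) p.δ (p.P / (1 - p.δ)) ((1 - p.δ) * ξ) x τ := by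
  have hQ : 0 < p.δ * τ + (1 - p.δ) * ξ := hξ.trans_le (le_width hδ0 hξτ)
  have h1 : 1 - p.δ ≠ 0 := sub_ne_zero.2 (Ne.symm hδ1)
  simp only [kernel, coeff, heatSol, Lam, Q]
  have e1 : (p.P ^ 2 * p.σ ^ 2 / (2 * (p.δ - 1)) + p.β * (p.δ - 1)) * ξ
      + p.P * x / (1 - p.δ) + p.P ^ 2 * p.σ ^ 2 * τ / (2 * (1 - p.δ) ^ 2)
      - (p.δ * x ^ 2 / (2 * p.σ ^ 2) + p.P * x * p.δ * τ / (1 - p.δ)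
          + p.P ^ 2 * p.σ ^ 2 * p.δ * τ ^ 2 / (2 * (1 - p.δ) ^ 2)) *
            (1 / (p.δ * τ + (1 - p.δ) * ξ))
      = (p.P ^ 2 * p.σ ^ 2 / (2 * (p.δ - 1)) + p.β * (p.δ - 1)) * ξ
        + (p.P / (1 - p.δ) * x + p.σ ^ 2 / 2 * (p.P / (1 - p.δ)) ^ 2 * τ
          - p.δ * (x + 2 * (p.σ ^ 2 / 2) * (p.P / (1 - p.δ)) * τ) ^ 2 /
            (4 * (p.σ ^ 2 / 2) * (p.δ * τ + (1 - p.δ) * ξ))) := by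
    generalize (p.P ^ 2 * p.σ ^ 2 / (2 * (p.δ - 1)) + p.β * (p.δ - 1)) * ξ = c
    generalize p.δ * τ + (1 - p.δ) * ξ = w at *
    generalize 1 - p.δ = z at *
    field_simp
    ring
  rw [e1, Real.exp_add]
  ring

/-- This identity collapses the bracket in the exponent of the source to `β(1-δ)`. -/
theorem neg_beta_eq (hσ : 0 < p.σ) : p.q + (1 - p.α) ^ 2 * p.σ ^ 2 / 2 = -p.β := by
  simp only [α, β]
  field_simp
  ring

/-- On the diagonal the width is `τ`, and the powers `(δ-1)/2` and `1/2` of `τ` combine to `δ/2`.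
This is the link that makes the Duhamel integral produce the right source. -/
theorem source_eq_kernel (hσ : 0 < p.σ) (hδ1 : p.δ ≠ 1) {τ : ℝ} (hτ : 0 < τ) (x : ℝ) :
    p.source x τ = p.E ^ p.γ * p.kernel x τ τ := by
  have h1 : 1 - p.δ ≠ 0 := sub_ne_zero.2 (Ne.symm hδ1)
  have hQ : p.Q τ τ = τ := by simp only [Q]; ring
  have hL : p.Lam τ τ = (2 * Real.pi * p.σ ^ 2 * τ) ^ (p.δ / 2) := by
    rw [Lam, hQ, Real.mul_rpow (by positivity) hτ.le, mul_assoc, Real.sqrt_eq_rpow,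
      ← Real.rpow_add hτ]
    congr 2
    ring
  simp only [source, kernel, hQ, hL]
  rw [show p.γ - p.δ - p.α * (1 - p.δ) = p.P from rfl]
  have e1 : -(p.δ / (2 * p.σ ^ 2 * τ)) * x ^ 2 + p.P * x
      - (p.β + p.q * p.δ + p.δ / 2 * (1 - p.α) ^ 2 * p.σ ^ 2) * τ
      = (p.P ^ 2 * p.σ ^ 2 / (2 * (p.δ - 1)) + p.β * (p.δ - 1)) * τ
      + p.P * x / (1 - p.δ) + p.P ^ 2 * p.σ ^ 2 * τ / (2 * (1 - p.δ) ^ 2)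
      - (p.δ * x ^ 2 / (2 * p.σ ^ 2) + p.P * x * p.δ * τ / (1 - p.δ)
          + p.P ^ 2 * p.σ ^ 2 * p.δ * τ ^ 2 / (2 * (1 - p.δ) ^ 2)) * (1 / τ) := by
    have hb : p.β + p.q * p.δ + p.δ / 2 * (1 - p.α) ^ 2 * p.σ ^ 2 = p.β * (1 - p.δ) := by
      linear_combination p.δ * neg_beta_eq hσ
    have hd : p.δ = 1 - (1 - p.δ) := by ring
    rw [hb, show p.δ - 1 = -(1 - p.δ) by ring]
    generalize 1 - p.δ = z at *
    rw [hd]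
    field_simp
    ring
  rw [e1]
  ring

theorem continuousOn_coeff (hσ : 0 < p.σ) (hA : ContinuousOn p.A (Ioc 0 p.T)) :
    ContinuousOn p.coeff (Ioc 0 p.T) := by
  have hpow : ContinuousOn (fun ξ : ℝ => ξ ^ ((p.δ - 1) / 2)) (Ioc 0 p.T) :=
    continuousOn_id.rpow_const fun ξ hξ => Or.inl hξ.1.ne'
  refine (hA.div (continuousOn_const.mul hpow) fun ξ hξ => ?_).mul (by fun_prop)
  have h1 : 0 < (2 * Real.pi * p.σ ^ 2) ^ (p.δ / 2) := Real.rpow_pos_of_pos (by positivity) _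
  have h2 : 0 < ξ ^ ((p.δ - 1) / 2) := Real.rpow_pos_of_pos hξ.1 _
  exact (mul_pos h1 h2).ne'

theorem intervalIntegrable_kernel (hσ : 0 < p.σ) (hδ0 : 0 ≤ p.δ) (hδ1 : p.δ ≠ 1)
    (hA : ContinuousOn p.A (Ioc 0 p.T)) {τ ε : ℝ} (hτ : τ ∈ Ioc 0 p.T) (hε : ε ∈ Ioc 0 τ) (x : ℝ) :
    IntervalIntegrable (p.kernel x τ) volume ε τ := by
  refine (intervalIntegrable_duhamel_integrand (a := p.σ ^ 2 / 2) (p := p.P / (1 - p.δ))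
    (by positivity) hδ0 (continuousOn_coeff hσ hA) hτ.2 hε ⟨hτ.1, le_rfl⟩ x).congr fun ξ hξ => ?_
  rw [uIoc_of_le hε.2] at hξ
  exact (kernel_eq hσ hδ0 hδ1 (hε.1.trans hξ.1) hξ.2 x).symm

/-- The solution formula for the transformed problem. -/
theorem eqMulIntegral_of_heatAt (hσ : 0 < p.σ) (hδ0 : 0 ≤ p.δ) (hδ1 : p.δ ≠ 1)
    (hA : ContinuousOn p.A (Ioc 0 p.T)) {u : ℝ → ℝ → ℝ} {M b : ℝ} (hb : 0 ≤ b)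
    (hcont : ContinuousOn (Function.uncurry u) (univ ×ˢ Ioc 0 p.T))
    (hheat : ∀ τ ∈ Ioo 0 p.T, HeatAt (p.σ ^ 2 / 2) u (fun x => p.source x τ) τ)
    (hgrow : ∀ x, ∀ τ ∈ Ioc 0 p.T, |u x τ| ≤ M * Real.exp (b * x ^ 2))
    (hinit : ∀ φ : ℝ → ℝ, ContDiff ℝ ∞ φ → HasCompactSupport φ →
      Tendsto (fun τ => ∫ x, u x τ * φ x) (𝓝[>] 0) (𝓝 0)) (x : ℝ) {τ : ℝ} (hτ : τ ∈ Ioc 0 p.T) :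
    EqMulIntegral (u x τ) (p.E ^ p.γ) (p.kernel x τ) τ := by
  refine eqMulIntegral_of_tendsto hτ.1
    (fun ε hε => intervalIntegrable_kernel hσ hδ0 hδ1 hA hτ hε x) ?_
  have hk : ContinuousOn (fun ξ => p.E ^ p.γ * p.coeff ξ) (Ioc 0 p.T) :=
    continuousOn_const.mul (continuousOn_coeff hσ hA)
  have hheat' : ∀ τ ∈ Ioo 0 p.T, HeatAt (p.σ ^ 2 / 2) u (fun x => p.E ^ p.γ * p.coeff τ *
      heatSol (p.σ ^ 2 / 2) p.δ (p.P / (1 - p.δ)) ((1 - p.δ) * τ) x τ) τ := by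
    intro τ hτ
    have h := hheat τ hτ
    simp only [source_eq_kernel hσ hδ1 hτ.1, kernel_eq hσ hδ0 hδ1 hτ.1 le_rfl, ← mul_assoc] at h
    exact h
  have h := tendsto_sub_duhamel (by positivity) hδ0 hb hk hcont hheat' hgrow hinit hτ x
  have h2 := h.const_sub (u x τ)
  rw [sub_zero] at h2
  refine h2.congr' ?_
  filter_upwards [Ioo_mem_nhdsGT hτ.1] with ε hε
  rw [sub_sub_cancel, duhamel, ← intervalIntegral.integral_const_mul]
  refine intervalIntegral.integral_congr fun ξ hξ => ?_
  rw [uIcc_of_le hε.2.le] at hξ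
  simp only [kernel_eq hσ hδ0 hδ1 (hε.1.trans_le hξ.1) hξ.2 x]
  ring

theorem IsSolution.heatAt {u : ℝ → ℝ → ℝ} (hu : p.IsSolution u) {τ : ℝ} (hτ : τ ∈ Ioo 0 p.T) :
    HeatAt (p.σ ^ 2 / 2) u (fun x => p.source x τ) τ := by
  refine ⟨deriv fun y => u y τ, deriv (deriv fun y => u y τ),
    fun y => (hu.diff_space τ hτ y).hasDerivAt, fun y => (hu.diff_space_two τ hτ y).hasDerivAt,
    fun y => (hu.diff_time y τ hτ).hasDerivAt.congr_deriv ?_⟩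
  linarith [hu.equation y τ hτ]

theorem IsSolution.eqMulIntegral (hσ : 0 < p.σ) (hδ0 : 0 ≤ p.δ) (hδ1 : p.δ ≠ 1)
    (hA : ContinuousOn p.A (Ioc 0 p.T)) {u : ℝ → ℝ → ℝ} (hu : p.IsSolution u)
    (hgrow : ∃ M b : ℝ, ∀ x : ℝ, ∀ τ ∈ Icc 0 p.T, |u x τ| ≤ M * Real.exp (b * |x| ^ 2))
    (x : ℝ) {τ : ℝ} (hτ : τ ∈ Ioc 0 p.T) :
    EqMulIntegral (u x τ) (p.E ^ p.γ) (p.kernel x τ) τ := by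
  obtain ⟨M, b, hM⟩ := hgrow
  refine eqMulIntegral_of_heatAt (M := |M|) hσ hδ0 hδ1 hA (abs_nonneg b) hu.continuousOn
    (fun τ hτ => hu.heatAt hτ) (fun x τ hτ => (hM x τ ⟨hτ.1.le, hτ.2⟩).trans ?_)
    hu.initial_limit x hτ
  rw [sq_abs]
  refine mul_le_mul (le_abs_self M) (Real.exp_le_exp.2 ?_) (Real.exp_pos _).le (abs_nonneg M)
  exact mul_le_mul_of_nonneg_right (le_abs_self b) (sq_nonneg x)

/-! ### Integrability up to the singularity -/

/-- For `d > 0` the width is bounded below, so the singularity is `ξ^{-(d-1)/2}`, whose exponent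
exceeds `-1` because `d < 3`. For `d = 0` the width is `ξ` itself and the two powers cancel. -/
theorem exists_rpow_div_sqrt_width_le {d τ : ℝ} (hd : 0 ≤ d) (hd3 : d < 3) (hτ : 0 < τ) :
    ∃ C s : ℝ, 0 ≤ C ∧ -1 < s ∧ ∀ ξ ∈ Ioc 0 τ,
      (ξ ^ ((d - 1) / 2) * Real.sqrt (d * τ + (1 - d) * ξ))⁻¹ ≤ C * ξ ^ s := by
  rcases hd.eq_or_lt with rfl | hd
  · refine ⟨1, 0, zero_le_one, by norm_num, fun ξ hξ => ?_⟩
    rw [zero_mul, zero_add, sub_zero, one_mul, Real.sqrt_eq_rpow, ← Real.rpow_add hξ.1]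
    norm_num
  · have hm : 0 < min d 1 * τ := mul_pos (lt_min hd one_pos) hτ
    refine ⟨(Real.sqrt (min d 1 * τ))⁻¹, -((d - 1) / 2), by positivity, by linarith,
      fun ξ hξ => ?_⟩
    have hlow : min d 1 * τ ≤ d * τ + (1 - d) * ξ := by
      rcases le_total d 1 with h | h
      · rw [min_eq_left h]; nlinarith [hξ.1]
      · rw [min_eq_right h]; nlinarith [hξ.2]
    have h1 : (Real.sqrt (d * τ + (1 - d) * ξ))⁻¹ ≤ (Real.sqrt (min d 1 * τ))⁻¹ :=
      inv_anti₀ (Real.sqrt_pos.2 hm) (Real.sqrt_le_sqrt hlow)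
    rw [mul_inv, Real.rpow_neg hξ.1.le, mul_comm]
    have h2 : 0 ≤ (ξ ^ ((d - 1) / 2))⁻¹ := inv_nonneg.2 (Real.rpow_nonneg hξ.1.le _)
    exact mul_le_mul_of_nonneg_right h1 h2

theorem intervalIntegrable_kernel_zero (hσ : 0 < p.σ) (hδ0 : 0 ≤ p.δ) (hδ1 : p.δ ≠ 1)
    (hδ3 : p.δ < 3) (hA : ContinuousOn p.A (Ioc 0 p.T)) (hAb : ∃ C : ℝ, ∀ ξ ∈ Ioc 0 p.T, |p.A ξ| ≤ C)
    (x : ℝ) {τ : ℝ} (hτ : τ ∈ Ioc 0 p.T) : IntervalIntegrable (p.kernel x τ) volume 0 τ := by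
  obtain ⟨B, hB⟩ := hAb
  obtain ⟨C, s, hC, hs, hCs⟩ := exists_rpow_div_sqrt_width_le hδ0 hδ3 hτ.1
  have hB0 : 0 ≤ B := (abs_nonneg _).trans (hB τ hτ)
  set K := p.P ^ 2 * p.σ ^ 2 / (2 * (p.δ - 1)) + p.β * (p.δ - 1) with hK
  set l := p.P / (1 - p.δ) with hl
  set c := (2 * Real.pi * p.σ ^ 2) ^ (p.δ / 2) with hc
  have hc0 : 0 < c := Real.rpow_pos_of_pos (by positivity) _
  set e := Real.exp (|K| * τ) * Real.exp (l * x + p.σ ^ 2 / 2 * l ^ 2 * τ) with he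
  have hdom : IntervalIntegrable (fun ξ => B / c * e * (C * ξ ^ s)) volume 0 τ :=
    ((intervalIntegral.intervalIntegrable_rpow' hs).const_mul C).const_mul _
  have hmeas : AEStronglyMeasurable (p.kernel x τ) (volume.restrict (uIoc 0 τ)) := by
    rw [uIoc_of_le hτ.1.le]
    refine ContinuousOn.aestronglyMeasurable ?_ measurableSet_Ioc
    refine (continuousOn_duhamel_integrand (a := p.σ ^ 2 / 2) (p := p.P / (1 - p.δ))
      (by positivity) hδ0 (continuousOn_coeff hσ hA) hτ.2 x).congr fun ξ hξ => ?_
    exact kernel_eq hσ hδ0 hδ1 hξ.1 hξ.2 x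
  refine hdom.mono_fun hmeas ?_
  rw [uIoc_of_le hτ.1.le]
  filter_upwards [ae_restrict_mem measurableSet_Ioc] with ξ hξ
  have hξs : 0 ≤ ξ ^ s := Real.rpow_nonneg hξ.1.le _
  have hQ : 0 < p.δ * τ + (1 - p.δ) * ξ := hξ.1.trans_le (le_width hδ0 hξ.2)
  rw [Real.norm_of_nonneg (by positivity : 0 ≤ B / c * e * (C * ξ ^ s)), kernel_eq hσ hδ0 hδ1 hξ.1
    hξ.2 x, coeff, heatSol, ← hK, ← hl, ← hc]
  have e1 : Real.exp (K * ξ) ≤ Real.exp (|K| * τ) := by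
    rw [Real.exp_le_exp]
    exact mul_le_mul (le_abs_self K) hξ.2 hξ.1.le (abs_nonneg K)
  have e2 : Real.exp (l * x + p.σ ^ 2 / 2 * l ^ 2 * τ - p.δ * (x + 2 * (p.σ ^ 2 / 2) * l * τ) ^ 2 /
      (4 * (p.σ ^ 2 / 2) * (p.δ * τ + (1 - p.δ) * ξ)))
      ≤ Real.exp (l * x + p.σ ^ 2 / 2 * l ^ 2 * τ) := by
    rw [Real.exp_le_exp, sub_le_self_iff]
    positivity
  have hG := Real.exp_pos (l * x + p.σ ^ 2 / 2 * l ^ 2 * τ - p.δ *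
    (x + 2 * (p.σ ^ 2 / 2) * l * τ) ^ 2 / (4 * (p.σ ^ 2 / 2) * (p.δ * τ + (1 - p.δ) * ξ)))
  generalize Real.exp (l * x + p.σ ^ 2 / 2 * l ^ 2 * τ - p.δ * (x + 2 * (p.σ ^ 2 / 2) * l * τ) ^ 2 /
      (4 * (p.σ ^ 2 / 2) * (p.δ * τ + (1 - p.δ) * ξ))) = G at e2 hG ⊢
  have hr : 0 < ξ ^ ((p.δ - 1) / 2) := Real.rpow_pos_of_pos hξ.1 _
  have hw : 0 < Real.sqrt (p.δ * τ + (1 - p.δ) * ξ) := Real.sqrt_pos.2 hQ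
  have hn : p.A ξ / (c * ξ ^ ((p.δ - 1) / 2)) * Real.exp (K * ξ) *
      (G / Real.sqrt (p.δ * τ + (1 - p.δ) * ξ)) = p.A ξ / c * (Real.exp (K * ξ) * G) *
        (ξ ^ ((p.δ - 1) / 2) * Real.sqrt (p.δ * τ + (1 - p.δ) * ξ))⁻¹ := by
    field_simp
  rw [hn, norm_mul, norm_mul, norm_div, Real.norm_of_nonneg hc0.le,
    Real.norm_of_nonneg (by positivity : 0 ≤ Real.exp (K * ξ) * G),
    Real.norm_of_nonneg (inv_nonneg.2 (mul_pos hr hw).le)]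
  refine mul_le_mul (mul_le_mul ?_ (mul_le_mul e1 e2 hG.le (Real.exp_pos _).le) (by positivity)
    (by positivity)) (hCs ξ hξ) (inv_nonneg.2 (mul_pos hr hw).le) (by positivity)
  exact div_le_div_of_nonneg_right (hB ξ ⟨hξ.1, hξ.2.trans hτ.2⟩) hc0.le

end Params


/-! ### The gamma of the European call and put -/

noncomputable def normalDensity (d : ℝ) : ℝ :=
  1 / Real.sqrt (2 * Real.pi) * Real.exp (-d ^ 2 / 2)

theorem hasDerivAt_Phi (d : ℝ) : HasDerivAt Params.Phi (normalDensity d) d := by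
  have hc : Continuous fun x : ℝ => Real.exp (-x ^ 2 / 2) := by fun_prop
  have hi : Integrable fun x : ℝ => Real.exp (-x ^ 2 / 2) := by
    refine (integrable_exp_neg_mul_sq (b := 1 / 2) (by norm_num)).congr
      (Eventually.of_forall fun x => ?_)
    ring_nf
  have h1 : HasDerivAt (fun y => ∫ x in (0 : ℝ)..y, Real.exp (-x ^ 2 / 2))
      (Real.exp (-d ^ 2 / 2)) d :=
    intervalIntegral.integral_hasDerivAt_right (hc.intervalIntegrable _ _)
      (hc.stronglyMeasurableAtFilter _ _) hc.continuousAt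
  have h2 := ((h1.const_add (∫ x in Iic (0 : ℝ), Real.exp (-x ^ 2 / 2))).const_mul
    (1 / Real.sqrt (2 * Real.pi)))
  refine h2.congr_of_eventuallyEq (Eventually.of_forall fun y => ?_)
  simp only [Params.Phi]
  rw [← intervalIntegral.integral_Iic_sub_Iic hi.integrableOn hi.integrableOn]
  ring

theorem normalDensity_neg (d : ℝ) : normalDensity (-d) = normalDensity d := by
  simp only [normalDensity, neg_sq]

namespace Params

variable {p : Params}

theorem hasDerivAt_d₁ (hσ : 0 < p.σ) (hE : 0 < p.E) {S t : ℝ} (hS : 0 < S) (ht : t < p.T) :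
    HasDerivAt (fun y => p.d₁ y t) (1 / (S * (p.σ * Real.sqrt (p.T - t)))) S := by
  have hs : 0 < Real.sqrt (p.T - t) := Real.sqrt_pos.2 (sub_pos.2 ht)
  have h0 : HasDerivAt (fun y => y / p.E) (1 / p.E) S := (hasDerivAt_id S).div_const _
  refine (((h0.log (by positivity)).add_const _).div_const _).congr_deriv ?_
  field_simp

theorem hasDerivAt_d₂ (hσ : 0 < p.σ) (hE : 0 < p.E) {S t : ℝ} (hS : 0 < S) (ht : t < p.T) :
    HasDerivAt (fun y => p.d₂ y t) (1 / (S * (p.σ * Real.sqrt (p.T - t)))) S := by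
  have hs : 0 < Real.sqrt (p.T - t) := Real.sqrt_pos.2 (sub_pos.2 ht)
  have h0 : HasDerivAt (fun y => y / p.E) (1 / p.E) S := (hasDerivAt_id S).div_const _
  refine (((h0.log (by positivity)).add_const _).div_const _).congr_deriv ?_
  field_simp

/-- Since `d₁ - d₂ = σ√(T-t)`, the quantity `(d₁² - d₂²)/2` equals `ln (S/E) + (r-q)(T-t)`. The
identity cancels the density terms in the first derivative of the price. -/
theorem price_normalDensity_eq (hσ : 0 < p.σ) (hE : 0 < p.E) {S t : ℝ} (hS : 0 < S) (ht : t < p.T) :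
    S * Real.exp (-p.q * (p.T - t)) * normalDensity (p.d₁ S t)
      = p.E * Real.exp (-p.r * (p.T - t)) * normalDensity (p.d₂ S t) := by
  have hτ : 0 < p.T - t := sub_pos.2 ht
  have hs : 0 < Real.sqrt (p.T - t) := Real.sqrt_pos.2 hτ
  have hsq : p.T - t = Real.sqrt (p.T - t) ^ 2 := (Real.sq_sqrt hτ.le).symm
  have hSE : S = p.E * Real.exp (Real.log (S / p.E)) := by
    rw [Real.exp_log (by positivity)]; field_simp
  have key : Real.log (S / p.E) + (-p.q * (p.T - t) + -p.d₁ S t ^ 2 / 2)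
      = -p.r * (p.T - t) + -p.d₂ S t ^ 2 / 2 := by
    simp only [d₁, d₂]
    generalize Real.log (S / p.E) = L
    generalize Real.sqrt (p.T - t) = w at *
    rw [hsq]
    field_simp
    ring
  simp only [normalDensity]
  calc _ = p.E * (1 / Real.sqrt (2 * Real.pi)) * (Real.exp (Real.log (S / p.E)) *
        (Real.exp (-p.q * (p.T - t)) * Real.exp (-p.d₁ S t ^ 2 / 2))) := by
        linear_combination (Real.exp (-p.q * (p.T - t)) * (1 / Real.sqrt (2 * Real.pi)) *
          Real.exp (-p.d₁ S t ^ 2 / 2)) * hSE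
    _ = _ := by
        rw [← Real.exp_add, ← Real.exp_add, key, Real.exp_add]
        ring

theorem hasDerivAt_call (hσ : 0 < p.σ) (hE : 0 < p.E) {S t : ℝ} (hS : 0 < S) (ht : t < p.T) :
    HasDerivAt (fun y => p.call y t) (Real.exp (-p.q * (p.T - t)) * Phi (p.d₁ S t)) S := by
  have h1 := (hasDerivAt_Phi (p.d₁ S t)).comp S (hasDerivAt_d₁ hσ hE hS ht)
  have h2 := (hasDerivAt_Phi (p.d₂ S t)).comp S (hasDerivAt_d₂ hσ hE hS ht)
  have h3 := (((hasDerivAt_id S).mul_const (Real.exp (-p.q * (p.T - t)))).mul h1).sub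
    (h2.const_mul (p.E * Real.exp (-p.r * (p.T - t))))
  refine h3.congr_deriv ?_
  simp only [id, Function.comp_apply]
  linear_combination (1 / (S * (p.σ * Real.sqrt (p.T - t)))) * price_normalDensity_eq hσ hE hS ht

theorem hasDerivAt_put (hσ : 0 < p.σ) (hE : 0 < p.E) {S t : ℝ} (hS : 0 < S) (ht : t < p.T) :
    HasDerivAt (fun y => p.put y t) (-(Real.exp (-p.q * (p.T - t)) * Phi (-p.d₁ S t))) S := by
  have h1 := (hasDerivAt_Phi (-p.d₁ S t)).comp S (hasDerivAt_d₁ hσ hE hS ht).neg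
  have h2 := (hasDerivAt_Phi (-p.d₂ S t)).comp S (hasDerivAt_d₂ hσ hE hS ht).neg
  rw [normalDensity_neg] at h1 h2
  have h3 := (h2.const_mul (p.E * Real.exp (-p.r * (p.T - t)))).sub
    (((hasDerivAt_id S).mul_const (Real.exp (-p.q * (p.T - t)))).mul h1)
  refine h3.congr_deriv ?_
  simp only [id, Function.comp_apply]
  linear_combination (1 / (S * (p.σ * Real.sqrt (p.T - t)))) * price_normalDensity_eq hσ hE hS ht

/-- The first derivatives of call and put differ by a quantity independent of `S`, so the second
derivatives coincide. -/
theorem deriv_deriv_price (hσ : 0 < p.σ) (hE : 0 < p.E) {V₀ : ℝ → ℝ → ℝ}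
    (hV₀ : V₀ = p.call ∨ V₀ = p.put) {S t : ℝ} (hS : 0 < S) (ht : t < p.T) :
    deriv (deriv fun y => V₀ y t) S = Real.exp (-p.q * (p.T - t)) * normalDensity (p.d₁ S t) /
      (S * (p.σ * Real.sqrt (p.T - t))) := by
  rcases hV₀ with rfl | rfl
  · have h : (deriv fun y => p.call y t) =ᶠ[𝓝 S]
        fun y => Real.exp (-p.q * (p.T - t)) * Phi (p.d₁ y t) := by
      filter_upwards [Ioi_mem_nhds hS] with y hy using (hasDerivAt_call hσ hE hy ht).deriv
    rw [h.deriv_eq]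
    have h1 := ((hasDerivAt_Phi (p.d₁ S t)).comp S (hasDerivAt_d₁ hσ hE hS ht)).const_mul
      (Real.exp (-p.q * (p.T - t)))
    refine h1.deriv.trans ?_
    ring
  · have h : (deriv fun y => p.put y t) =ᶠ[𝓝 S]
        fun y => -(Real.exp (-p.q * (p.T - t)) * Phi (-p.d₁ y t)) := by
      filter_upwards [Ioi_mem_nhds hS] with y hy using (hasDerivAt_put hσ hE hy ht).deriv
    rw [h.deriv_eq]
    have h1 := (((hasDerivAt_Phi (-p.d₁ S t)).comp S (hasDerivAt_d₁ hσ hE hS ht).neg).const_mul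
      (Real.exp (-p.q * (p.T - t)))).neg
    refine h1.deriv.trans ?_
    rw [normalDensity_neg]
    ring

/-! ### The change of variables -/

/-- The function `V` in the variables `x = ln (S / E)`, `τ = T - t`. -/
noncomputable def transform (p : Params) (V : ℝ → ℝ → ℝ) (x τ : ℝ) : ℝ :=
  Real.exp (-p.α * x - p.β * τ) * V (p.E * Real.exp x) (p.T - τ)

theorem source_eq_L₁ (hσ : 0 < p.σ) (hE : 0 < p.E) {V₀ : ℝ → ℝ → ℝ}
    (hV₀ : V₀ = p.call ∨ V₀ = p.put) (x : ℝ) {τ : ℝ} (hτ : 0 < τ) :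
    Real.exp (-p.α * x - p.β * τ) * p.L₁ V₀ (p.E * Real.exp x) (p.T - τ) = p.source x τ := by
  have hS : 0 < p.E * Real.exp x := by positivity
  have hs : 0 < Real.sqrt τ := Real.sqrt_pos.2 hτ
  have hsq : τ = Real.sqrt τ ^ 2 := (Real.sq_sqrt hτ.le).symm
  rw [L₁, deriv_deriv_price hσ hE hV₀ hS (by linarith), sub_sub_cancel]
  set D := p.d₁ (p.E * Real.exp x) (p.T - τ) with hD
  have hDe : D = (x + (p.r - p.q + p.σ ^ 2 / 2) * τ) / (p.σ * Real.sqrt τ) := by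
    rw [hD, d₁, sub_sub_cancel, mul_div_cancel_left₀ _ hE.ne', Real.log_exp]
  have hgam : p.E * Real.exp x * (Real.exp (-p.q * τ) * normalDensity D /
      (p.E * Real.exp x * (p.σ * Real.sqrt τ)))
      -- The gamma times `S` is a positive Gaussian expression in `x`, so its real power `δ`
      -- multiplies the exponent by `δ` and turns the root into the power `δ/2`.
      = Real.exp (-p.q * τ - D ^ 2 / 2) / Real.sqrt (2 * Real.pi * p.σ ^ 2 * τ) := by
    have hsplit : Real.sqrt (2 * Real.pi * p.σ ^ 2 * τ)
        = Real.sqrt (2 * Real.pi) * (p.σ * Real.sqrt τ) := by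
      rw [Real.sqrt_mul (by positivity), Real.sqrt_mul (by positivity), Real.sqrt_sq hσ.le, mul_assoc]
    rw [hsplit, normalDensity, sub_eq_add_neg, Real.exp_add, ← neg_div]
    have : 0 < Real.sqrt (2 * Real.pi) := Real.sqrt_pos.2 (by positivity)
    field_simp
  have hW : 0 < 2 * Real.pi * p.σ ^ 2 * τ := by positivity
  rw [hgam, Real.div_rpow (Real.exp_pos _).le (Real.sqrt_nonneg _), ← Real.exp_mul,
    Real.sqrt_eq_rpow, ← Real.rpow_mul hW.le, Real.mul_rpow hE.le (Real.exp_pos _).le,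
    ← Real.exp_mul, show 1 / 2 * p.δ = p.δ / 2 by ring, source]
  have e1 : -(p.δ / (2 * p.σ ^ 2 * τ)) * x ^ 2
      + (p.γ - p.δ - p.α * (1 - p.δ)) * x
      - (p.β + p.q * p.δ + p.δ / 2 * (1 - p.α) ^ 2 * p.σ ^ 2) * τ
      = (-p.α * x - p.β * τ) + x * p.γ + (-p.q * τ - D ^ 2 / 2) * p.δ := by
    rw [hDe, div_pow, mul_pow, Real.sq_sqrt hτ.le]
    simp only [α]
    field_simp
    ring
  rw [e1, Real.exp_add, Real.exp_add]
  ring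

theorem heatAt_transform (hσ : 0 < p.σ) (hE : 0 < p.E) {V₀ V₁ : ℝ → ℝ → ℝ}
    (hV₀ : V₀ = p.call ∨ V₀ = p.put) (hV : p.IsFirstOrderCorrection V₀ V₁) {τ : ℝ}
    (hτ : τ ∈ Ioo 0 p.T) :
    HeatAt (p.σ ^ 2 / 2) (p.transform V₁) (fun x => p.source x τ) τ := by
  set t := p.T - τ with ht
  have htI : t ∈ Ioo 0 p.T := ⟨by linarith [hτ.2], by linarith [hτ.1]⟩
  set f := fun y => V₁ y t with hf
  have hS : ∀ y, 0 < p.E * Real.exp y := fun y => by positivity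
  have d1 : ∀ y, HasDerivAt f (deriv f (p.E * Real.exp y)) (p.E * Real.exp y) := fun y =>
    (hV.diff_space _ (hS y) t htI).hasDerivAt
  have d2 : ∀ y, HasDerivAt (deriv f) (deriv (deriv f) (p.E * Real.exp y)) (p.E * Real.exp y) :=
    fun y => (hV.diff_space_two _ (hS y) t htI).hasDerivAt
  have dS : ∀ y, HasDerivAt (fun y => p.E * Real.exp y) (p.E * Real.exp y) y := fun y =>
    (Real.hasDerivAt_exp y).const_mul p.E
  have de : ∀ y, HasDerivAt (fun y => Real.exp (-p.α * y - p.β * τ))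
      (Real.exp (-p.α * y - p.β * τ) * -p.α) y := fun y =>
    ((((hasDerivAt_id y).const_mul (-p.α)).sub_const (p.β * τ)).exp).congr_deriv (by simp)
  have c1 : ∀ y, HasDerivAt (fun y => f (p.E * Real.exp y))
      (deriv f (p.E * Real.exp y) * (p.E * Real.exp y)) y := fun y =>
    HasDerivAt.comp (h₂ := f) y (d1 y) (dS y)
  have c2 : ∀ y, HasDerivAt (fun y => deriv f (p.E * Real.exp y))
      (deriv (deriv f) (p.E * Real.exp y) * (p.E * Real.exp y)) y := fun y =>
    HasDerivAt.comp (h₂ := deriv f) y (d2 y) (dS y)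
  refine ⟨fun y => Real.exp (-p.α * y - p.β * τ) *
      (-p.α * f (p.E * Real.exp y) + p.E * Real.exp y * deriv f (p.E * Real.exp y)),
    fun y => Real.exp (-p.α * y - p.β * τ) * (p.α ^ 2 * f (p.E * Real.exp y)
      + (1 - 2 * p.α) * (p.E * Real.exp y) * deriv f (p.E * Real.exp y)
      + (p.E * Real.exp y) ^ 2 * deriv (deriv f) (p.E * Real.exp y)), ?_, ?_, ?_⟩
  · intro y
    exact ((de y).mul (c1 y)).congr_deriv (by ring)
  · intro y
    refine ((de y).mul (((c1 y).const_mul (-p.α)).add ((dS y).mul (c2 y)))).congr_deriv ?_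
    simp only [Pi.add_apply, Pi.mul_apply]
    ring
  · intro y
    have hVt : HasDerivAt (fun s => V₁ (p.E * Real.exp y) s)
        (deriv (fun s => V₁ (p.E * Real.exp y) s) t) t :=
      (hV.diff_time _ (hS y) t htI).hasDerivAt
    have h1 : HasDerivAt (fun s => V₁ (p.E * Real.exp y) (p.T - s))
        (deriv (fun s => V₁ (p.E * Real.exp y) s) t * (-1)) τ :=
      HasDerivAt.comp τ hVt ((hasDerivAt_id τ).const_sub p.T)
    have h2 : HasDerivAt (fun s => Real.exp (-p.α * y - p.β * s))
        (Real.exp (-p.α * y - p.β * τ) * -p.β) τ :=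
      ((((hasDerivAt_id τ).const_mul p.β).const_sub (-p.α * y)).exp).congr_deriv (by simp)
    refine (h2.mul h1).congr_deriv ?_
    have heq := hV.equation _ (hS y) t htI
    rw [L₀] at heq
    -- These two identities are the reason for the choice of `α` and `β`: they remove the terms in
    -- `V₁` and in `S ∂V₁/∂S`.
    have hr : p.σ ^ 2 / 2 * p.α ^ 2 + p.r = -p.β := by
      simp only [α, β]
      field_simp
      ring
    have hrq : p.σ ^ 2 / 2 * (1 - 2 * p.α) = p.r - p.q := by
      simp only [α]
      field_simp
      ring
    beta_reduce
    rw [← source_eq_L₁ hσ hE hV₀ y hτ.1]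
    linear_combination -Real.exp (-p.α * y - p.β * τ) * heq
      - Real.exp (-p.α * y - p.β * τ) * f (p.E * Real.exp y) * hr
      - Real.exp (-p.α * y - p.β * τ) * (p.E * Real.exp y) * deriv f (p.E * Real.exp y) * hrq


theorem continuousOn_transform (hE : 0 < p.E) {V₀ V₁ : ℝ → ℝ → ℝ}
    (hV : p.IsFirstOrderCorrection V₀ V₁) :
    ContinuousOn (Function.uncurry (p.transform V₁)) (univ ×ˢ Ioc 0 p.T) := by
  have h1 : ContinuousOn (fun z : ℝ × ℝ => V₁ (p.E * Real.exp z.1) (p.T - z.2))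
      (univ ×ˢ Ioc 0 p.T) :=
    hV.continuousOn.comp (f := fun z : ℝ × ℝ => (p.E * Real.exp z.1, p.T - z.2)) (by fun_prop)
      fun z hz => ⟨mul_pos hE (Real.exp_pos z.1),
        ⟨by have := hz.2.2; simp only; linarith, by have := hz.2.1; simp only; linarith⟩⟩
  have h2 : Continuous fun z : ℝ × ℝ => Real.exp (-p.α * z.1 - p.β * z.2) := by fun_prop
  exact h2.continuousOn.mul h1

theorem exists_abs_transform_le (hE : 0 < p.E) {V₁ : ℝ → ℝ → ℝ}
    (hgrow : ∃ M b : ℝ, ∀ S > 0, ∀ t ∈ Icc 0 p.T,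
      |V₁ S t| ≤ M * Real.exp (b * |Real.log S| ^ 2)) :
    ∃ M b : ℝ, 0 ≤ b ∧ ∀ x, ∀ τ ∈ Ioc 0 p.T, |p.transform V₁ x τ| ≤ M * Real.exp (b * x ^ 2) := by
  obtain ⟨M, b, h⟩ := hgrow
  set l := Real.log p.E with hl
  -- The rate `2|b|` comes from `(l + x)² ≤ 2l² + 2x²`, and the additional `1` absorbs `e^{-αx} ≤
  -- e^{α² + x²}`.
  refine ⟨|M| * Real.exp (p.α ^ 2 + |p.β| * p.T + 2 * |b| * l ^ 2), 2 * |b| + 1, by positivity,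
    fun x τ hτ => ?_⟩
  have hS : 0 < p.E * Real.exp x := by positivity
  have h1 := h _ hS (p.T - τ) ⟨by linarith [hτ.2], by linarith [hτ.1]⟩
  have hlog : Real.log (p.E * Real.exp x) = l + x := by
    rw [Real.log_mul hE.ne' (Real.exp_pos x).ne', Real.log_exp]
  rw [hlog, sq_abs] at h1
  rw [transform, abs_mul, abs_of_pos (Real.exp_pos _)]
  have e1 : M * Real.exp (b * (l + x) ^ 2) ≤ |M| * Real.exp (2 * |b| * l ^ 2 + 2 * |b| * x ^ 2) := by
    refine mul_le_mul (le_abs_self M) (Real.exp_le_exp.2 ?_) (Real.exp_pos _).le (abs_nonneg M)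
    have h2 : b * (l + x) ^ 2 ≤ |b| * (l + x) ^ 2 :=
      mul_le_mul_of_nonneg_right (le_abs_self b) (sq_nonneg _)
    nlinarith [mul_nonneg (abs_nonneg b) (sq_nonneg (l - x))]
  have e2 : Real.exp (-p.α * x - p.β * τ) ≤ Real.exp (p.α ^ 2 + |p.β| * p.T + x ^ 2) := by
    rw [Real.exp_le_exp]
    have h3 : -p.β * τ ≤ |p.β| * p.T :=
      mul_le_mul (neg_le_abs _) hτ.2 hτ.1.le (abs_nonneg _)
    nlinarith [sq_nonneg (p.α + x), sq_nonneg p.α, sq_nonneg x]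
  calc _ ≤ Real.exp (p.α ^ 2 + |p.β| * p.T + x ^ 2) *
        (|M| * Real.exp (2 * |b| * l ^ 2 + 2 * |b| * x ^ 2)) :=
        mul_le_mul e2 (h1.trans e1) (abs_nonneg _) (Real.exp_pos _).le
    _ = |M| * Real.exp ((p.α ^ 2 + |p.β| * p.T + 2 * |b| * l ^ 2) + (2 * |b| + 1) * x ^ 2) := by
        rw [mul_left_comm, ← Real.exp_add]
        congr 2
        ring
    _ = _ := by rw [Real.exp_add]; exact (mul_assoc _ _ _).symm

/-- A test function in the variable `x = ln (S / E)`, as a test function in the variable `S`. -/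
noncomputable def priceTest (p : Params) (φ : ℝ → ℝ) (S : ℝ) : ℝ :=
  if 0 < S then Real.exp (-p.α * Real.log (S / p.E)) * φ (Real.log (S / p.E)) / S else 0

theorem priceTest_eq_zero (hE : 0 < p.E) {φ : ℝ → ℝ} {R : ℝ} (hR : ∀ x, R < |x| → φ x = 0) {S : ℝ}
    (hS : S ∉ Icc (p.E * Real.exp (-R)) (p.E * Real.exp R)) : p.priceTest φ S = 0 := by
  rw [priceTest]
  split_ifs with h
  · rw [hR, mul_zero, zero_div]
    by_contra! hle
    obtain ⟨h1, h2⟩ := abs_le.1 hle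
    have h3 : S = p.E * Real.exp (Real.log (S / p.E)) := by
      rw [Real.exp_log (by positivity)]; field_simp
    refine hS ⟨?_, ?_⟩
    · rw [h3]
      exact mul_le_mul_of_nonneg_left (Real.exp_le_exp.2 h1) hE.le
    · rw [h3]
      exact mul_le_mul_of_nonneg_left (Real.exp_le_exp.2 h2) hE.le
  · rfl

/-- Only smoothness near `S = 0` is in question, and there the function vanishes identically because
`φ` has bounded support in `ln (S/E)`. -/
theorem contDiff_priceTest (hE : 0 < p.E) {φ : ℝ → ℝ} (hφ : ContDiff ℝ ∞ φ) {R : ℝ}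
    (hR : ∀ x, R < |x| → φ x = 0) : ContDiff ℝ ∞ (p.priceTest φ) := by
  rw [contDiff_iff_contDiffAt]
  intro S
  have hlow : 0 < p.E * Real.exp (-R) := by positivity
  rcases lt_or_ge S (p.E * Real.exp (-R)) with h | h
  · refine (contDiffAt_const (c := (0 : ℝ))).congr_of_eventuallyEq ?_
    filter_upwards [Iio_mem_nhds h] with y hy
    exact priceTest_eq_zero hE hR fun hy' => not_le.2 hy hy'.1
  · have hS : 0 < S := hlow.trans_le h
    have hlog : ContDiffAt ℝ ∞ (fun y => Real.log (y / p.E)) S :=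
      (contDiffAt_id.div_const p.E).log (by simp only [id]; positivity)
    refine ContDiffAt.congr_of_eventuallyEq (f := fun y =>
      Real.exp (-p.α * Real.log (y / p.E)) * φ (Real.log (y / p.E)) / y) ?_ ?_
    · exact (((contDiffAt_const.mul hlog).exp).mul (hφ.contDiffAt.comp S hlog)).div contDiffAt_id
        hS.ne'
    · filter_upwards [Ioi_mem_nhds hS] with y hy
      exact if_pos hy

/-- Under `S = E e^x` the Jacobian is `S`, which cancels the factor `1/S` in `priceTest`. -/
theorem integral_priceTest (hE : 0 < p.E) (φ : ℝ → ℝ) (V : ℝ → ℝ) :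
    ∫ S in Ioi 0, V S * p.priceTest φ S
      = ∫ x, Real.exp (-p.α * x) * V (p.E * Real.exp x) * φ x := by
  have himg : (fun x => p.E * Real.exp x) '' univ = Ioi 0 := by
    ext S
    refine ⟨?_, fun hS => ⟨Real.log (S / p.E), mem_univ _, ?_⟩⟩
    · rintro ⟨x, -, rfl⟩
      exact mul_pos hE (Real.exp_pos x)
    · have hS' : 0 < S := hS
      simp only
      rw [Real.exp_log (by positivity)]
      field_simp
  have hinj : InjOn (fun x => p.E * Real.exp x) univ := fun x _ y _ h =>
    Real.exp_injective (mul_left_cancel₀ hE.ne' h)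
  have h := integral_image_eq_integral_abs_deriv_smul MeasurableSet.univ
    (fun x _ => ((Real.hasDerivAt_exp x).const_mul p.E).hasDerivWithinAt) hinj
    (fun S => V S * p.priceTest φ S)
  rw [himg, setIntegral_univ] at h
  rw [h]
  congr 1
  ext x
  have hS : 0 < p.E * Real.exp x := by positivity
  rw [priceTest, if_pos hS, abs_of_pos hS, mul_div_cancel_left₀ _ hE.ne', Real.log_exp, smul_eq_mul]
  field_simp

theorem tendsto_integral_transform (hE : 0 < p.E) {V₀ V₁ : ℝ → ℝ → ℝ}
    (hV : p.IsFirstOrderCorrection V₀ V₁) {φ : ℝ → ℝ} (hφ : ContDiff ℝ ∞ φ)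
    (hc : HasCompactSupport φ) :
    Tendsto (fun τ => ∫ x, p.transform V₁ x τ * φ x) (𝓝[>] 0) (𝓝 0) := by
  obtain ⟨R, hR⟩ : ∃ R, ∀ x, R < |x| → φ x = 0 := by
    obtain ⟨R, hR⟩ := hc.isCompact.isBounded.subset_closedBall 0
    refine ⟨R, fun x hx => image_eq_zero_of_notMem_tsupport fun h => ?_⟩
    have := hR h
    rw [mem_closedBall_zero_iff, Real.norm_eq_abs] at this
    linarith
  have hzero : ∀ S, S ∉ Icc (p.E * Real.exp (-R)) (p.E * Real.exp R) → p.priceTest φ S = 0 :=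
    fun S hS => priceTest_eq_zero hE hR hS
  have hsub : tsupport (p.priceTest φ) ⊆ Icc (p.E * Real.exp (-R)) (p.E * Real.exp R) :=
    closure_minimal (fun S hS => by_contra fun h => hS (hzero S h)) isClosed_Icc
  have h := hV.terminal_limit (p.priceTest φ) (contDiff_priceTest hE hφ hR)
    (HasCompactSupport.intro isCompact_Icc hzero)
    (hsub.trans fun S hS => (mul_pos hE (Real.exp_pos (-R))).trans_le hS.1)
  have hsubT : Tendsto (fun τ => p.T - τ) (𝓝[>] 0) (𝓝[<] p.T) := by
    refine tendsto_nhdsWithin_iff.2 ⟨?_, ?_⟩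
    · have : Tendsto (fun τ => p.T - τ) (𝓝 0) (𝓝 (p.T - 0)) := tendsto_const_nhds.sub tendsto_id
      rw [sub_zero] at this
      exact this.mono_left nhdsWithin_le_nhds
    · filter_upwards [self_mem_nhdsWithin] with τ hτ
      have : 0 < τ := hτ
      exact mem_Iio.2 (by linarith)
  have hexp : Tendsto (fun τ => Real.exp (-p.β * τ)) (𝓝[>] 0) (𝓝 (Real.exp (-p.β * 0))) := by
    have hcont : Continuous fun τ => Real.exp (-p.β * τ) := by fun_prop
    exact (hcont.tendsto 0).mono_left nhdsWithin_le_nhds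
  have h2 := hexp.mul (h.comp hsubT)
  rw [mul_zero] at h2
  refine h2.congr fun τ => ?_
  simp only [Function.comp_apply]
  rw [integral_priceTest hE φ (fun S => V₁ S (p.T - τ)), ← integral_const_mul]
  congr 1
  ext x
  rw [transform, show -p.α * x - p.β * τ = -p.β * τ + -p.α * x by ring, Real.exp_add]
  ring

/-! ### The price kernel -/

/-- The factor that turns `priceKernel` into `kernel`. -/
noncomputable def kernelFactor (p : Params) (x τ : ℝ) : ℝ :=
  Real.exp (p.P * x / (1 - p.δ) + p.P ^ 2 * p.σ ^ 2 * τ / (2 * (1 - p.δ) ^ 2)) /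
    (2 * Real.pi * p.σ ^ 2) ^ (p.δ / 2)

theorem kernelFactor_pos (hσ : 0 < p.σ) (x τ : ℝ) : 0 < p.kernelFactor x τ :=
  div_pos (Real.exp_pos _) (Real.rpow_pos_of_pos (by positivity) _)

theorem kernel_eq_priceKernel (S t ξ : ℝ) :
    p.kernel (Real.log (S / p.E)) (p.T - t) ξ =
      p.kernelFactor (Real.log (S / p.E)) (p.T - t) * p.priceKernel S t ξ := by
  simp only [kernel, kernelFactor, priceKernel, Lam, Q, K, M]
  rw [show p.γ - p.δ - p.α * (1 - p.δ) = p.P from rfl]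
  generalize Real.log (S / p.E) = x
  generalize p.T - t = τ
  generalize 1 / (p.δ * τ + (1 - p.δ) * ξ) = w
  have e : (p.P ^ 2 * p.σ ^ 2 / (2 * (p.δ - 1)) + p.β * (p.δ - 1)) * ξ
      + p.P * x / (1 - p.δ) + p.P ^ 2 * p.σ ^ 2 * τ / (2 * (1 - p.δ) ^ 2)
      - (p.δ * x ^ 2 / (2 * p.σ ^ 2) + p.P * x * p.δ * τ / (1 - p.δ)
          + p.P ^ 2 * p.σ ^ 2 * p.δ * τ ^ 2 / (2 * (1 - p.δ) ^ 2)) * w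
      = (p.P * x / (1 - p.δ) + p.P ^ 2 * p.σ ^ 2 * τ / (2 * (1 - p.δ) ^ 2))
        + ((p.P ^ 2 * p.σ ^ 2 / (2 * (p.δ - 1)) + p.β * (p.δ - 1)) * ξ
          - (p.δ / (2 * p.σ ^ 2) * x ^ 2 + p.P * p.δ * τ / (1 - p.δ) * x
            + p.P ^ 2 * p.σ ^ 2 * p.δ * τ ^ 2 / (2 * (1 - p.δ) ^ 2)) * w) := by ring
  rw [e, Real.exp_add]
  ring

/-- The exponent of `S/E` splits as `(γ-δ)/(1-δ) = α + P/(1-δ)`: the part `α` undoes the exponential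
factor of `transform`, the rest belongs to the kernel. -/
theorem priceFactor_eq (hE : 0 < p.E) (hδ1 : p.δ ≠ 1) {S : ℝ} (hS : 0 < S) (t : ℝ) :
    p.priceFactor S t = Real.exp (p.α * Real.log (S / p.E) + p.β * (p.T - t)) *
      (p.E ^ p.γ * p.kernelFactor (Real.log (S / p.E)) (p.T - t)) := by
  have h1 : 1 - p.δ ≠ 0 := sub_ne_zero.2 (Ne.symm hδ1)
  simp only [priceFactor, kernelFactor]
  rw [Real.rpow_def_of_pos (x := S / p.E) (by positivity)]
  have hP : (p.γ - p.δ) / (1 - p.δ) = p.α + p.P / (1 - p.δ) := by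
    rw [P]; field_simp; ring
  rw [hP, show p.γ - p.δ - p.α * (1 - p.δ) = p.P from rfl]
  generalize Real.log (S / p.E) = x
  generalize p.T - t = τ
  have e : x * (p.α + p.P / (1 - p.δ)) + (p.β + p.P ^ 2 * p.σ ^ 2 / (2 * (1 - p.δ) ^ 2)) * τ
      = (p.α * x + p.β * τ)
        + (p.P * x / (1 - p.δ) + p.P ^ 2 * p.σ ^ 2 * τ / (2 * (1 - p.δ) ^ 2)) := by ring
  rw [mul_assoc, ← Real.exp_add, e, Real.exp_add]
  ring

theorem intervalIntegrable_priceKernel (hσ : 0 < p.σ) {S t ε : ℝ}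
    (h : IntervalIntegrable (p.kernel (Real.log (S / p.E)) (p.T - t)) volume ε (p.T - t)) :
    IntervalIntegrable (p.priceKernel S t) volume ε (p.T - t) := by
  have hc := kernelFactor_pos hσ (Real.log (S / p.E)) (p.T - t)
  refine (h.const_mul (p.kernelFactor (Real.log (S / p.E)) (p.T - t))⁻¹).congr fun ξ _ => ?_
  rw [kernel_eq_priceKernel, ← mul_assoc, inv_mul_cancel₀ hc.ne', one_mul]

theorem IsFirstOrderCorrection.eqMulIntegral (hσ : 0 < p.σ) (hE : 0 < p.E) (hδ0 : 0 ≤ p.δ)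
    (hδ1 : p.δ ≠ 1) (hA : ContinuousOn p.A (Ioc 0 p.T)) {V₀ V₁ : ℝ → ℝ → ℝ}
    (hV₀ : V₀ = p.call ∨ V₀ = p.put) (hV : p.IsFirstOrderCorrection V₀ V₁)
    (hgrow : ∃ M b : ℝ, ∀ S > 0, ∀ t ∈ Icc 0 p.T,
      |V₁ S t| ≤ M * Real.exp (b * |Real.log S| ^ 2)) {S t : ℝ} (hS : 0 < S) (ht : t ∈ Ico 0 p.T) :
    EqMulIntegral (V₁ S t) (p.priceFactor S t) (p.priceKernel S t) (p.T - t) := by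
  obtain ⟨M, b, hb, hM⟩ := exists_abs_transform_le hE hgrow
  have hτ : p.T - t ∈ Ioc 0 p.T := ⟨by linarith [ht.2], by linarith [ht.1]⟩
  set x := Real.log (S / p.E) with hx
  have h := eqMulIntegral_of_heatAt hσ hδ0 hδ1 hA hb (continuousOn_transform hE hV)
    (fun τ hτ => heatAt_transform hσ hE hV₀ hV hτ) hM
    (fun φ hφ hc => tendsto_integral_transform hE hV hφ hc) x hτ
  refine eqMulIntegral_of_tendsto hτ.1
    (fun ε hε => intervalIntegrable_priceKernel hσ (h.1 ε hε)) ?_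
  have hSx : p.E * Real.exp x = S := by
    rw [hx, Real.exp_log (by positivity)]; field_simp
  have hval : Real.exp (p.α * x + p.β * (p.T - t)) * p.transform V₁ x (p.T - t) = V₁ S t := by
    rw [transform, sub_sub_cancel, hSx, ← mul_assoc, ← Real.exp_add,
      show p.α * x + p.β * (p.T - t) + (-p.α * x - p.β * (p.T - t)) = 0 by ring, Real.exp_zero,
      one_mul]
  have h2 := h.2.1.const_mul (Real.exp (p.α * x + p.β * (p.T - t)))
  rw [hval] at h2
  refine h2.congr fun ε => ?_
  have hint : ∫ ξ in ε..(p.T - t), p.kernel x (p.T - t) ξ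
      = p.kernelFactor x (p.T - t) * ∫ ξ in ε..(p.T - t), p.priceKernel S t ξ := by
    rw [← intervalIntegral.integral_const_mul]
    exact intervalIntegral.integral_congr fun ξ _ => kernel_eq_priceKernel S t ξ
  rw [hint, priceFactor_eq hE hδ1 hS]
  ring

end Params

end NonlinearBS

theorem theorem2p1 (p : NonlinearBS.Params) (hσ : 0 < p.σ) (hE : 0 < p.E)
    (hδ0 : 0 ≤ p.δ) (hδ1 : p.δ ≠ 1) (hA : ContinuousOn p.A (Set.Ioc 0 p.T)) :
    (∀ u : ℝ → ℝ → ℝ, p.IsSolution u →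
      (∃ M b : ℝ, ∀ x : ℝ, ∀ τ ∈ Set.Icc 0 p.T, |u x τ| ≤ M * Real.exp (b * |x| ^ 2)) →
      ∀ x : ℝ, ∀ τ ∈ Set.Ioc 0 p.T,
        NonlinearBS.EqMulIntegral (u x τ) (p.E ^ p.γ) (p.kernel x τ) τ) ∧
    (∀ V₀ V₁ : ℝ → ℝ → ℝ, (V₀ = p.call ∨ V₀ = p.put) → p.IsFirstOrderCorrection V₀ V₁ →
      (∃ M b : ℝ, ∀ S > 0, ∀ t ∈ Set.Icc 0 p.T,
        |V₁ S t| ≤ M * Real.exp (b * |Real.log S| ^ 2)) →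
      ∀ S > 0, ∀ t ∈ Set.Ico 0 p.T,
        NonlinearBS.EqMulIntegral (V₁ S t) (p.priceFactor S t) (p.priceKernel S t) (p.T - t)) ∧
    (p.δ < 3 → (∃ C : ℝ, ∀ ξ ∈ Set.Ioc 0 p.T, |p.A ξ| ≤ C) →
      (∀ x : ℝ, ∀ τ ∈ Set.Ioc 0 p.T,
        IntervalIntegrable (p.kernel x τ) MeasureTheory.volume 0 τ) ∧
      (∀ S > 0, ∀ t ∈ Set.Ico 0 p.T,
        IntervalIntegrable (p.priceKernel S t) MeasureTheory.volume 0 (p.T - t))) := by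
  refine ⟨fun u hu hgrow x τ hτ => hu.eqMulIntegral hσ hδ0 hδ1 hA hgrow x hτ,
    fun V₀ V₁ hV₀ hV hgrow S hS t ht => hV.eqMulIntegral hσ hE hδ0 hδ1 hA hV₀ hgrow hS ht,
    fun hδ3 hAb => ⟨fun x τ hτ =>
      NonlinearBS.Params.intervalIntegrable_kernel_zero hσ hδ0 hδ1 hδ3 hA hAb x hτ,
      fun S _ t ht => ?_⟩⟩
  exact NonlinearBS.Params.intervalIntegrable_priceKernel hσ
    (NonlinearBS.Params.intervalIntegrable_kernel_zero hσ hδ0 hδ1 hδ3 hA hAb _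
      ⟨by linarith [ht.2], by linarith [ht.1]⟩)
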